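/- **Theorem (existence of minimizers for the $L^2$-momentum-regularized measure matching problem).** Let $d\ge 0$, let $\Omega\subseteq\mathbb R^d$ be closed (for instance compact, or $\Omega=\mathbb R^d$), and let $\mathcal P(\Omega)$ be the set of Borel probability measures on $\mathbb R^d$ concentrated on $\Omega$, with the topology of weak (narrow) convergence. Let $K(x,y)=-|x-y|$ be the Energy-Distance kernel. Let $\mu^0\in\mathcal P(\Omega)$ be concentrated on a compact subset of $\Omega$ (no other condition is imposed on the initial measure), let $\nu\in\mathcal P(\Omega)$, and let $\mathcal L:\mathcal P(\Omega)\times\mathcal P(\Omega)\to[0,\infty]$ be a loss such that $\alpha\mapsto\mathcal L(\alpha,\nu)$ is lower semicontinuous on $\mathcal P(\Omega)$. Call a pair $(\mu,\gamma)$ *admissible* if * $\mu=(\mu_t)_{t\in[0,1]}\in AC^2([0,1],\mathcal P(C))$ for some compact $C\subseteq\Omega$, that is, $\mu_t\in\mathcal P(C)$ for all $t\in[0,1]$ and there is $m\in L^2(0,1)$ with $W_2(\mu_s,\mu_t)\le\int_s^t |m(r)|\,dr$ for all $0\le s\le t\le1$, where $W_2$ is the quadratic Wasserstein distance (if $\Omega$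 is compact this is just $\mu\in AC^2([0,1],\mathcal P(\Omega))$); * $\mu_{t}=\mu^0$ at $t=0$; * $\gamma\in L^2([0,1],L^2(\mu_t))$, that is, $\gamma:[0,1]\times\mathbb R^d\to\mathbb R^d$ is Borel and $\int_0^1\|\gamma_t\|^2_{L^2(\mu_t)}\,dt<\infty$; * for almost every $t\in[0,1]$ the momentum measure $\Gamma_t:=\gamma_t\mu_t$ has zero total mass, $\int\gamma_t\,d\mu_t=0$; * the continuity equation $\partial_t\mu_t+\nabla\cdot(v_t\mu_t)=0$ holds in the sense of distributions on $(0,1)\times\mathbb R^d$, with velocity $v_t=K\star\Gamma_t$, i.e. $v_t(x)=-\int|x-y|\,\gamma_t(y)\,d\mu_t(y)$. Then the problem of minimizing $$E(\mu,\gamma)=\mathcal L(\mu_1,\nu)+\int_0^1\langle\Gamma_t,K\star\Gamma_t\rangle\,dt+\int_0^1\|\gamma_t\|^2_{L^2(\mu_t)}\,dt$$ over all admissible pairs has a solution: there is an admissible pair $(\mu,\gamma)$ with $E(\mu,\gamma)\le E(\mu',\gamma')$ for every admissible pair $(\mu',\gamma')$. Here $\langle\Gamma_t,K\star\Gamma_t\rangle=-\iint|x-y|\,\gamma_t(x)\cdot\gamma_t(y)\,d\mu_t(x)\,d\mu_t(y)$.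 -/

import Mathlib

open MeasureTheory Set
open scoped ENNReal ContDiff

namespace MomentumMatching

/-- The Euclidean space `ℝᵈ`. -/
abbrev E (d : ℕ) : Type := EuclideanSpace ℝ (Fin d)

variable {d : ℕ}

/-- `𝒫(Ω)`: the Borel probability measures on `ℝᵈ` that are concentrated on `Ω`. As a subset of
`ProbabilityMeasure (E d)` it carries the topology of weak (narrow) convergence. -/
def probOn (Ω : Set (E d)) : Set (ProbabilityMeasure (E d)) :=
  {α | (α : Measure (E d)) Ωᶜ = 0}

/-- The quadratic Wasserstein distance: the infimum, over the couplings `π` of `α` and `β`, of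
`(∫ |x - y|² dπ(x, y)) ^ (1/2)`. -/
noncomputable def W2 (α β : ProbabilityMeasure (E d)) : ℝ≥0∞ :=
  ⨅ π : {π : Measure (E d × E d) //
      π.map Prod.fst = (α : Measure (E d)) ∧ π.map Prod.snd = (β : Measure (E d))},
    (∫⁻ z, edist z.1 z.2 ^ 2 ∂(π : Measure (E d × E d))) ^ (1 / 2 : ℝ)

/-- `μ ∈ AC²([0,1], 𝒫(C))` (used for compact `C`): every `μ_t`, `t ∈ [0,1]`, lies in `𝒫(C)`, and
there is `m ∈ L²(0,1)` with `W₂(μ_s, μ_t) ≤ ∫_s^t |m|` for all `0 ≤ s ≤ t ≤ 1`.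
The values of `μ` outside of `[0,1]` play no role. -/
def IsAC2Curve (C : Set (E d)) (μ : ℝ → ProbabilityMeasure (E d)) : Prop :=
  (∀ t ∈ Icc (0 : ℝ) 1, μ t ∈ probOn C) ∧
  ∃ m : ℝ → ℝ, MemLp m 2 (volume.restrict (Icc (0 : ℝ) 1)) ∧
    ∀ s t : ℝ, 0 ≤ s → s ≤ t → t ≤ 1 → W2 (μ s) (μ t) ≤ ∫⁻ r in Icc s t, ‖m r‖ₑ

/-- The Energy-Distance kernel `K(x, y) = -|x - y|`. -/
noncomputable def edKernel (x y : E d) : ℝ := -‖x - y‖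

/-- `K ⋆ Γ` for the vector-valued measure `Γ = g α`, that is `x ↦ ∫ K(x, y) g(y) dα(y)`. -/
noncomputable def edConv (α : ProbabilityMeasure (E d)) (g : E d → E d) (x : E d) : E d :=
  ∫ y, edKernel x y • g y ∂(α : Measure (E d))

/-- `⟨Γ, K ⋆ Γ⟩` for the vector-valued measure `Γ = g α`. -/
noncomputable def edEnergy (α : ProbabilityMeasure (E d)) (g : E d → E d) : ℝ :=
  ∫ x, inner ℝ (g x) (edConv α g x) ∂(α : Measure (E d))

/-- `γ ∈ L²([0,1], L²(μ_t))`; `γ` stands for a jointly Borel representative `(t, x) ↦ γ_t(x)`. -/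
def IsL2Momentum (μ : ℝ → ProbabilityMeasure (E d)) (γ : ℝ → E d → E d) : Prop :=
  Measurable (Function.uncurry γ) ∧
  ∫⁻ t in Icc (0 : ℝ) 1, ∫⁻ x, ‖γ t x‖ₑ ^ 2 ∂(μ t : Measure (E d)) < ⊤

/-- `∂_t μ_t + ∇ · (v_t μ_t) = 0` in the sense of distributions on `(0,1) × ℝᵈ`. -/
def ContinuityEquation (μ : ℝ → ProbabilityMeasure (E d)) (v : ℝ → E d → E d) : Prop :=
  ∀ φ : ℝ × E d → ℝ, ContDiff ℝ ∞ φ → HasCompactSupport φ →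
    tsupport φ ⊆ Ioo (0 : ℝ) 1 ×ˢ (univ : Set (E d)) →
    ∫ t in (0 : ℝ)..1, ∫ x, (deriv (fun s => φ (s, x)) t
      + inner ℝ (v t x) (gradient (fun y => φ (t, y)) x)) ∂(μ t : Measure (E d)) = 0

/-- The competitors `(μ, γ)` of the matching problem with initial measure `μ₀`, for measures on
`Ω`. -/
structure Admissible (Ω : Set (E d)) (μ₀ : ProbabilityMeasure (E d))
    (μ : ℝ → ProbabilityMeasure (E d)) (γ : ℝ → E d → E d) : Prop where
  /-- The curve starts from the prescribed initial measure. -/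
  initial : μ 0 = μ₀
  /-- `μ ∈ AC²([0,1], 𝒫(C))` for some compact `C ⊆ Ω` (one can take `C = Ω` if `Ω` is compact). -/
  curve : ∃ C ⊆ Ω, IsCompact C ∧ IsAC2Curve C μ
  /-- `γ ∈ L²([0,1], L²(μ_t))`. -/
  momentum : IsL2Momentum μ γ
  /-- The momentum measure `Γ_t = γ_t μ_t` has zero total mass, for almost every `t`. -/
  zeroMean : ∀ᵐ t ∂(volume.restrict (Icc (0 : ℝ) 1)), ∫ x, γ t x ∂(μ t : Measure (E d)) = 0
  /-- The continuity equation with velocity `v_t = K ⋆ (γ_t μ_t)`. -/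
  continuity : ContinuityEquation μ (fun t => edConv (μ t) (γ t))

/-- The energy `ℒ(μ₁, ν) + ∫₀¹ ⟨Γ_t, K ⋆ Γ_t⟩ dt + ∫₀¹ ‖γ_t‖²_{L²(μ_t)} dt`, with
`Γ_t = γ_t μ_t`. -/
noncomputable def energy (L : ProbabilityMeasure (E d) → ProbabilityMeasure (E d) → ℝ≥0∞)
    (ν : ProbabilityMeasure (E d)) (μ : ℝ → ProbabilityMeasure (E d)) (γ : ℝ → E d → E d) :
    EReal :=
  (L (μ 1) ν : EReal)
    + (((∫ t in (0 : ℝ)..1, edEnergy (μ t) (γ t))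
      + ∫ t in (0 : ℝ)..1, ∫ x, ‖γ t x‖ ^ 2 ∂(μ t : Measure (E d)) : ℝ) : EReal)

end MomentumMatching

open MomentumMatching

/-! The proof is the direct method; the work lies in coercivity and compactness, since `Ω` may be
unbounded and the velocity depends on the unknown measure.

Coercivity. Up to a factor, `|x - y|` on a ball is a constant minus an average over half-spaces of
products of their indicators at `x` and `y` (`exists_mul_norm_sub_eq`). On vector measures of zero
mass the constant drops out, so the interaction becomes an `L²` inner product of half-space features
(`exists_integral_inner_edConv_eq`). Hence it is nonnegative, and the energy controls `∫ ‖γ_t‖² dt`.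

Confinement. Zero mass also lets the kernel be replaced by `|x| - |x - y|`, which is bounded by
`|y|`; so the speed is at most `ρ_t ‖γ_t‖`, with `ρ_t²` the second moment of `μ_t`, uniformly in `x`
(`norm_edConv_le_mul`). A speed bound `V` yields a coupling of `μ_s` and `μ_t` that moves no point
by more than `∫ V` (`HasSpeedBound.exists_coupling`). By Strassen duality this reduces to `∫ g dμ_s
≤ ∫ Q g dμ_t`, where `Q g` is the supremum of `g` over balls of radius `∫ V`. These suprema form the
Hopf–Lax semigroup of `∂_r w = |∇w|`, and mollified subsolutions of this equation increase along the
curve. The support radius is therefore at most `R₀ + ∫ ρ ‖γ‖` and bounds `ρ` in turn, so Gronwall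
confines all competitors of bounded energy to one ball (`exists_uniform_radius`).

Compactness. In a fixed ball the couplings give equicontinuity, hence a limit curve along an
ultrafilter (`exists_curveLimit`). Pairings of the momenta with continuous fields converge to a
functional bounded by the `L²` norm of the limit space-time measure, and the Riesz theorem produces
the limit momentum (`exists_tendsto_pairing`). Zero mass passes to the limit directly. In the
continuity equation, symmetry of the kernel moves the convolution onto `∇φ`; the term becomes a
pairing of `γ` with a uniformly convergent field. The interaction is lower semicontinuous because
positive definiteness gives `2⟨Γ_i, K ⋆ G⟩ ≤ ⟨Γ_i, K ⋆ Γ_i⟩ + ⟨G, K ⋆ G⟩`, nearly an equality in the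
limit if `G` comes from a continuous zero-mean approximation of the limit momentum
(`CurveLimit.integral_edEnergy_le`). The couplings finally show that the limit curve is in `AC²`. -/

namespace MomentumMatching

open Filter Topology CompactlySupported ProbabilityTheory
open scoped Convolution

set_option maxSynthPendingDepth 3

/-! ### Duality: functionals on subspaces and couplings on compact spaces. -/

section

/-- A functional that vanishes on the kernel of `T` factors through its range. This allows
functionals to be prescribed through non-injective parametrizations. -/
theorem exists_section_of_forall_eq_zero {A V : Type*} [AddCommGroup A] [Module ℝ A]
    [AddCommGroup V] [Module ℝ V] (T : A →ₗ[ℝ] V) (l : A →ₗ[ℝ] ℝ)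
    (h : ∀ a, T a = 0 → l a = 0) :
    ∃ f : LinearMap.range T →ₗ[ℝ] ℝ, ∀ a, f ⟨T a, a, rfl⟩ = l a := by
  obtain ⟨s, hs⟩ := LinearMap.exists_rightInverse_of_surjective T.rangeRestrict
    T.range_rangeRestrict
  refine ⟨l ∘ₗ s, fun a => ?_⟩
  have h1 : T (s ⟨T a, a, rfl⟩) = T a :=
    congrArg Subtype.val (LinearMap.congr_fun hs ⟨T a, a, rfl⟩)
  have h2 := h (s ⟨T a, a, rfl⟩ - a) (by rw [map_sub, h1, sub_self])
  rw [map_sub, sub_eq_zero] at h2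
  exact h2

/-- A bounded linear functional on a subspace of a Hilbert space is represented by a vector. -/
theorem exists_inner_eq_of_abs_le {A H : Type*} [AddCommGroup A] [Module ℝ A]
    [NormedAddCommGroup H] [InnerProductSpace ℝ H] [CompleteSpace H] (T : A →ₗ[ℝ] H)
    (l : A →ₗ[ℝ] ℝ) {M : ℝ} (hM : 0 ≤ M) (h : ∀ a, |l a| ≤ M * ‖T a‖) :
    ∃ w : H, ‖w‖ ≤ M ∧ ∀ a, l a = inner ℝ w (T a) := by
  obtain ⟨f, hf⟩ := exists_section_of_forall_eq_zero T l fun a ha => by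
    simpa [ha] using h a
  obtain ⟨g, hg, hg'⟩ := exists_extension_norm_eq (LinearMap.range T)
    (f.mkContinuous M (by rintro ⟨_, a, rfl⟩; rw [hf]; exact h a))
  refine ⟨(InnerProductSpace.toDual ℝ H).symm g, ?_, fun a => ?_⟩
  · rw [LinearIsometryEquiv.norm_map, hg']
    exact LinearMap.mkContinuous_norm_le _ hM _
  · rw [InnerProductSpace.toDual_symm_apply]
    have := hg ⟨T a, a, rfl⟩
    rw [this, LinearMap.mkContinuous_apply, hf]

/-- A form of Strassen's theorem on a compact metric space: a coupling concentrated on a closed set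
exists as soon as the dual inequality holds. -/
theorem exists_coupling_of_dual {X : Type*} [MetricSpace X] [CompactSpace X] [MeasurableSpace X]
    [BorelSpace X] (α β : Measure X) [IsProbabilityMeasure α] [IsProbabilityMeasure β]
    {D : Set (X × X)} (hD : IsClosed D)
    (h : ∀ φ ψ : C(X, ℝ), (∀ z ∈ D, 0 ≤ φ z.1 + ψ z.2) →
      0 ≤ ∫ x, φ x ∂α + ∫ x, ψ x ∂β) :
    ∃ π : Measure (X × X), π.map Prod.fst = α ∧ π.map Prod.snd = β ∧ π Dᶜ = 0 := by
  have h_int : ∀ (μ : Measure X) [IsProbabilityMeasure μ] (f : C(X, ℝ)), Integrable f μ :=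
    fun μ _ f => (BoundedContinuousFunction.mkOfCompact f).integrable μ
  -- On functions `φ(x) + ψ(y)` a coupling must act as `l`. The dual inequality makes `l` well
  -- defined and positive there; the coupling is a positive extension.
  let T : (C(X, ℝ) × C(X, ℝ)) →ₗ[ℝ] C(X × X, ℝ) :=
    { toFun := fun p => p.1.comp ContinuousMap.fst + p.2.comp ContinuousMap.snd
      map_add' := fun p q => by ext z; simp; ring
      map_smul' := fun c p => by ext z; simp }
  let l : (C(X, ℝ) × C(X, ℝ)) →ₗ[ℝ] ℝ :=
    { toFun := fun p => ∫ x, p.1 x ∂α + ∫ x, p.2 x ∂β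
      map_add' := fun p q => by
        simp only [Prod.fst_add, Prod.snd_add, ContinuousMap.add_apply]
        rw [integral_add (h_int _ _) (h_int _ _), integral_add (h_int _ _) (h_int _ _)]; ring
      map_smul' := fun c p => by
        simp only [Prod.smul_fst, Prod.smul_snd, ContinuousMap.smul_apply, integral_smul,
          RingHom.id_apply, smul_add] }
  have hl : ∀ p, (∀ z ∈ D, 0 ≤ T p z) → 0 ≤ l p := fun p hp => h p.1 p.2 hp
  obtain ⟨f, hf⟩ := exists_section_of_forall_eq_zero T l fun p hp => by
    apply le_antisymm
    · have := hl (-p) fun z _ => by rw [map_neg, hp]; simp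
      rw [map_neg] at this; linarith
    · exact hl p fun z _ => by rw [hp]; simp
  -- Positivity is demanded on `D` only: the extension is then blind to values off `D`, which forces
  -- the measure onto `D`.
  let s : PointedCone ℝ C(X × X, ℝ) :=
    { carrier := {g | ∀ z ∈ D, 0 ≤ g z}
      add_mem' := fun ha hb z hz => add_nonneg (ha z hz) (hb z hz)
      zero_mem' := fun z _ => le_rfl
      smul_mem' := fun c g hg z hz => mul_nonneg c.2 (hg z hz) }
  obtain ⟨Λ, hΛ, hΛs⟩ := riesz_extension s ⟨LinearMap.range T, f⟩
    (by rintro ⟨_, p, rfl⟩ hp; exact (hl p hp).trans_eq (hf p).symm)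
    (fun y => ⟨⟨_, (ContinuousMap.const X ‖y‖, 0), rfl⟩, fun z _ => by
      have := (abs_le.1 (y.norm_coe_le_norm z)).1
      change 0 ≤ (‖y‖ + 0) + y z
      linarith⟩)
  have hΛT : ∀ p, Λ (T p) = l p := fun p => (hΛ ⟨T p, p, rfl⟩).trans (hf p)
  let Λc : C_c(X × X, ℝ) →ₗ[ℝ] ℝ :=
    { toFun := fun g => Λ g.toContinuousMap
      map_add' := fun a b => Λ.map_add a.toContinuousMap b.toContinuousMap
      map_smul' := fun c a => Λ.map_smul c a.toContinuousMap }
  let Λp : C_c(X × X, ℝ) →ₚ[ℝ] ℝ := PositiveLinearMap.mk₀ Λc fun g hg => hΛs _ fun z _ => hg z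
  let π := RealRMK.rieszMeasure Λp
  have hπ : ∀ g : C(X × X, ℝ), ∫ z, g z ∂π = Λ g := fun g =>
    RealRMK.integral_rieszMeasure Λp (CompactlySupportedContinuousMap.continuousMapEquiv g)
  have : IsFiniteMeasure π := ⟨isCompact_univ.measure_lt_top⟩
  refine ⟨π, ?_, ?_, ?_⟩
  · refine ext_of_forall_integral_eq_of_IsFiniteMeasure fun φ => ?_
    rw [integral_map measurable_fst.aemeasurable φ.continuous.aestronglyMeasurable]
    have := hΛT (φ.toContinuousMap, 0)
    rw [← hπ] at this
    simpa [T, l] using this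
  · refine ext_of_forall_integral_eq_of_IsFiniteMeasure fun φ => ?_
    rw [integral_map measurable_snd.aemeasurable φ.continuous.aestronglyMeasurable]
    have := hΛT (0, φ.toContinuousMap)
    rw [← hπ] at this
    simpa [T, l] using this
  · rcases D.eq_empty_or_nonempty with rfl | hne
    -- For empty `D` the dual hypothesis is contradictory: the pair `(-1, 0)` satisfies the
    -- constraint vacuously and has integral `-1`.
    · have := h (ContinuousMap.const X (-1)) 0 (by simp)
      simp at this
      linarith
    -- The distance to `D` and its negative both lie in the cone, so the distance has integral zero.
    let g : C(X × X, ℝ) := ⟨fun z => Metric.infDist z D, Metric.continuous_infDist_pt D⟩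
    have hgD : ∀ z ∈ D, g z = 0 := fun z hz => Metric.infDist_zero_of_mem hz
    have h0 : ∫ z, g z ∂π = 0 := by
      rw [hπ]
      apply le_antisymm
      · have := hΛs (-g) fun z hz => by simp [hgD z hz]
        rw [map_neg] at this; linarith
      · exact hΛs g fun z hz => (hgD z hz).ge
    rw [integral_eq_zero_iff_of_nonneg (fun z => show 0 ≤ g z from Metric.infDist_nonneg)
      ((BoundedContinuousFunction.mkOfCompact g).integrable π)] at h0
    have : ∀ᵐ z ∂π, z ∈ D := by
      filter_upwards [h0] with z hz
      exact (hD.mem_iff_infDist_zero hne).2 hz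
    exact this

end

/-! ### Conditional positive definiteness of the energy distance by half-space slicing. -/

section

variable {d : ℕ}

theorem integrable_abs_inner_closedBall (z : E d) :
    Integrable (fun w => |inner ℝ z w|) (volume.restrict (Metric.closedBall (0 : E d) 1)) :=
  ContinuousOn.integrableOn_compact (isCompact_closedBall 0 1) (by fun_prop)

theorem integral_inner_closedBall (z : E d) :
    ∫ w in Metric.closedBall (0 : E d) 1, inner ℝ z w = 0 := by
  have h := (LinearIsometryEquiv.measurePreserving (LinearIsometryEquiv.neg ℝ (E := E d)))
    |>.setIntegral_preimage_emb (LinearIsometryEquiv.neg ℝ).toHomeomorph.measurableEmbedding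
      (fun w => inner ℝ z w) (Metric.closedBall (0 : E d) 1)
  have h2 : (⇑(LinearIsometryEquiv.neg ℝ (E := E d))) ⁻¹' (Metric.closedBall (0 : E d) 1)
      = Metric.closedBall (0 : E d) 1 := by
    ext w; simp
  rw [h2] at h
  simp only [LinearIsometryEquiv.coe_neg, inner_neg_right, integral_neg] at h
  linarith

/-- The reflection in the hyperplane orthogonal to `x - y` carries `x` to `y` and preserves both the
ball and Lebesgue measure. -/
theorem integral_abs_inner_closedBall_congr {x y : E d} (h : ‖x‖ = ‖y‖) :
    ∫ w in Metric.closedBall (0 : E d) 1, |inner ℝ x w|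
      = ∫ w in Metric.closedBall (0 : E d) 1, |inner ℝ y w| := by
  let ρ := (Submodule.span ℝ {x - y})ᗮ.reflection
  have hρ : ρ x = y := Submodule.reflection_sub h
  have h1 := ρ.measurePreserving.setIntegral_preimage_emb ρ.toHomeomorph.measurableEmbedding
      (fun w => |inner ℝ y w|) (Metric.closedBall (0 : E d) 1)
  have h2 : ρ ⁻¹' (Metric.closedBall (0 : E d) 1) = Metric.closedBall (0 : E d) 1 := by
    ext w; simp
  rw [h2] at h1
  rw [← h1, ← hρ]
  simp only [LinearIsometryEquiv.inner_map_map]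

/-- The Euclidean norm is, up to a constant, an average of absolute values of linear forms. -/
theorem exists_mul_norm_eq_integral_abs_inner (d : ℕ) : ∃ c : ℝ, 0 < c ∧ ∀ z : E d,
    c * ‖z‖ = ∫ w in Metric.closedBall (0 : E d) 1, |inner ℝ z w| := by
  rcases subsingleton_or_nontrivial (E d) with hs | hn
  -- In dimension zero there is no unit vector; both sides vanish and any positive constant serves.
  · refine ⟨1, one_pos, fun z => ?_⟩
    rw [Subsingleton.elim z 0]; simp
  obtain ⟨e, he⟩ := exists_norm_eq (E d) zero_le_one
  refine ⟨∫ w in Metric.closedBall (0 : E d) 1, |inner ℝ e w|, ?_, fun z => ?_⟩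
  · refine (setIntegral_pos_iff_support_of_nonneg_ae (ae_of_all _ fun w => abs_nonneg _)
      (integrable_abs_inner_closedBall e)).2 ?_
    refine lt_of_lt_of_le ((IsOpen.measure_pos volume
      (U := Function.support (fun w => |inner ℝ e w|) ∩ Metric.ball (0 : E d) 1) ?_ ?_))
      (measure_mono (inter_subset_inter_right _ Metric.ball_subset_closedBall))
    · exact (Continuous.isOpen_support (by fun_prop)).inter Metric.isOpen_ball
    · refine ⟨(1 / 2 : ℝ) • e, ?_, ?_⟩
      · simp [inner_smul_right, he]
      · rw [mem_ball_zero_iff, norm_smul, he]; norm_num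
  · have h1 := integral_abs_inner_closedBall_congr (x := z) (y := ‖z‖ • e)
      (by rw [norm_smul, he]; simp)
    rw [h1, mul_comm, ← integral_const_mul]
    refine integral_congr_ae (ae_of_all _ fun w => ?_)
    simp [inner_smul_left, abs_mul]

/-- The indicator of the half-space `{y | θ.2 < ⟨y, θ.1⟩}`. -/
noncomputable def halfSpace (θ : E d × ℝ) (x : E d) : ℝ :=
  if θ.2 < inner ℝ x θ.1 then 1 else 0

/-- The measure on the parameters of half-spaces that slices balls of radius `R`. -/
noncomputable def sliceMeasure (d : ℕ) (R : ℝ) : Measure (E d × ℝ) :=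
  (volume.restrict (Metric.closedBall (0 : E d) 1)).prod (volume.restrict (Icc (-R) R))

instance (R : ℝ) : IsFiniteMeasure (volume.restrict (Metric.closedBall (0 : E d) R)) :=
  ⟨by simpa using (isCompact_closedBall (0 : E d) R).measure_lt_top⟩

instance (R : ℝ) : IsFiniteMeasure (sliceMeasure d R) := by
  unfold sliceMeasure; infer_instance

theorem measurable_halfSpace : Measurable fun p : (E d × ℝ) × E d => halfSpace p.1 p.2 := by
  unfold halfSpace
  refine Measurable.ite (measurableSet_lt ?_ ?_) measurable_const measurable_const
  · fun_prop
  · exact (Continuous.inner (by fun_prop) (by fun_prop)).measurable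

theorem abs_halfSpace_le (θ : E d × ℝ) (x : E d) : |halfSpace θ x| ≤ 1 := by
  unfold halfSpace; split_ifs <;> norm_num

/-- The integral is the length of `[-R, min a b)`, and `min a b = (a + b - |a - b|) / 2`. -/
theorem integral_Icc_ite_mul_ite {R a b : ℝ} (ha : |a| ≤ R) (hb : |b| ≤ R) :
    ∫ u in Icc (-R) R, (if u < a then (1 : ℝ) else 0) * (if u < b then 1 else 0)
      = (a + b + 2 * R - |a - b|) / 2 := by
  have h : (fun u => (if u < a then (1 : ℝ) else 0) * (if u < b then 1 else 0))
      = (Iio (min a b)).indicator 1 := by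
    ext u
    simp only [indicator, mem_Iio, lt_min_iff, Pi.one_apply]
    split_ifs <;> simp_all
  rw [h, integral_indicator_one measurableSet_Iio, measureReal_restrict_apply measurableSet_Iio]
  have h2 : Iio (min a b) ∩ Icc (-R) R = Ico (-R) (min a b) := by
    ext u
    simp only [mem_inter_iff, mem_Iio, mem_Icc, mem_Ico, lt_min_iff]
    have := (abs_le.1 ha).2
    constructor
    · rintro ⟨h1, h2, h3⟩; exact ⟨h2, h1⟩
    · rintro ⟨h1, h2⟩; exact ⟨h2, h1, by linarith [h2.1]⟩
  rw [h2, Real.volume_real_Ico_of_le (le_min (abs_le.1 ha).1 (abs_le.1 hb).1), min_def]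
  split_ifs with h3
  · rw [abs_of_nonpos (by linarith)]; ring
  · rw [abs_of_nonneg (by linarith)]; ring

theorem integrable_of_norm_le_one {X F : Type*} [MeasurableSpace X] {τ : Measure X}
    [NormedAddCommGroup F] [IsFiniteMeasure τ] {f : X → F} (hf : AEStronglyMeasurable f τ)
    {C : ℝ} (h : ∀ x, ‖f x‖ ≤ C) : Integrable f τ :=
  Integrable.of_bound hf C (ae_of_all _ h)

/-- Slicing formula for the distance of two points of a ball. -/
theorem exists_mul_norm_sub_eq (d : ℕ) : ∃ c : ℝ, 0 < c ∧ ∀ R : ℝ, ∃ a : ℝ, ∀ x y : E d,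
    ‖x‖ ≤ R → ‖y‖ ≤ R →
    c * ‖x - y‖ = a - 2 * ∫ θ, halfSpace θ x * halfSpace θ y ∂(sliceMeasure d R) := by
  obtain ⟨c, hc, h⟩ := exists_mul_norm_eq_integral_abs_inner d
  -- Integrated over directions `w`, the linear terms of the one-dimensional formula vanish by
  -- oddness. What remains besides `|⟨x - y, w⟩|` is `2 * R`, which determines `a`.
  refine ⟨c, hc, fun R => ⟨∫ w in Metric.closedBall (0 : E d) 1, 2 * R, fun x y hx hy => ?_⟩⟩
  have hm : Measurable fun θ : E d × ℝ => halfSpace θ x * halfSpace θ y :=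
    (measurable_halfSpace.comp (by fun_prop : Measurable fun θ : E d × ℝ => (θ, x))).mul
      (measurable_halfSpace.comp (by fun_prop : Measurable fun θ : E d × ℝ => (θ, y)))
  have hi : Integrable (fun θ : E d × ℝ => halfSpace θ x * halfSpace θ y) (sliceMeasure d R) := by
    refine integrable_of_norm_le_one hm.aestronglyMeasurable (C := 1) fun θ => ?_
    rw [norm_mul]
    exact mul_le_one₀ (abs_halfSpace_le _ _) (norm_nonneg _) (abs_halfSpace_le _ _)
  have key : ∀ w ∈ Metric.closedBall (0 : E d) 1,
      ∫ u in Icc (-R) R, halfSpace (w, u) x * halfSpace (w, u) y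
        = (inner ℝ x w + inner ℝ y w + 2 * R - |inner ℝ (x - y) w|) / 2 := by
    intro w hw
    rw [mem_closedBall_zero_iff] at hw
    have hb : ∀ z : E d, ‖z‖ ≤ R → |inner ℝ z w| ≤ R := fun z hz =>
      (abs_real_inner_le_norm z w).trans
        ((mul_le_of_le_one_right (norm_nonneg _) hw).trans hz)
    rw [inner_sub_left]
    exact integral_Icc_ite_mul_ite (hb x hx) (hb y hy)
  unfold sliceMeasure at hi ⊢
  rw [h, integral_prod _ hi, setIntegral_congr_fun Metric.isClosed_closedBall.measurableSet key]
  have i1 : ∀ z : E d, Integrable (fun w => inner ℝ z w)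
      (volume.restrict (Metric.closedBall (0 : E d) 1)) := fun z =>
    ContinuousOn.integrableOn_compact (isCompact_closedBall 0 1) (by fun_prop)
  have i2 : Integrable (fun w => inner ℝ x w + inner ℝ y w)
      (volume.restrict (Metric.closedBall (0 : E d) 1)) := (i1 x).add (i1 y)
  have i3 : Integrable (fun w => inner ℝ x w + inner ℝ y w + 2 * R)
      (volume.restrict (Metric.closedBall (0 : E d) 1)) := i2.add (integrable_const _)
  rw [integral_div, integral_sub i3 (integrable_abs_inner_closedBall _),
    integral_add i2 (integrable_const _), integral_add (i1 x) (i1 y), integral_inner_closedBall, integral_inner_closedBall]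
  ring

/-- The half-space features of the vector measure `f α`. -/
noncomputable def sliceFeature (α : ProbabilityMeasure (E d)) (f : E d → E d) (θ : E d × ℝ) : E d :=
  ∫ x, halfSpace θ x • f x ∂(α : Measure (E d))

variable {α β : ProbabilityMeasure (E d)} {f g : E d → E d} {R : ℝ}

theorem integrable_halfSpace_smul (hf : Integrable f (α : Measure (E d))) (θ : E d × ℝ) :
    Integrable (fun x => halfSpace θ x • f x) (α : Measure (E d)) :=
  hf.bdd_smul 1
    (measurable_halfSpace.comp (by fun_prop : Measurable fun x : E d => (θ, x))).aestronglyMeasurable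
    (ae_of_all _ fun x => abs_halfSpace_le θ x)

theorem norm_sliceFeature_le (hf : Integrable f (α : Measure (E d))) (θ : E d × ℝ) :
    ‖sliceFeature α f θ‖ ≤ ∫ x, ‖f x‖ ∂(α : Measure (E d)) :=
  norm_integral_le_of_norm_le hf.norm (ae_of_all _ fun x => by
    rw [norm_smul]
    exact mul_le_of_le_one_left (norm_nonneg _) (abs_halfSpace_le θ x))

theorem integrable_prod_halfSpace_smul (hf : Integrable f (α : Measure (E d))) :
    Integrable (fun p : (E d × ℝ) × E d => halfSpace p.1 p.2 • f p.2)
      ((sliceMeasure d R).prod (α : Measure (E d))) :=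
  (hf.comp_snd (sliceMeasure d R)).bdd_smul 1
    measurable_halfSpace.aestronglyMeasurable
    (ae_of_all _ fun p => abs_halfSpace_le p.1 p.2)

theorem aestronglyMeasurable_sliceFeature (hf : Integrable f (α : Measure (E d))) :
    AEStronglyMeasurable (sliceFeature α f) (sliceMeasure d R) :=
  (integrable_prod_halfSpace_smul hf).aestronglyMeasurable.integral_prod_right'

theorem ae_norm_le_of_compl_closedBall (hα : (α : Measure (E d)) (Metric.closedBall 0 R)ᶜ = 0) :
    ∀ᵐ x ∂(α : Measure (E d)), ‖x‖ ≤ R := by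
  have : ∀ᵐ x ∂(α : Measure (E d)), x ∈ Metric.closedBall (0 : E d) R := hα
  simpa using this

/-- The interaction of two vector measures of zero mass is an `L²` inner product of features. -/
theorem exists_integral_inner_edConv_eq (d : ℕ) : ∃ c : ℝ, 0 < c ∧
    ∀ (R : ℝ) (α β : ProbabilityMeasure (E d)) (f g : E d → E d),
    (α : Measure (E d)) (Metric.closedBall 0 R)ᶜ = 0 →
    (β : Measure (E d)) (Metric.closedBall 0 R)ᶜ = 0 →
    Integrable f (α : Measure (E d)) → Integrable g (β : Measure (E d)) →
    ∫ x, f x ∂(α : Measure (E d)) = 0 → ∫ x, g x ∂(β : Measure (E d)) = 0 →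
    ∫ x, inner ℝ (f x) (edConv β g x) ∂(α : Measure (E d))
      = c * ∫ θ, inner ℝ (sliceFeature α f θ) (sliceFeature β g θ) ∂(sliceMeasure d R) := by
  obtain ⟨c, hc, h⟩ := exists_mul_norm_sub_eq d
  -- On the ball `-|x - y|` is `2 / c` times the integral of the product of indicators, minus `a /
  -- c`. The zero mass of `g β` removes the constant, and Fubini leaves the features.
  refine ⟨2 / c, by positivity, fun R α β f g hα hβ hf hg hf0 hg0 => ?_⟩
  obtain ⟨a, ha⟩ := h R
  set τ := sliceMeasure d R
  have hconv : ∀ x, ‖x‖ ≤ R → edConv β g x = (2 / c) •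
      ∫ θ, halfSpace θ x • sliceFeature β g θ ∂τ := by
    intro x hx
    have hmx : Measurable fun p : E d × (E d × ℝ) => halfSpace p.2 x * halfSpace p.2 p.1 :=
      (measurable_halfSpace.comp (by fun_prop : Measurable fun p : E d × (E d × ℝ) => (p.2, x))).mul
      (measurable_halfSpace.comp (by fun_prop : Measurable fun p : E d × (E d × ℝ) => (p.2, p.1)))
    have i1 : Integrable (fun p : E d × (E d × ℝ) =>
        (halfSpace p.2 x * halfSpace p.2 p.1) • g p.1) ((β : Measure (E d)).prod τ) := by
      refine (hg.comp_fst τ).bdd_smul 1 hmx.aestronglyMeasurable (ae_of_all _ fun p => ?_)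
      rw [norm_mul]
      exact mul_le_one₀ (abs_halfSpace_le _ _) (norm_nonneg _) (abs_halfSpace_le _ _)
    have e1 : ∀ᵐ y ∂(β : Measure (E d)), edKernel x y • g y
        = (2 / c) • (∫ θ, (halfSpace θ x * halfSpace θ y) • g y ∂τ) - (a / c) • g y := by
      filter_upwards [ae_norm_le_of_compl_closedBall hβ] with y hy
      rw [integral_smul_const, smul_smul, ← sub_smul]
      congr 1
      have := ha x y hx hy
      unfold edKernel
      field_simp
      linarith
    have j1 : Integrable (fun y => (2 / c) • ∫ θ, (halfSpace θ x * halfSpace θ y) • g y ∂τ)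
        (β : Measure (E d)) :=
      Integrable.smul (2 / c) (f := fun y => ∫ θ, (halfSpace θ x * halfSpace θ y) • g y ∂τ)
        i1.integral_prod_left
    have j2 : Integrable (fun y => (a / c) • g y) (β : Measure (E d)) :=
      Integrable.smul (a / c) (f := fun y => g y) hg
    unfold edConv
    rw [integral_congr_ae e1, integral_sub j1 j2,
      integral_smul, integral_smul, hg0, smul_zero, sub_zero, integral_integral_swap i1]
    congr 1
    refine integral_congr_ae (ae_of_all _ fun θ => ?_)
    simp only [sliceFeature, mul_smul, integral_smul]
  have e2 : ∀ᵐ x ∂(α : Measure (E d)), inner ℝ (f x) (edConv β g x)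
      = (2 / c) * ∫ θ, inner ℝ (halfSpace θ x • f x) (sliceFeature β g θ) ∂τ := by
    filter_upwards [ae_norm_le_of_compl_closedBall hα] with x hx
    have i3 : Integrable (fun θ => halfSpace θ x • sliceFeature β g θ) τ := by
      refine integrable_of_norm_le_one ((measurable_halfSpace.comp
        (by fun_prop : Measurable fun θ : E d × ℝ => (θ, x))).aestronglyMeasurable.smul
        (aestronglyMeasurable_sliceFeature hg)) (C := ∫ y, ‖g y‖ ∂(β : Measure (E d))) fun θ => ?_
      rw [norm_smul]
      exact (mul_le_of_le_one_left (norm_nonneg _) (abs_halfSpace_le θ x)).trans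
        (norm_sliceFeature_le hg θ)
    rw [hconv x hx, inner_smul_right, ← integral_inner i3]
    congr 1
    refine integral_congr_ae (ae_of_all _ fun θ => ?_)
    simp only [inner_smul_left, inner_smul_right]; simp
  have i2 : Integrable (fun p : E d × (E d × ℝ) =>
      inner ℝ (halfSpace p.2 p.1 • f p.1) (sliceFeature β g p.2)) ((α : Measure (E d)).prod τ) := by
    refine ((hf.comp_fst τ).norm.mul_const (∫ y, ‖g y‖ ∂(β : Measure (E d)))).mono' ?_
      (ae_of_all _ fun p => ?_)
    · refine AEStronglyMeasurable.inner ?_ (aestronglyMeasurable_sliceFeature hg).comp_snd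
      exact (measurable_halfSpace.comp (by fun_prop :
        Measurable fun p : E d × (E d × ℝ) => (p.2, p.1))).aestronglyMeasurable.smul
        hf.aestronglyMeasurable.comp_fst
    · refine (norm_inner_le_norm _ _).trans (mul_le_mul ?_ (norm_sliceFeature_le hg _)
        (norm_nonneg _) (norm_nonneg _))
      rw [norm_smul]
      exact mul_le_of_le_one_left (norm_nonneg _) (abs_halfSpace_le _ _)
  rw [integral_congr_ae e2, integral_const_mul, integral_integral_swap i2]
  congr 1
  refine integral_congr_ae (ae_of_all _ fun θ => ?_)
  simp only
  rw [real_inner_comm, sliceFeature.eq_1 α f, ← integral_inner (integrable_halfSpace_smul hf θ)]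
  exact integral_congr_ae (ae_of_all _ fun x => real_inner_comm _ _)

/-- As `g β` has zero mass, the kernel may be replaced by `|x| - |x - y|`, whose modulus is at most
`|y|`. The bound is thus independent of `x`. -/
theorem norm_edConv_le (hg : Integrable g (β : Measure (E d)))
    (hβ : (β : Measure (E d)) (Metric.closedBall 0 R)ᶜ = 0)
    (hg0 : ∫ x, g x ∂(β : Measure (E d)) = 0) (x : E d) :
    ‖edConv β g x‖ ≤ ∫ y, ‖y‖ * ‖g y‖ ∂(β : Measure (E d)) := by
  have i1 : Integrable (fun y => ‖y‖ * ‖g y‖) (β : Measure (E d)) :=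
    hg.norm.bdd_mul (c := R) (by fun_prop) (by
      filter_upwards [ae_norm_le_of_compl_closedBall hβ] with y hy; simpa using hy)
  have i2 : Integrable (fun y => edKernel x y • g y) (β : Measure (E d)) := by
    have hk : Continuous (edKernel x) := by unfold edKernel; fun_prop
    refine hg.bdd_smul (‖x‖ + R) hk.aestronglyMeasurable ?_
    filter_upwards [ae_norm_le_of_compl_closedBall hβ] with y hy
    unfold edKernel
    rw [norm_neg, norm_norm]
    linarith [norm_sub_le x y]
  have e : edConv β g x = ∫ y, (edKernel x y + ‖x‖) • g y ∂(β : Measure (E d)) := by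
    have i3 : Integrable (fun y => ‖x‖ • g y) (β : Measure (E d)) :=
      Integrable.smul ‖x‖ (f := fun y => g y) hg
    simp only [add_smul]
    rw [integral_add i2 i3, integral_smul, hg0, smul_zero, add_zero, edConv]
  rw [e]
  refine norm_integral_le_of_norm_le i1 (ae_of_all _ fun y => ?_)
  rw [norm_smul]
  refine mul_le_mul_of_nonneg_right ?_ (norm_nonneg _)
  unfold edKernel
  rw [Real.norm_eq_abs, abs_le]
  have h1 := norm_sub_le x y
  have h2 := norm_sub_norm_le x (x - y)
  rw [sub_sub_cancel] at h2
  constructor <;> linarith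

theorem integrable_inner_sliceFeature (hf : Integrable f (α : Measure (E d)))
    (hg : Integrable g (β : Measure (E d))) :
    Integrable (fun θ => inner ℝ (sliceFeature α f θ) (sliceFeature β g θ)) (sliceMeasure d R) := by
  refine integrable_of_norm_le_one ((aestronglyMeasurable_sliceFeature hf).inner
    (aestronglyMeasurable_sliceFeature hg)) fun θ => (norm_inner_le_norm _ _).trans
      (mul_le_mul (norm_sliceFeature_le hf θ) (norm_sliceFeature_le hg θ) (norm_nonneg _)
        (integral_nonneg fun _ => norm_nonneg _))

/-- Conditional positive definiteness of the energy distance. -/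
theorem edEnergy_nonneg (hα : (α : Measure (E d)) (Metric.closedBall 0 R)ᶜ = 0)
    (hf : Integrable f (α : Measure (E d))) (hf0 : ∫ x, f x ∂(α : Measure (E d)) = 0) :
    0 ≤ edEnergy α f := by
  obtain ⟨c, hc, h⟩ := exists_integral_inner_edConv_eq d
  rw [edEnergy, h R α α f f hα hα hf hf hf0 hf0]
  exact mul_nonneg hc.le (integral_nonneg fun θ => real_inner_self_nonneg)

/-- The interaction energy of the difference of two vector measures of zero mass is nonnegative. -/
theorem two_mul_integral_inner_edConv_le (hα : (α : Measure (E d)) (Metric.closedBall 0 R)ᶜ = 0)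
    (hβ : (β : Measure (E d)) (Metric.closedBall 0 R)ᶜ = 0)
    (hf : Integrable f (α : Measure (E d))) (hg : Integrable g (β : Measure (E d)))
    (hf0 : ∫ x, f x ∂(α : Measure (E d)) = 0) (hg0 : ∫ x, g x ∂(β : Measure (E d)) = 0) :
    2 * ∫ x, inner ℝ (f x) (edConv β g x) ∂(α : Measure (E d)) ≤ edEnergy α f + edEnergy β g := by
  obtain ⟨c, hc, h⟩ := exists_integral_inner_edConv_eq d
  rw [edEnergy, edEnergy, h R α α f f hα hα hf hf hf0 hf0, h R β β g g hβ hβ hg hg hg0 hg0,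
    h R α β f g hα hβ hf hg hf0 hg0, ← mul_add, mul_left_comm, ← integral_const_mul,
    ← integral_add (integrable_inner_sliceFeature hf hf) (integrable_inner_sliceFeature hg hg)]
  refine mul_le_mul_of_nonneg_left (integral_mono
    ((integrable_inner_sliceFeature hf hg).const_mul 2)
    ((integrable_inner_sliceFeature hf hf).add (integrable_inner_sliceFeature hg hg))
    fun θ => ?_) hc.le
  -- Pointwise in `θ` the claim is that the squared norm of the difference of the features is
  -- nonnegative.
  have := real_inner_self_nonneg (x := sliceFeature α f θ - sliceFeature β g θ)
  rw [real_inner_sub_sub_self] at this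
  simp only
  linarith

end

/-! ### From weak derivatives in time to the fundamental theorem of calculus. -/

section

theorem exists_Icc_subset_Ioo_of_isCompact {K : Set ℝ} (hK : IsCompact K) {a b : ℝ} (hab : a < b)
    (h : K ⊆ Ioo a b) : ∃ a' b', a < a' ∧ a' ≤ b' ∧ b' < b ∧ K ⊆ Icc a' b' := by
  rcases K.eq_empty_or_nonempty with rfl | hne
  · exact ⟨(a + b) / 2, (a + b) / 2, by linarith, le_rfl, by linarith, empty_subset _⟩
  · exact ⟨sInf K, sSup K, (h (hK.sInf_mem hne)).1, csInf_le_csSup hne hK.bddBelow hK.bddAbove,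
      (h (hK.sSup_mem hne)).2, fun x hx => ⟨csInf_le hK.bddBelow hx, le_csSup hK.bddAbove hx⟩⟩

/-- A smooth function with support in `(0, 1)` and vanishing integral has a primitive with support
in `(0, 1)`. -/
theorem exists_primitive_of_integral_eq_zero {ξ : ℝ → ℝ} (hξ : ContDiff ℝ ∞ ξ)
    (hc : HasCompactSupport ξ) (hs : tsupport ξ ⊆ Ioo 0 1) (h0 : ∫ x in (0 : ℝ)..1, ξ x = 0) :
    ∃ χ : ℝ → ℝ, ContDiff ℝ ∞ χ ∧ HasCompactSupport χ ∧ tsupport χ ⊆ Ioo 0 1 ∧ deriv χ = ξ := by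
  obtain ⟨a, b, ha, hab, hb, hK⟩ := exists_Icc_subset_Ioo_of_isCompact hc zero_lt_one hs
  have hv : ∀ x, x ∉ Icc a b → ξ x = 0 := fun x hx =>
    image_eq_zero_of_notMem_tsupport fun h => hx (hK h)
  let χ : ℝ → ℝ := fun x => ∫ r in (0 : ℝ)..x, ξ r
  have hd : ∀ x, HasDerivAt χ (ξ x) x := fun x =>
    intervalIntegral.integral_hasDerivAt_right (hξ.continuous.intervalIntegrable _ _)
      (hξ.continuous.stronglyMeasurableAtFilter _ _) hξ.continuous.continuousAt
  have hderiv : deriv χ = ξ := funext fun x => (hd x).deriv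
  have hsupp : Function.support χ ⊆ Icc a b := by
    intro x hx
    by_contra hxn
    refine hx ?_
    rcases lt_or_ge x a with h | h
    · refine intervalIntegral.integral_zero_ae (ae_of_all _ fun r hr => hv r fun hr' => ?_)
      have := hr.2
      have := hr'.1
      rcases max_cases 0 x with h | h <;> linarith
    · have hbx : b < x := by
        by_contra! hle
        exact hxn ⟨h, hle⟩
      -- To the right of the support the primitive equals the total integral, which is zero, plus an
      -- integral between `1` and `x` over which `ξ` vanishes.
      have h1 : ∫ r in (1 : ℝ)..x, ξ r = 0 := by
        refine intervalIntegral.integral_zero_ae (ae_of_all _ fun r hr => hv r fun hr' => ?_)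
        have := hr.1
        have := hr'.2
        rcases min_cases 1 x with h | h <;> linarith
      simp only [χ]
      rw [← intervalIntegral.integral_add_adjacent_intervals
        (hξ.continuous.intervalIntegrable 0 1) (hξ.continuous.intervalIntegrable 1 x), h0, h1,
        add_zero]
  have hts : tsupport χ ⊆ Icc a b := closure_minimal hsupp isClosed_Icc
  refine ⟨χ, ?_, isCompact_Icc.of_isClosed_subset (isClosed_tsupport χ) hts, ?_, hderiv⟩
  · rw [contDiff_infty_iff_deriv, hderiv]
    exact ⟨fun x => (hd x).differentiableAt, hξ⟩
  · exact hts.trans fun x hx => ⟨ha.trans_le hx.1, hx.2.trans_lt hb⟩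

theorem intervalIntegral_eq_integral_of_tsupport_subset {f : ℝ → ℝ}
    (hs : Function.support f ⊆ Ioo 0 1) : ∫ x in (0 : ℝ)..1, f x = ∫ x, f x := by
  rw [intervalIntegral.integral_of_le zero_le_one]
  exact setIntegral_eq_integral_of_forall_compl_eq_zero fun x hx => by
    by_contra h
    exact hx (Ioo_subset_Ioc_self (hs h))

/-- A continuous function on `[0, 1]` whose weak derivative is integrable is the primitive of it. -/
theorem sub_eq_integral_of_weak_deriv {F G : ℝ → ℝ} (hF : ContinuousOn F (Icc 0 1))
    (hG : IntervalIntegrable G volume 0 1)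
    (h : ∀ χ : ℝ → ℝ, ContDiff ℝ ∞ χ → HasCompactSupport χ → tsupport χ ⊆ Ioo 0 1 →
      ∫ t in (0 : ℝ)..1, (deriv χ t * F t + χ t * G t) = 0)
    {s t : ℝ} (hs : 0 ≤ s) (hst : s ≤ t) (ht : t ≤ 1) : F t - F s = ∫ r in s..t, G r := by
  set P : ℝ → ℝ := fun t => ∫ r in (0 : ℝ)..t, G r with hP
  have hPac : AbsolutelyContinuousOnInterval P 0 1 :=
    hG.absolutelyContinuousOnInterval_intervalIntegral (by simp)
  have hPc : ContinuousOn P (Icc 0 1) := by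
    have := hPac.continuousOn
    rwa [uIcc_of_le zero_le_one] at this
  have hH : ContinuousOn (fun t => F t - P t) (Icc 0 1) := hF.sub hPc
  have hii : ∀ ψ : ℝ → ℝ, Continuous ψ → ∀ J : ℝ → ℝ, ContinuousOn J (Icc 0 1) →
      IntervalIntegrable (fun t => ψ t * J t) volume 0 1 := fun ψ hψ J hJ =>
    ContinuousOn.intervalIntegrable (by
      rw [uIcc_of_le zero_le_one]; exact hψ.continuousOn.mul hJ)
  -- Integration by parts against the absolutely continuous `P` shows that `F - P` has zero weak
  -- derivative.
  have hA : ∀ χ : ℝ → ℝ, ContDiff ℝ ∞ χ → HasCompactSupport χ → tsupport χ ⊆ Ioo 0 1 →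
      ∫ t in (0 : ℝ)..1, deriv χ t * (F t - P t) = 0 := by
    intro χ h1 h2 h3
    have hdc : Continuous (deriv χ) := h1.continuous_deriv (by simp)
    have hχac : AbsolutelyContinuousOnInterval χ 0 1 :=
      (h1.of_le (by simp)).contDiffOn.absolutelyContinuousOnInterval
    have hχ0 : χ 0 = 0 := image_eq_zero_of_notMem_tsupport fun h => lt_irrefl _ (h3 h).1
    have hχ1 : χ 1 = 0 := image_eq_zero_of_notMem_tsupport fun h => lt_irrefl _ (h3 h).2
    have e1 := hχac.integral_mul_deriv_eq_deriv_mul hPac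
    have e2 : ∫ t in (0 : ℝ)..1, χ t * deriv P t = ∫ t in (0 : ℝ)..1, χ t * G t := by
      refine intervalIntegral.integral_congr_ae ?_
      filter_upwards [hG.ae_hasDerivAt_integral] with x hx hx'
      rw [(hx (uIoc_subset_uIcc hx') 0 (by simp)).deriv]
    rw [e2, hχ0, hχ1] at e1
    have e3 := h χ h1 h2 h3
    rw [intervalIntegral.integral_add (hii _ hdc _ hF)
      (hG.continuousOn_mul h1.continuous.continuousOn), e1] at e3
    simp only [mul_sub]
    rw [intervalIntegral.integral_sub (hii _ hdc _ hF) (hii _ hdc _ hPc)]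
    linarith
  -- Du Bois-Reymond's argument: with a bump `ρ` of mass one inside `(0, 1)`, `ψ - (∫ ψ) ρ` has zero
  -- integral, hence is the derivative of a test function, for every test function `ψ`. So `F - P`
  -- is almost everywhere the constant `c₀`, and everywhere by continuity.
  let b : ContDiffBump (1 / 2 : ℝ) := ⟨1 / 8, 1 / 4, by norm_num, by norm_num⟩
  set ρ := b.normed volume with hρ
  have hρs : tsupport ρ ⊆ Ioo 0 1 := by
    rw [hρ, b.tsupport_normed_eq, Real.closedBall_eq_Icc]
    intro x hx
    simp only [b, mem_Icc, mem_Ioo] at hx ⊢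
    constructor <;> linarith [hx.1, hx.2]
  have hρ1 : ∫ x in (0 : ℝ)..1, ρ x = 1 := by
    rw [intervalIntegral_eq_integral_of_tsupport_subset ((subset_tsupport _).trans hρs)]
    exact b.integral_normed
  have hρd : ContDiff ℝ ∞ ρ := b.contDiff_normed
  set c₀ := ∫ x in (0 : ℝ)..1, ρ x * (F x - P x) with hc₀
  have hB : ∀ ψ : ℝ → ℝ, ContDiff ℝ ∞ ψ → HasCompactSupport ψ → tsupport ψ ⊆ Ioo 0 1 →
      ∫ x, ψ x • (F x - P x - c₀) = 0 := by
    intro ψ h1 h2 h3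
    rw [← intervalIntegral_eq_integral_of_tsupport_subset]
    swap
    · intro x hx
      refine h3 (subset_tsupport _ fun hx0 => hx ?_)
      simp [hx0]
    set c := ∫ x in (0 : ℝ)..1, ψ x
    have hts : tsupport (fun x => ψ x - c * ρ x) ⊆ tsupport ψ ∪ tsupport ρ := by
      refine closure_minimal (fun x hx => ?_) ((isClosed_tsupport _).union (isClosed_tsupport _))
      by_contra hn
      rw [mem_union, not_or] at hn
      refine hx ?_
      simp only
      rw [image_eq_zero_of_notMem_tsupport hn.1, image_eq_zero_of_notMem_tsupport hn.2]
      simp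
    obtain ⟨χ, k1, k2, k3, k4⟩ := exists_primitive_of_integral_eq_zero
      (ξ := fun x => ψ x - c * ρ x) (h1.sub (contDiff_const.mul hρd))
      ((h2.isCompact.union b.hasCompactSupport_normed.isCompact).of_isClosed_subset
        (isClosed_tsupport _) hts)
      (hts.trans (union_subset h3 hρs))
      (by rw [intervalIntegral.integral_sub (h1.continuous.intervalIntegrable _ _)
            ((hρd.continuous.intervalIntegrable _ _).const_mul c),
            intervalIntegral.integral_const_mul, hρ1]; simp [c])
    have := hA χ k1 k2 k3
    rw [k4] at this
    simp only [sub_mul, mul_assoc] at this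
    rw [intervalIntegral.integral_sub (hii _ h1.continuous _ hH)
      ((hii _ hρd.continuous _ hH).const_mul c), intervalIntegral.integral_const_mul] at this
    simp only [smul_eq_mul, mul_sub (_ : ℝ) _ c₀]
    rw [intervalIntegral.integral_sub (hii _ h1.continuous _ hH)
      ((h1.continuous.intervalIntegrable _ _).mul_const c₀),
      intervalIntegral.integral_mul_const]
    exact this
  have hae := isOpen_Ioo.ae_eq_zero_of_integral_contDiff_smul_eq_zero
    (((hH.sub continuousOn_const).mono Ioo_subset_Icc_self).locallyIntegrableOn
      measurableSet_Ioo) hB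
  have hEq : EqOn (fun t => F t - P t) (fun _ => c₀) (Icc 0 1) := by
    refine Measure.eqOn_Icc_of_ae_eq volume zero_ne_one ?_ hH continuousOn_const
    rw [← restrict_Ioo_eq_restrict_Icc]
    refine (ae_restrict_iff' measurableSet_Ioo).2 ?_
    filter_upwards [hae] with x hx hx'
    exact sub_eq_zero.1 (hx hx')
  have e1 := hEq ⟨hs, hst.trans ht⟩
  have e2 := hEq ⟨hs.trans hst, ht⟩
  simp only at e1 e2
  have i1 : IntervalIntegrable G volume 0 s := hG.mono_set (by
    rw [uIcc_of_le hs, uIcc_of_le zero_le_one]; exact Icc_subset_Icc le_rfl (hst.trans ht))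
  have i2 : IntervalIntegrable G volume 0 t := hG.mono_set (by
    rw [uIcc_of_le (hs.trans hst), uIcc_of_le zero_le_one]; exact Icc_subset_Icc le_rfl ht)
  rw [← intervalIntegral.integral_interval_sub_left i2 i1]
  simp only [hP] at e1 e2
  linarith

end

/-! ### Mollification and second-order estimates. -/

section

variable {d : ℕ}

/-- Mollification of a function on `ℝᵈ`. -/
noncomputable def mollify (b : ContDiffBump (0 : E d)) (g : E d → ℝ) : E d → ℝ :=
  (b.normed volume ⋆[ContinuousLinearMap.lsmul ℝ ℝ, volume] g)

theorem mollify_apply (b : ContDiffBump (0 : E d)) (g : E d → ℝ) (x : E d) :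
    mollify b g x = ∫ y, b.normed volume y * g (x - y) := by
  simp [mollify, convolution_def]

theorem contDiff_mollify (b : ContDiffBump (0 : E d)) {g : E d → ℝ} (hg : Continuous g) :
    ContDiff ℝ ∞ (mollify b g) :=
  b.hasCompactSupport_normed.contDiff_convolution_left _ b.contDiff_normed hg.locallyIntegrable

theorem integrable_mollify (b : ContDiffBump (0 : E d)) {g : E d → ℝ} (hg : Continuous g)
    (x : E d) : Integrable fun y => b.normed volume y * g (x - y) := by
  refine Continuous.integrable_of_hasCompactSupport
    (b.continuous_normed.mul (by fun_prop)) ?_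
  exact b.hasCompactSupport_normed.mul_right

/-- Two different base points are allowed, so the lemma transports both Lipschitz bounds and the
semigroup inequality between balls of different radii. -/
theorem mollify_mono (b : ContDiffBump (0 : E d)) {g g' : E d → ℝ} (hg : Continuous g)
    (hg' : Continuous g') {x x' : E d} (h : ∀ y, g (x - y) ≤ g' (x' - y)) :
    mollify b g x ≤ mollify b g' x' := by
  rw [mollify_apply, mollify_apply]
  exact integral_mono (integrable_mollify b hg x) (integrable_mollify b hg' x') fun y =>
    mul_le_mul_of_nonneg_left (h y) (b.nonneg_normed y)

theorem mollify_add_const (b : ContDiffBump (0 : E d)) {g : E d → ℝ} (hg : Continuous g) (a : ℝ)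
    (x : E d) : mollify b (fun y => g y + a) x = mollify b g x + a := by
  rw [mollify_apply, mollify_apply]
  simp only [mul_add]
  rw [integral_add (integrable_mollify b hg x)
    ((b.continuous_normed.integrable_of_hasCompactSupport b.hasCompactSupport_normed).mul_const a),
    integral_mul_const, b.integral_normed, one_mul]

theorem lipschitz_mollify (b : ContDiffBump (0 : E d)) {g : E d → ℝ} {C : NNReal}
    (hg : LipschitzWith C g) : LipschitzWith C (mollify b g) := by
  refine LipschitzWith.of_le_add_mul C fun x x' => ?_
  rw [← mollify_add_const b hg.continuous]
  refine mollify_mono b hg.continuous (hg.continuous.add continuous_const) fun y => ?_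
  have := hg.le_add_mul (x - y) (x' - y)
  rwa [dist_sub_right] at this

theorem abs_mollify_sub_le (b : ContDiffBump (0 : E d)) {g : E d → ℝ} (hg : Continuous g) {κ : ℝ}
    (h : ∀ x y, dist x y < b.rOut → |g x - g y| ≤ κ) (x : E d) : |mollify b g x - g x| ≤ κ :=
  b.dist_normed_convolution_le hg.aestronglyMeasurable fun y hy => h y x hy

theorem norm_convolution_le {F G H : Type*} [NormedAddCommGroup F] [NormedSpace ℝ F]
    [NormedAddCommGroup G] [NormedSpace ℝ G] [NormedAddCommGroup H] [NormedSpace ℝ H]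
    (T : F →L[ℝ] G →L[ℝ] H) {f : E d → F} {g : E d → G} (hf : Integrable f) {M : ℝ}
    (hg : ∀ x, ‖g x‖ ≤ M) (x : E d) :
    ‖(f ⋆[T, volume] g) x‖ ≤ ‖T‖ * M * ∫ y, ‖f y‖ := by
  rw [convolution_def, ← integral_const_mul]
  refine norm_integral_le_of_norm_le (hf.norm.const_mul _) (ae_of_all _ fun y => ?_)
  calc ‖T (f y) (g (x - y))‖ ≤ ‖T‖ * ‖f y‖ * ‖g (x - y)‖ := T.le_opNorm₂ _ _
    _ ≤ ‖T‖ * ‖f y‖ * M := by gcongr; exact hg _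
    _ = ‖T‖ * M * ‖f y‖ := by ring

/-- The derivatives of the mollifications of uniformly bounded functions are equi-Lipschitz. -/
theorem exists_lipschitz_fderiv_mollify (b : ContDiffBump (0 : E d)) (M : ℝ) : ∃ C : NNReal,
    ∀ g : E d → ℝ, Continuous g → (∀ x, |g x| ≤ M) → LipschitzWith C (fderiv ℝ (mollify b g)) := by
  set ρ := b.normed volume
  have hρ : ContDiff ℝ ∞ ρ := b.contDiff_normed
  have hρc : HasCompactSupport ρ := b.hasCompactSupport_normed
  have hρ' : ContDiff ℝ ∞ (fderiv ℝ ρ) := hρ.fderiv_right (by simp)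
  have hi : Integrable (fderiv ℝ (fderiv ℝ ρ)) :=
    (hρ'.continuous_fderiv (by simp)).integrable_of_hasCompactSupport
      ((hρc.fderiv ℝ).fderiv ℝ)
  set T := ((ContinuousLinearMap.lsmul ℝ ℝ : ℝ →L[ℝ] ℝ →L[ℝ] ℝ).precompL (E d)).precompL (E d)
  -- Both derivatives fall on the mollifier, so `g` enters only through its bound `M`.
  refine ⟨(‖T‖ * M * ∫ y, ‖fderiv ℝ (fderiv ℝ ρ) y‖).toNNReal, fun g hg hM => ?_⟩
  have h1 : fderiv ℝ (mollify b g) = (fderiv ℝ ρ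
      ⋆[(ContinuousLinearMap.lsmul ℝ ℝ : ℝ →L[ℝ] ℝ →L[ℝ] ℝ).precompL (E d), volume] g) :=
    funext fun x => (hρc.hasFDerivAt_convolution_left _ (hρ.of_le (by simp))
      hg.locallyIntegrable x).fderiv
  have h2 : ∀ x, HasFDerivAt (fderiv ℝ (mollify b g))
      ((fderiv ℝ (fderiv ℝ ρ) ⋆[T, volume] g) x) x := fun x => by
    rw [h1]
    exact (hρc.fderiv ℝ).hasFDerivAt_convolution_left _ (hρ'.of_le (by simp))
      hg.locallyIntegrable x
  refine lipschitzWith_of_nnnorm_fderiv_le (𝕜 := ℝ) (fun x => (h2 x).differentiableAt) fun x => ?_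
  rw [(h2 x).fderiv, ← NNReal.coe_le_coe, coe_nnnorm]
  exact (norm_convolution_le T hi hM x).trans (Real.le_coe_toNNReal _)

/-- A function with Lipschitz derivative grows, in a suitable direction, like its gradient. -/
theorem exists_norm_le_add_mul_norm_fderiv_le {w : E d → ℝ} {C : NNReal} (hw : Differentiable ℝ w)
    (hC : LipschitzWith C (fderiv ℝ w)) (x : E d) {h : ℝ} (hh : 0 ≤ h) :
    ∃ z : E d, ‖z‖ ≤ h ∧ w x + h * ‖fderiv ℝ w x‖ - C * h ^ 2 ≤ w (x + z) := by
  -- The step `z` has length `h` along the gradient, or is zero where the gradient vanishes.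
  obtain ⟨z, hz, hz'⟩ : ∃ z : E d, ‖z‖ ≤ h ∧ fderiv ℝ w x z = h * ‖fderiv ℝ w x‖ := by
    set p := (InnerProductSpace.toDual ℝ (E d)).symm (fderiv ℝ w x) with hp
    have hpn : ‖fderiv ℝ w x‖ = ‖p‖ := by rw [hp, LinearIsometryEquiv.norm_map]
    have hpz : ∀ z, fderiv ℝ w x z = inner ℝ p z := fun z => by
      rw [hp, InnerProductSpace.toDual_symm_apply]
    rcases eq_or_ne p 0 with h0 | h0
    · exact ⟨0, by simpa using hh, by simp [hpn, h0]⟩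
    · have : ‖p‖ ≠ 0 := norm_ne_zero_iff.2 h0
      refine ⟨(h / ‖p‖) • p, ?_, ?_⟩
      · rw [norm_smul, Real.norm_of_nonneg (by positivity)]
        exact (div_mul_cancel₀ _ this).le
      · rw [hpz, hpn, inner_smul_right, real_inner_self_eq_norm_sq]
        field_simp
  refine ⟨z, hz, ?_⟩
  have key := (convex_segment x (x + z)).norm_image_sub_le_of_norm_hasFDerivWithin_le'
    (f := w) (f' := fderiv ℝ w) (φ := fderiv ℝ w x) (C := C * h)
    (fun y _ => (hw y).hasFDerivAt.hasFDerivWithinAt) (fun y hy => ?_)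
    (left_mem_segment ℝ x (x + z)) (right_mem_segment ℝ x (x + z))
  · rw [add_sub_cancel_left, hz', Real.norm_eq_abs, abs_le] at key
    have : (C : ℝ) * h * ‖z‖ ≤ C * h * h := by gcongr
    nlinarith [key.1]
  · rw [← dist_eq_norm]
    refine (hC.dist_le_mul y x).trans ?_
    gcongr
    rw [segment_eq_image'] at hy
    obtain ⟨θ, ⟨hθ0, hθ1⟩, rfl⟩ := hy
    rw [add_sub_cancel_left, dist_self_add_left, norm_smul, Real.norm_of_nonneg hθ0]
    exact (mul_le_of_le_one_left (norm_nonneg _) hθ1).trans hz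

end

/-! ### Narrow convergence in a fixed ball and curves with a speed bound. -/

section

variable {d : ℕ}

theorem Continuous.integrable_of_compl_closedBall {F : Type*} [NormedAddCommGroup F]
    {α : Measure (E d)} [IsFiniteMeasure α] {R : ℝ}
    (hα : α (Metric.closedBall 0 R)ᶜ = 0) {f : E d → F} (hf : Continuous f) : Integrable f α := by
  have h : α.restrict (Metric.closedBall 0 R) = α := Measure.restrict_eq_self_of_ae_mem hα
  rw [← h]
  exact hf.continuousOn.integrableOn_compact (isCompact_closedBall 0 R)

theorem norm_integral_sub_le_of_forall_closedBall {F : Type*} [NormedAddCommGroup F]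
    [NormedSpace ℝ F] {α : Measure (E d)} [IsProbabilityMeasure α] {R : ℝ}
    (hα : α (Metric.closedBall 0 R)ᶜ = 0) {f g : E d → F} (hf : Continuous f) (hg : Continuous g)
    {ε : ℝ} (h : ∀ x ∈ Metric.closedBall 0 R, ‖f x - g x‖ ≤ ε) :
    ‖∫ x, f x ∂α - ∫ x, g x ∂α‖ ≤ ε := by
  rw [← integral_sub (Continuous.integrable_of_compl_closedBall hα hf)
    (Continuous.integrable_of_compl_closedBall hα hg)]
  have hae : ∀ᵐ x ∂α, x ∈ Metric.closedBall (0 : E d) R := hα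
  refine (norm_integral_le_of_norm_le (integrable_const ε) ?_).trans (by simp)
  filter_upwards [hae] with x hx using h x hx

/-- Truncating `f` at its bound on the ball changes none of the integrals and makes `f` a legitimate
test function for narrow convergence. -/
theorem tendsto_integral_of_continuous_real {ι : Type*} {l : Filter ι}
    {α : ι → ProbabilityMeasure (E d)} {β : ProbabilityMeasure (E d)} (h : Tendsto α l (𝓝 β))
    {R : ℝ} (hα : ∀ i, (α i : Measure (E d)) (Metric.closedBall 0 R)ᶜ = 0)
    (hβ : (β : Measure (E d)) (Metric.closedBall 0 R)ᶜ = 0) {f : E d → ℝ} (hf : Continuous f) :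
    Tendsto (fun i => ∫ x, f x ∂(α i : Measure (E d))) l (𝓝 (∫ x, f x ∂(β : Measure (E d)))) := by
  obtain ⟨C, hC⟩ := (isCompact_closedBall (0 : E d) R).exists_bound_of_continuousOn hf.continuousOn
  let f' : BoundedContinuousFunction (E d) ℝ := BoundedContinuousFunction.ofNormedAddCommGroup
    (fun x => max (-|C|) (min |C| (f x))) (by fun_prop) |C| fun x => by
      rw [Real.norm_eq_abs, abs_le]
      exact ⟨le_max_left _ _, max_le (by linarith [abs_nonneg C]) (min_le_left _ _)⟩
  have key : ∀ x ∈ Metric.closedBall (0 : E d) R, f' x = f x := fun x hx => by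
    have := abs_le.1 ((hC x hx).trans (le_abs_self C))
    change max (-|C|) (min |C| (f x)) = f x
    rw [min_eq_right this.2, max_eq_right this.1]
  have e : ∀ γ : ProbabilityMeasure (E d), (γ : Measure (E d)) (Metric.closedBall 0 R)ᶜ = 0 →
      ∫ x, f' x ∂(γ : Measure (E d)) = ∫ x, f x ∂(γ : Measure (E d)) := fun γ hγ => by
    have hae : ∀ᵐ x ∂(γ : Measure (E d)), x ∈ Metric.closedBall (0 : E d) R := hγ
    refine integral_congr_ae ?_
    filter_upwards [hae] with x hx using key x hx
  have := ProbabilityMeasure.tendsto_iff_forall_integral_tendsto.1 h f'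
  rw [e β hβ] at this
  exact this.congr fun i => e (α i) (hα i)

theorem tendsto_integral_of_continuous {F : Type*} [NormedAddCommGroup F] [InnerProductSpace ℝ F]
    [FiniteDimensional ℝ F] {ι : Type*} {l : Filter ι}
    {α : ι → ProbabilityMeasure (E d)} {β : ProbabilityMeasure (E d)} (h : Tendsto α l (𝓝 β))
    {R : ℝ} (hα : ∀ i, (α i : Measure (E d)) (Metric.closedBall 0 R)ᶜ = 0)
    (hβ : (β : Measure (E d)) (Metric.closedBall 0 R)ᶜ = 0) {f : E d → F} (hf : Continuous f) :
    Tendsto (fun i => ∫ x, f x ∂(α i : Measure (E d))) l (𝓝 (∫ x, f x ∂(β : Measure (E d)))) := by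
  let b := stdOrthonormalBasis ℝ F
  have e : ∀ γ : ProbabilityMeasure (E d), (γ : Measure (E d)) (Metric.closedBall 0 R)ᶜ = 0 →
      ∫ x, f x ∂(γ : Measure (E d))
        = ∑ i, (∫ x, inner ℝ (b i) (f x) ∂(γ : Measure (E d))) • b i := fun γ hγ => by
    have := FiniteDimensional.complete ℝ F
    conv_lhs => rw [← b.sum_repr' (∫ x, f x ∂(γ : Measure (E d)))]
    simp only [integral_inner (Continuous.integrable_of_compl_closedBall hγ hf)]
  rw [e β hβ]
  simp only [fun i => e (α i) (hα i)]
  exact tendsto_finsetSum _ fun i _ =>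
    (tendsto_integral_of_continuous_real h hα hβ (by fun_prop)).smul_const _

/-- Integrals of uniformly convergent functions against weakly convergent measures converge. -/
theorem tendsto_integral_of_tendstoUniformlyOn {F : Type*} [NormedAddCommGroup F]
    [InnerProductSpace ℝ F] [FiniteDimensional ℝ F] {ι : Type*} {l : Filter ι}
    {α : ι → ProbabilityMeasure (E d)} {β : ProbabilityMeasure (E d)} (h : Tendsto α l (𝓝 β))
    {R : ℝ} (hα : ∀ i, (α i : Measure (E d)) (Metric.closedBall 0 R)ᶜ = 0)
    (hβ : (β : Measure (E d)) (Metric.closedBall 0 R)ᶜ = 0) {f : ι → E d → F} {g : E d → F}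
    (hf : ∀ i, Continuous (f i)) (hg : Continuous g)
    (hfg : TendstoUniformlyOn f g l (Metric.closedBall 0 R)) :
    Tendsto (fun i => ∫ x, f i x ∂(α i : Measure (E d))) l (𝓝 (∫ x, g x ∂(β : Measure (E d)))) := by
  have h1 : Tendsto (fun i => ∫ x, f i x ∂(α i : Measure (E d)) - ∫ x, g x ∂(α i : Measure (E d)))
      l (𝓝 0) := by
    rw [Metric.tendsto_nhds]
    intro ε hε
    filter_upwards [Metric.tendstoUniformlyOn_iff.1 hfg (ε / 2) (by positivity)] with i hi
    rw [dist_zero_right]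
    refine (norm_integral_sub_le_of_forall_closedBall (hα i) (hf i) hg (ε := ε / 2)
      fun x hx => ?_).trans_lt (by linarith)
    rw [← dist_eq_norm, dist_comm]
    exact (hi x hx).le
  simpa using h1.add (tendsto_integral_of_continuous h hα hβ hg)

/-- A curve of measures in a ball along which mass moves with speed at most `V`. -/
structure HasSpeedBound (R : ℝ) (μ : ℝ → ProbabilityMeasure (E d)) (V : ℝ → ℝ) : Prop where
  cont : Continuous μ
  supp : ∀ t, (μ t : Measure (E d)) (Metric.closedBall 0 R)ᶜ = 0
  nonneg : ∀ t, 0 ≤ V t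
  int : IntervalIntegrable V volume 0 1
  bound : ∀ f : E d → ℝ, ContDiff ℝ ∞ f → ∀ s t, 0 ≤ s → s ≤ t → t ≤ 1 →
    |∫ x, f x ∂(μ t : Measure (E d)) - ∫ x, f x ∂(μ s : Measure (E d))|
      ≤ ∫ r in s..t, V r * ∫ x, ‖fderiv ℝ f x‖ ∂(μ r : Measure (E d))

variable {R : ℝ} {μ : ℝ → ProbabilityMeasure (E d)} {V : ℝ → ℝ}

theorem HasSpeedBound.continuous_integral (h : HasSpeedBound R μ V) {f : E d → ℝ}
    (hf : Continuous f) : Continuous fun t => ∫ x, f x ∂(μ t : Measure (E d)) :=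
  continuous_iff_continuousAt.2 fun t =>
    tendsto_integral_of_continuous (h.cont.tendsto t) h.supp (h.supp t) hf

theorem HasSpeedBound.intervalIntegrable (h : HasSpeedBound R μ V) {s t : ℝ} (hs : 0 ≤ s)
    (hst : s ≤ t) (ht : t ≤ 1) : IntervalIntegrable V volume s t :=
  h.int.mono_set (by
    rw [uIcc_of_le hst, uIcc_of_le zero_le_one]; exact Icc_subset_Icc hs ht)

theorem HasSpeedBound.intervalIntegrable_mul (h : HasSpeedBound R μ V) {f : E d → ℝ}
    (hf : Continuous f) {s t : ℝ} (hs : 0 ≤ s) (hst : s ≤ t) (ht : t ≤ 1) :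
    IntervalIntegrable (fun r => V r * ∫ x, f x ∂(μ r : Measure (E d))) volume s t :=
  (h.intervalIntegrable hs hst ht).mul_continuousOn (h.continuous_integral hf).continuousOn

/-- Integrals of Lipschitz functions change at most at the rate of the speed bound. -/
theorem HasSpeedBound.abs_sub_le_of_lipschitz (h : HasSpeedBound R μ V) {f : E d → ℝ}
    {C : NNReal} (hf : LipschitzWith C f) {s t : ℝ} (hs : 0 ≤ s) (hst : s ≤ t) (ht : t ≤ 1) :
    |∫ x, f x ∂(μ t : Measure (E d)) - ∫ x, f x ∂(μ s : Measure (E d))|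
      ≤ C * ∫ r in s..t, V r := by
  refine le_of_forall_pos_le_add fun ε hε => ?_
  -- At this radius the mollification stays within `ε / 2` of `f`, an error incurred once at each of
  -- the two times; `C + 1` avoids division by zero.
  let b : ContDiffBump (0 : E d) := ⟨ε / (4 * (C + 1)), ε / (2 * (C + 1)), by positivity, by
    apply div_lt_div_of_pos_left hε (by positivity); nlinarith [C.2]⟩
  have hb : ∀ x, |mollify b f x - f x| ≤ ε / 2 := abs_mollify_sub_le b hf.continuous fun x y hxy => by
    refine (hf.dist_le_mul x y).trans ?_
    have h1 : dist x y ≤ ε / (2 * (C + 1)) := hxy.le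
    calc (C : ℝ) * dist x y ≤ (C + 1) * (ε / (2 * (C + 1))) := by gcongr; linarith
      _ = ε / 2 := by field_simp
  have hm := contDiff_mollify b hf.continuous
  have hd := fun r => norm_integral_sub_le_of_forall_closedBall (h.supp r) hm.continuous
    hf.continuous fun x _ => hb x
  have h1 := h.bound _ hm s t hs hst ht
  have h2 : ∫ r in s..t, V r * ∫ x, ‖fderiv ℝ (mollify b f) x‖ ∂(μ r : Measure (E d))
      ≤ ∫ r in s..t, C * V r := by
    have hdc : Continuous (fun x => ‖fderiv ℝ (mollify b f) x‖) :=
      (hm.continuous_fderiv (by simp)).norm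
    refine intervalIntegral.integral_mono_on hst (h.intervalIntegrable_mul hdc hs hst ht)
      ((h.intervalIntegrable hs hst ht).const_mul _) fun r _ => ?_
    rw [mul_comm (C : ℝ)]
    refine mul_le_mul_of_nonneg_left ?_ (h.nonneg r)
    calc ∫ x, ‖fderiv ℝ (mollify b f) x‖ ∂(μ r : Measure (E d))
        ≤ ∫ x, (C : ℝ) ∂(μ r : Measure (E d)) := integral_mono
          (Continuous.integrable_of_compl_closedBall (h.supp r) hdc) (integrable_const _) fun x =>
            norm_fderiv_le_of_lipschitz ℝ (lipschitz_mollify b hf)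
      _ = C := by simp
  rw [intervalIntegral.integral_const_mul] at h2
  have h3 := abs_le.1 (hd t)
  have h4 := abs_le.1 (hd s)
  have h5 := abs_le.1 (h1.trans h2)
  rw [abs_le]
  constructor <;> linarith [h3.1, h3.2, h4.1, h4.2, h5.1, h5.2]

/-- A function that decreases at most quadratically with respect to a continuous clock does not
decrease. -/
theorem le_of_quadratic_decrease {H δ : ℝ → ℝ} {s t C : ℝ} (hst : s ≤ t)
    (hδ : ContinuousOn δ (Icc s t)) (hmono : MonotoneOn δ (Icc s t))
    (h : ∀ a b, s ≤ a → a ≤ b → b ≤ t → H a - C * (δ b - δ a) ^ 2 ≤ H b) : H s ≤ H t := by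
  -- The intermediate value theorem cuts the clock into `N` equal increments `D / N`. Each costs `C
  -- (D / N)²`, so the total loss `C D² / N` vanishes as `N` grows.
  have key : ∀ N : ℕ, 0 < N → H s - C * (δ t - δ s) ^ 2 / N ≤ H t := by
    intro N hN
    have hN' : (0 : ℝ) < N := by exact_mod_cast hN
    set D := δ t - δ s
    have hD : 0 ≤ D := sub_nonneg.2 (hmono (left_mem_Icc.2 hst) (right_mem_Icc.2 hst) hst)
    have hq : ∀ k : ℕ, ∃ q ∈ Icc s t, k ≤ N → δ q = δ s + D * k / N := by
      intro k
      by_cases hk : k ≤ N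
      · have hk' : (k : ℝ) ≤ N := by exact_mod_cast hk
        have h1 : D * k / N ≤ D := by
          rw [div_le_iff₀ hN']; exact mul_le_mul_of_nonneg_left hk' hD
        have h2 : δ s + D * k / N ∈ Icc (δ s) (δ t) :=
          ⟨le_add_of_nonneg_right (by positivity), by simp only [D] at h1 ⊢; linarith⟩
        obtain ⟨q, hq, hq'⟩ := intermediate_value_Icc hst hδ h2
        exact ⟨q, hq, fun _ => hq'⟩
      · exact ⟨s, left_mem_Icc.2 hst, fun h => absurd h hk⟩
    choose q hqm hqe using hq
    rcases hD.eq_or_lt with hD0 | hDpos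
    · have := h s t le_rfl hst le_rfl
      rw [← hD0]
      change H s - C * D ^ 2 ≤ H t at this
      rw [← hD0] at this
      simpa using this
    have step : ∀ k : ℕ, k ≤ N → H (q 0) - k * (C * (D / N) ^ 2) ≤ H (q k) := by
      intro k
      induction k with
      | zero => intro _; simp
      | succ k ih =>
        intro hk
        have e1 := hqe k (by omega)
        have e2 := hqe (k + 1) hk
        have e3 : δ (q (k + 1)) - δ (q k) = D / N := by
          rw [e1, e2]; push_cast; field_simp; ring
        have hlt : q k ≤ q (k + 1) := by
          by_contra! hlt
          have := hmono (hqm (k + 1)) (hqm k) hlt.le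
          have : 0 < D / N := by positivity
          linarith
        have := h (q k) (q (k + 1)) (hqm k).1 hlt (hqm (k + 1)).2
        rw [e3] at this
        have := ih (by omega)
        push_cast
        linarith
    -- The times `q 0` and `q N` need not be `s` and `t`, but they show the same clock values, so
    -- passing between them costs nothing.
    have e0 := hqe 0 (by omega)
    have eN := hqe N le_rfl
    have f0 := h s (q 0) le_rfl (hqm 0).1 (hqm 0).2
    have fN := h (q N) t (hqm N).1 (hqm N).2 le_rfl
    rw [e0] at f0
    rw [eN] at fN
    have g0 : (δ s + D * (0 : ℕ) / N - δ s) = 0 := by simp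
    have gN : δ t - (δ s + D * N / N) = 0 := by
      rw [mul_div_cancel_right₀ _ hN'.ne']; simp only [D]; ring
    rw [g0] at f0
    rw [gN] at fN
    have := step N le_rfl
    have e : (N : ℝ) * (C * (D / N) ^ 2) = C * D ^ 2 / N := by field_simp
    rw [e] at this
    linarith
  have hlim : Tendsto (fun N : ℕ => H s - C * (δ t - δ s) ^ 2 / N) atTop (𝓝 (H s - 0)) :=
    tendsto_const_nhds.sub (tendsto_const_div_atTop_nhds_zero_nat _)
  rw [sub_zero] at hlim
  exact le_of_tendsto hlim ((eventually_gt_atTop 0).mono key)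

end

/-! ### Hopf–Lax evolution and couplings with bounded displacement. -/

section

variable {d : ℕ} {R : ℝ} {μ : ℝ → ProbabilityMeasure (E d)} {V : ℝ → ℝ}

/-- Subsolutions of the eikonal Hamilton–Jacobi equation increase along a curve with bounded
speed. -/
theorem HasSpeedBound.integral_le_of_subsolution (h : HasSpeedBound R μ V) {w : ℝ → E d → ℝ}
    {C : NNReal} (hw : ∀ r, ContDiff ℝ ∞ (w r)) (hC : ∀ r, LipschitzWith C (fderiv ℝ (w r)))
    (hmono : ∀ r x z, 0 ≤ r → ∀ e, ‖z‖ ≤ e → w r (x + z) ≤ w (r + e) x)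
    {s t : ℝ} (hs : 0 ≤ s) (hst : s ≤ t) (ht : t ≤ 1) :
    ∫ x, w 0 x ∂(μ s : Measure (E d))
      ≤ ∫ x, w (∫ r in s..t, V r) x ∂(μ t : Measure (E d)) := by
  let δ : ℝ → ℝ := fun q => ∫ r in s..q, V r
  have hV : IntervalIntegrable V volume s t := h.intervalIntegrable hs hst ht
  have hVi : ∀ a b, s ≤ a → a ≤ b → b ≤ t → IntervalIntegrable V volume a b := fun a b h1 h2 h3 =>
    h.intervalIntegrable (hs.trans h1) h2 (h3.trans ht)
  have hδ : ∀ a b, s ≤ a → a ≤ b → b ≤ t → δ b - δ a = ∫ r in a..b, V r := fun a b h1 h2 h3 =>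
    intervalIntegral.integral_interval_sub_left (hVi s b le_rfl (h1.trans h2) h3)
      (hVi s a le_rfl h1 (h2.trans h3))
  have hnn : ∀ a b, a ≤ b → 0 ≤ ∫ r in a..b, V r := fun a b hab =>
    intervalIntegral.integral_nonneg hab fun r _ => h.nonneg r
  have hcont : ContinuousOn δ (Icc s t) := by
    have := intervalIntegral.continuousOn_primitive_interval (μ := volume) (f := V) (a := s) (b := t)
      (by rw [uIcc_of_le hst]; exact (intervalIntegrable_iff_integrableOn_Icc_of_le hst).1 hV)
    rwa [uIcc_of_le hst] at this
  -- With the clock `δ = ∫ V`, over a clock increment `e` advancing `w` gains `e * m b` up to `C * e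
  -- ^ 2`, while moving the measure loses at most `e * (m b + C * e)`. The first-order terms cancel
  -- and `2 * C` bounds the rest.
  have key := le_of_quadratic_decrease (H := fun q => ∫ x, w (δ q) x ∂(μ q : Measure (E d)))
    (C := 2 * C) hst hcont
    (fun a ha b hb hab => by
      have := hδ a b ha.1 hab hb.2
      have := hnn a b hab
      linarith) ?_
  · simpa [δ] using key
  intro a b ha hab hb
  set e := δ b - δ a with he
  have he' : e = ∫ r in a..b, V r := hδ a b ha hab hb
  have he0 : 0 ≤ e := he' ▸ hnn a b hab
  have hδa : 0 ≤ δ a := hnn s a ha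
  set u := w (δ a) with hu
  have hub : w (δ b) = w (δ a + e) := by rw [he]; congr 1; ring
  have hdu : Continuous fun x => ‖fderiv ℝ u x‖ := ((hw _).continuous_fderiv (by simp)).norm
  have hlip : LipschitzWith C fun x => ‖fderiv ℝ u x‖ := by
    have := lipschitzWith_one_norm.comp (hC (δ a))
    rwa [one_mul] at this
  set m : ℝ → ℝ := fun q => ∫ x, ‖fderiv ℝ u x‖ ∂(μ q : Measure (E d)) with hm
  have h_int : ∀ q, ∀ f : E d → ℝ, Continuous f → Integrable f (μ q : Measure (E d)) :=
    fun q f hf => Continuous.integrable_of_compl_closedBall (h.supp q) hf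
  have step1 : ∫ x, u x ∂(μ b : Measure (E d)) + e * m b - C * e ^ 2
      ≤ ∫ x, w (δ b) x ∂(μ b : Measure (E d)) := by
    have e1 : ∫ x, (u x + e * ‖fderiv ℝ u x‖ - C * e ^ 2) ∂(μ b : Measure (E d))
        = ∫ x, u x ∂(μ b : Measure (E d)) + e * m b - C * e ^ 2 := by
      have i1 := h_int b u (hw _).continuous
      have i2 : Integrable (fun x => e * ‖fderiv ℝ u x‖) (μ b : Measure (E d)) :=
        (h_int b _ hdu).const_mul _
      have i3 : Integrable (fun x => u x + e * ‖fderiv ℝ u x‖) (μ b : Measure (E d)) := i1.add i2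
      rw [integral_sub i3 (integrable_const _), integral_add i1 i2, integral_const_mul]
      simp [hm]
    rw [← e1]
    refine integral_mono (h_int b _ (((hw _).continuous.add (continuous_const.mul hdu)).sub
      continuous_const)) (h_int b _ (hw _).continuous) fun x => ?_
    obtain ⟨z, hz, hz'⟩ := exists_norm_le_add_mul_norm_fderiv_le ((hw (δ a)).differentiable
      (by simp)) (hC (δ a)) x he0
    simp only
    rw [hub]
    exact hz'.trans (hmono _ _ _ hδa _ hz)
  -- The norm of the gradient is itself `C`-Lipschitz, so its average drifts by at most `C * e`.
  have step2 : ∀ q ∈ Icc a b, m q ≤ m b + C * e := by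
    intro q hq
    have h1 := h.abs_sub_le_of_lipschitz hlip (hs.trans (ha.trans hq.1)) hq.2 (hb.trans ht)
    have h2 : ∫ r in q..b, V r ≤ e := by
      rw [← hδ q b (ha.trans hq.1) hq.2 hb, he]
      have := hδ a q ha hq.1 (hq.2.trans hb)
      have := hnn a q hq.1
      linarith
    have h3 : (C : ℝ) * ∫ r in q..b, V r ≤ C * e := by gcongr
    have := (abs_le.1 (h1.trans h3)).1
    simp only [hm]
    linarith
  have step3 : ∫ r in a..b, V r * m r ≤ e * (m b + C * e) := by
    calc ∫ r in a..b, V r * m r ≤ ∫ r in a..b, V r * (m b + C * e) := by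
          refine intervalIntegral.integral_mono_on hab
            (h.intervalIntegrable_mul hdu (hs.trans ha) hab (hb.trans ht))
            ((hVi a b ha hab hb).mul_const _) fun r hr => ?_
          exact mul_le_mul_of_nonneg_left (step2 r hr) (h.nonneg r)
      _ = e * (m b + C * e) := by rw [intervalIntegral.integral_mul_const, he']
  have step4 := (abs_le.1 ((h.bound u (hw _) a b (hs.trans ha) hab (hb.trans ht)).trans step3)).1
  nlinarith

/-- The supremum of a function over balls of radius `r`. -/
noncomputable def supBall (g : E d → ℝ) (r : ℝ) (x : E d) : ℝ :=
  ⨆ z : Metric.closedBall (0 : E d) r, g (x + z)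

theorem bddAbove_range_of_abs_le {g : E d → ℝ} {M : ℝ} (hM : ∀ x, |g x| ≤ M) (r : ℝ) (x : E d) :
    BddAbove (range fun z : Metric.closedBall (0 : E d) r => g (x + z)) :=
  ⟨M, by rintro _ ⟨z, rfl⟩; exact (le_abs_self _).trans (hM _)⟩

theorem nonempty_closedBall_zero {r : ℝ} (hr : 0 ≤ r) : Nonempty (Metric.closedBall (0 : E d) r) :=
  ⟨⟨0, by simpa using hr⟩⟩

theorem le_supBall {g : E d → ℝ} {M : ℝ} (hM : ∀ x, |g x| ≤ M) {r : ℝ} {x z : E d} (hz : ‖z‖ ≤ r) :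
    g (x + z) ≤ supBall g r x :=
  le_ciSup (bddAbove_range_of_abs_le hM r x) ⟨z, by simpa using hz⟩

theorem supBall_le {g : E d → ℝ} {r : ℝ} (hr : 0 ≤ r) {x : E d} {a : ℝ}
    (h : ∀ z, ‖z‖ ≤ r → g (x + z) ≤ a) : supBall g r x ≤ a :=
  have := nonempty_closedBall_zero (d := d) hr
  ciSup_le fun z => h z (mem_closedBall_zero_iff.1 z.2)

theorem abs_supBall_le {g : E d → ℝ} {M : ℝ} (hM : ∀ x, |g x| ≤ M) {r : ℝ} (hr : 0 ≤ r) (x : E d) :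
    |supBall g r x| ≤ M := by
  rw [abs_le]
  constructor
  · have := le_supBall hM (r := r) (x := x) (z := 0) (by simpa using hr)
    exact (neg_le_of_abs_le (hM _)).trans this
  · exact supBall_le hr fun z _ => (le_abs_self _).trans (hM _)

theorem supBall_zero (g : E d → ℝ) (x : E d) : supBall g 0 x = g x := by
  have : Unique (Metric.closedBall (0 : E d) 0) :=
    { default := ⟨0, by simp⟩, uniq := fun z => Subtype.ext (by simpa using z.2) }
  rw [supBall, ciSup_unique]
  have h : ((default : Metric.closedBall (0 : E d) 0) : E d) = 0 := by
    simpa using (default : Metric.closedBall (0 : E d) 0).2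
  rw [h, add_zero]

theorem abs_supBall_sub_le {g : E d → ℝ} {M : ℝ} (hM : ∀ x, |g x| ≤ M) {η κ : ℝ}
    (h : ∀ x y, dist x y < η → |g x - g y| ≤ κ) {r : ℝ} (hr : 0 ≤ r) {x y : E d}
    (hxy : dist x y < η) : |supBall g r x - supBall g r y| ≤ κ := by
  have aux : ∀ x y : E d, dist x y < η → supBall g r x ≤ supBall g r y + κ := fun x y hxy =>
    supBall_le hr fun z hz => by
      have h1 := h (x + z) (y + z) (by simpa using hxy)
      have h2 := le_supBall hM (x := y) hz
      linarith [(abs_le.1 h1).2]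
  rw [abs_le]
  have := aux x y hxy
  have := aux y x (by rwa [dist_comm])
  constructor <;> linarith

theorem continuous_supBall {g : E d → ℝ} {M : ℝ} (hM : ∀ x, |g x| ≤ M) (hg : UniformContinuous g)
    {r : ℝ} (hr : 0 ≤ r) : Continuous (supBall g r) := by
  refine (Metric.uniformContinuous_iff.2 fun κ hκ => ?_).continuous
  obtain ⟨η, hη, H⟩ := Metric.uniformContinuous_iff.1 hg (κ / 2) (by positivity)
  exact ⟨η, hη, fun {x y} hxy =>
    (abs_supBall_sub_le hM (fun x y h => (H h).le) hr hxy).trans_lt (by linarith)⟩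

/-- The ball of radius `r` about `x + z` lies in that of radius `r + e` about `x`. This inequality
stands in for the equation `∂_r w = |∇w|` and survives mollification, unlike the nonlinear equation
itself. -/
theorem supBall_add_le {g : E d → ℝ} {M : ℝ} (hM : ∀ x, |g x| ≤ M) {r : ℝ} (hr : 0 ≤ r) {e : ℝ}
    {x z : E d} (hz : ‖z‖ ≤ e) : supBall g r (x + z) ≤ supBall g (r + e) x :=
  supBall_le hr fun z' hz' => by
    rw [add_assoc]
    exact le_supBall hM ((norm_add_le _ _).trans (by linarith))

/-- Along a curve with speed bound `V`, the integral of `g` is at most the later integral of the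
supremum of `g` over balls of radius `∫ V`. -/
theorem HasSpeedBound.integral_le_integral_supBall (h : HasSpeedBound R μ V) {g : E d → ℝ} {M : ℝ}
    (hM : ∀ x, |g x| ≤ M) (hg : UniformContinuous g) {s t : ℝ} (hs : 0 ≤ s) (hst : s ≤ t)
    (ht : t ≤ 1) :
    ∫ x, g x ∂(μ s : Measure (E d))
      ≤ ∫ x, supBall g (∫ r in s..t, V r) x ∂(μ t : Measure (E d)) := by
  refine le_of_forall_pos_le_add fun ε hε => ?_
  have huc : ∀ κ > 0, ∃ η > 0, ∀ x y, dist x y < η → |g x - g y| ≤ κ := fun κ hκ => by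
    obtain ⟨η, hη, H⟩ := Metric.uniformContinuous_iff.1 hg κ hκ
    exact ⟨η, hη, fun x y hxy => (H hxy).le⟩
  have hcont : ∀ r, 0 ≤ r → Continuous (supBall g r) := fun r hr => continuous_supBall hM hg hr
  obtain ⟨η, hη, H⟩ := huc (ε / 2) (by positivity)
  let b : ContDiffBump (0 : E d) := ⟨η / 2, η, by positivity, by linarith⟩
  obtain ⟨C, hC⟩ := exists_lipschitz_fderiv_mollify b M
  -- Smoothness is required for every real `r`, while the estimates on `supBall` hold for `r ≥ 0`;
  -- hence the truncation.
  let w : ℝ → E d → ℝ := fun r => mollify b (supBall g (max r 0))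
  have hmax : ∀ r : ℝ, 0 ≤ max r 0 := fun r => le_max_right _ _
  have key := h.integral_le_of_subsolution (w := w) (C := C)
    (fun r => contDiff_mollify b (hcont _ (hmax r)))
    (fun r => hC _ (hcont _ (hmax r)) (abs_supBall_le hM (hmax r)))
    (fun r x z hr e hz => by
      have he : 0 ≤ e := (norm_nonneg z).trans hz
      refine mollify_mono b (hcont _ (hmax _)) (hcont _ (hmax _)) fun y => ?_
      rw [max_eq_left hr, max_eq_left (by positivity), add_sub_right_comm]
      exact supBall_add_le hM hr hz) hs hst ht
  have hδ : 0 ≤ ∫ r in s..t, V r := intervalIntegral.integral_nonneg hst fun r _ => h.nonneg r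
  have close : ∀ r, 0 ≤ r → ∀ q, |∫ x, w r x ∂(μ q : Measure (E d))
      - ∫ x, supBall g r x ∂(μ q : Measure (E d))| ≤ ε / 2 := fun r hr q => by
    refine norm_integral_sub_le_of_forall_closedBall (h.supp q)
      (contDiff_mollify b (hcont _ (hmax r))).continuous (hcont r hr) fun x _ => ?_
    simp only [max_eq_left hr]
    exact abs_mollify_sub_le b (hcont r hr) (fun x y hxy => abs_supBall_sub_le hM H hr hxy) x
  have c1 := abs_le.1 (close 0 le_rfl s)
  have c2 := abs_le.1 (close _ hδ t)
  simp only [supBall_zero] at c1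
  linarith [c1.1, c2.2]

/-- The nearest-point projection onto the cube `[-R, R]ᵈ`. -/
noncomputable def cubeProj (R : ℝ) (x : E d) : E d :=
  WithLp.toLp 2 fun i => max (-R) (min R (x i))

theorem lipschitz_cubeProj (R : ℝ) : LipschitzWith 1 (cubeProj (d := d) R) := by
  refine LipschitzWith.of_dist_le_mul fun x y => ?_
  rw [NNReal.coe_one, one_mul, EuclideanSpace.dist_eq, EuclideanSpace.dist_eq]
  refine Real.sqrt_le_sqrt (Finset.sum_le_sum fun i _ => ?_)
  refine pow_le_pow_left₀ dist_nonneg ?_ 2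
  simp only [cubeProj, Real.dist_eq]
  rw [max_comm, max_comm (-R), min_comm, min_comm R]
  refine (abs_max_sub_max_le_abs _ _ _).trans ((abs_min_sub_min_le_max _ _ _ _).trans ?_)
  simp

/-- The cube `[-R, R]ᵈ`. -/
def cube (d : ℕ) (R : ℝ) : Set (E d) := {x | ∀ i, x i ∈ Icc (-R) R}

theorem isCompact_cube (d : ℕ) (R : ℝ) : IsCompact (cube d R) := by
  have h : cube d R = WithLp.toLp 2 '' (Set.pi univ fun _ : Fin d => Icc (-R) R) := by
    ext x
    constructor
    · exact fun hx => ⟨x.ofLp, fun i _ => hx i, rfl⟩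
    · rintro ⟨y, hy, rfl⟩ i
      exact hy i (mem_univ i)
  rw [h]
  exact (isCompact_univ_pi fun _ => isCompact_Icc).image (PiLp.continuous_toLp 2 _)

theorem closedBall_subset_cube (d : ℕ) (R : ℝ) : Metric.closedBall 0 R ⊆ cube d R := fun x hx i => by
  have := (PiLp.norm_apply_le x i).trans (mem_closedBall_zero_iff.1 hx)
  exact abs_le.1 this

theorem cubeProj_mem {R : ℝ} (hR : 0 ≤ R) (x : E d) : cubeProj R x ∈ cube d R := fun i =>
  ⟨le_max_left _ _, max_le (by linarith) (min_le_left _ _)⟩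

theorem cubeProj_eq {R : ℝ} {x : E d} (hx : x ∈ cube d R) : cubeProj R x = x := by
  ext i
  simp only [cubeProj]
  rw [min_eq_right (hx i).2, max_eq_right (hx i).1]

/-- Two measures of a curve with speed bound `V` have a coupling under which no point moves by more
than `∫ V`. -/
theorem HasSpeedBound.exists_coupling (h : HasSpeedBound R μ V) {s t : ℝ} (hs : 0 ≤ s)
    (hst : s ≤ t) (ht : t ≤ 1) : ∃ π : Measure (E d × E d),
      π.map Prod.fst = (μ s : Measure (E d)) ∧ π.map Prod.snd = (μ t : Measure (E d)) ∧
      ∀ᵐ z ∂π, dist z.1 z.2 ≤ ∫ r in s..t, V r := by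
  set δ := ∫ r in s..t, V r
  have hδ : 0 ≤ δ := intervalIntegral.integral_nonneg hst fun r _ => h.nonneg r
  have hR : 0 ≤ R := by
    by_contra! hneg
    have := h.supp 0
    rw [Metric.closedBall_eq_empty.2 hneg, compl_empty, measure_univ] at this
    exact one_ne_zero this
  -- Duality needs a compact space. A cube is used because clamping the coordinates is an explicit
  -- `1`-Lipschitz retraction onto it.
  let X := cube d R
  have hXc : IsCompact X := isCompact_cube d R
  have hXm : MeasurableSet X := hXc.isClosed.measurableSet
  have : CompactSpace X := isCompact_iff_compactSpace.1 hXc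
  have hae : ∀ q, ∀ᵐ x ∂(μ q : Measure (E d)), x ∈ X := fun q => by
    have : ∀ᵐ x ∂(μ q : Measure (E d)), x ∈ Metric.closedBall (0 : E d) R := h.supp q
    filter_upwards [this] with x hx using closedBall_subset_cube d R hx
  let ν : ℝ → Measure X := fun q => (μ q : Measure (E d)).comap Subtype.val
  have hmap : ∀ q, (ν q).map Subtype.val = (μ q : Measure (E d)) := fun q => by
    rw [map_comap_subtype_coe hXm, Measure.restrict_eq_self_of_ae_mem (hae q)]
  have hprob : ∀ q, IsProbabilityMeasure (ν q) := fun q => by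
    refine ⟨?_⟩
    have := congrArg (fun m => m univ) (hmap q)
    simp only [Measure.map_apply measurable_subtype_coe MeasurableSet.univ, preimage_univ,
      measure_univ] at this
    exact this
  let p : E d → X := fun x => ⟨cubeProj R x, cubeProj_mem hR x⟩
  have hpl : LipschitzWith 1 p := fun x y => lipschitz_cubeProj R x y
  have hpX : ∀ x : X, p x = x := fun x => Subtype.ext (cubeProj_eq x.2)
  have h_int : ∀ q, ∀ φ : C(X, ℝ), ∫ x, φ x ∂(ν q) = ∫ x, φ (p x) ∂(μ q : Measure (E d)) := by
    intro q φ
    have hφ : Continuous fun x => φ (p x) := φ.continuous.comp hpl.continuous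
    rw [← hmap q, integral_map measurable_subtype_coe.aemeasurable hφ.aestronglyMeasurable]
    simp only [hpX]
  obtain ⟨π, h1, h2, h3⟩ := exists_coupling_of_dual (ν s) (ν t)
    (D := {z : X × X | dist z.1 z.2 ≤ δ}) (isClosed_le (by fun_prop) continuous_const) <| by
    intro φ ψ hφψ
    rw [h_int, h_int]
    obtain ⟨M, hM⟩ : ∃ M, ∀ x, |φ x| ≤ M := ⟨‖φ‖, φ.norm_coe_le_norm⟩
    have hu : UniformContinuous fun x => -φ (p x) :=
      ((CompactSpace.uniformContinuous_of_continuous φ.continuous).comp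
        hpl.uniformContinuous).neg
    have key := h.integral_le_integral_supBall (M := M) (g := fun x => -φ (p x))
      (fun x => by rw [abs_neg]; exact hM _) hu hs hst ht
    -- Since `p` does not increase distances, `p (x + z)` and `p x` are within `δ` of each other,
    -- and the dual constraint gives `-φ (p (x + z)) ≤ ψ (p x)`.
    have hle : ∫ x, supBall (fun x => -φ (p x)) δ x ∂(μ t : Measure (E d))
        ≤ ∫ x, ψ (p x) ∂(μ t : Measure (E d)) := by
      refine integral_mono_ae
        (Continuous.integrable_of_compl_closedBall (h.supp t) (continuous_supBall
          (fun x => by rw [abs_neg]; exact hM _) hu hδ))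
        (Continuous.integrable_of_compl_closedBall (h.supp t)
          (ψ.continuous.comp hpl.continuous)) ?_
      filter_upwards [hae t] with x hx
      refine supBall_le hδ fun z hz => ?_
      have h1 : dist (p (x + z)) (p x) ≤ δ := by
        refine (hpl.dist_le_mul _ _).trans ?_
        simpa using hz
      have := hφψ (p (x + z), p x) h1
      simp only at this
      linarith
    rw [integral_neg] at key
    linarith
  refine ⟨π.map (Prod.map Subtype.val Subtype.val), ?_, ?_, ?_⟩
  · rw [Measure.map_map measurable_fst (by fun_prop), ← hmap s, ← h1,
      Measure.map_map measurable_subtype_coe measurable_fst]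
    rfl
  · rw [Measure.map_map measurable_snd (by fun_prop), ← hmap t, ← h2,
      Measure.map_map measurable_subtype_coe measurable_snd]
    rfl
  · rw [ae_map_iff (by fun_prop) (measurableSet_le (by fun_prop) measurable_const)]
    exact h3

end

/-! ### Space-time measures and speed bounds from the continuity equation. -/

section

variable {d : ℕ} {R : ℝ} {μ : ℝ → ProbabilityMeasure (E d)} {V : ℝ → ℝ} {v γ : ℝ → E d → E d}

/-- A weakly continuous curve of probability measures as a Markov kernel. -/
noncomputable def curveKernel (μ : ℝ → ProbabilityMeasure (E d)) (hμ : Continuous μ) :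
    Kernel ℝ (E d) where
  toFun t := (μ t : Measure (E d))
  measurable' := by
    refine Measurable.measure_of_isPiSystem_of_isProbabilityMeasure
      (BorelSpace.measurable_eq.trans rfl) isPiSystem_isOpen fun s hs => ?_
    -- On open sets, which form a generating π-system, the mass is lower semicontinuous in `t` by
    -- the portmanteau theorem.
    refine LowerSemicontinuous.measurable (lowerSemicontinuous_iff_le_liminf.2 fun t => ?_)
    exact ProbabilityMeasure.le_liminf_measure_open_of_tendsto (hμ.tendsto t) hs

instance (hμ : Continuous μ) : IsMarkovKernel (curveKernel μ hμ) :=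
  ⟨fun t => (μ t).2⟩

/-- The space-time measure `dt ⊗ μ_t` on `[0, 1] × ℝᵈ`. -/
noncomputable def spaceTime (μ : ℝ → ProbabilityMeasure (E d)) (hμ : Continuous μ) :
    Measure (ℝ × E d) :=
  (volume.restrict (Icc (0 : ℝ) 1)).compProd (curveKernel μ hμ)

instance : IsProbabilityMeasure (volume.restrict (Icc (0 : ℝ) 1)) :=
  ⟨by simp⟩

instance (hμ : Continuous μ) : IsProbabilityMeasure (spaceTime μ hμ) := by
  unfold spaceTime; infer_instance

theorem stronglyMeasurable_integral_curve {F : Type*} [NormedAddCommGroup F] [NormedSpace ℝ F]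
    (hμ : Continuous μ) {f : ℝ × E d → F} (hf : StronglyMeasurable f) :
    StronglyMeasurable fun t => ∫ x, f (t, x) ∂(μ t : Measure (E d)) :=
  hf.integral_kernel_prod_right' (κ := curveKernel μ hμ)

theorem measurable_edConv_curve (hμ : Continuous μ) (hγ : Measurable (Function.uncurry γ)) :
    Measurable fun p : ℝ × E d => edConv (μ p.1) (γ p.1) p.2 := by
  have h : StronglyMeasurable fun q : (ℝ × E d) × E d => edKernel q.1.2 q.2 • γ q.1.1 q.2 := by
    refine Measurable.stronglyMeasurable (Measurable.fun_smul ?_ ?_)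
    · unfold edKernel; fun_prop
    · exact hγ.comp (by fun_prop : Measurable fun q : (ℝ × E d) × E d => (q.1.1, q.2))
  exact (h.integral_kernel_prod_right'
    (κ := (curveKernel μ hμ).comap Prod.fst measurable_fst)).measurable

theorem norm_gradient (f : E d → ℝ) (x : E d) : ‖gradient f x‖ = ‖fderiv ℝ f x‖ := by
  rw [gradient, LinearIsometryEquiv.norm_map]

theorem continuous_gradient {f : E d → ℝ} (hf : ContDiff ℝ ∞ f) : Continuous (gradient f) :=
  (InnerProductSpace.toDual ℝ (E d)).symm.continuous.comp (hf.continuous_fderiv (by simp))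

theorem gradient_congr {f g : E d → ℝ} {x : E d} (h : f =ᶠ[𝓝 x] g) :
    gradient f x = gradient g x := by
  rw [gradient, gradient, h.fderiv_eq]

theorem gradient_const_mul {f : E d → ℝ} (hf : ContDiff ℝ ∞ f) (c : ℝ) (x : E d) :
    gradient (fun y => c * f y) x = c • gradient f x := by
  rw [gradient, gradient, fderiv_const_mul (hf.differentiable (by simp) x), map_smul]

theorem ae_mem_closedBall (hsupp : ∀ t, (μ t : Measure (E d)) (Metric.closedBall 0 R)ᶜ = 0) (t : ℝ) :
    ∀ᵐ x ∂(μ t : Measure (E d)), x ∈ Metric.closedBall (0 : E d) R := hsupp t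

theorem continuous_integral_curve {F : Type*} [NormedAddCommGroup F] [InnerProductSpace ℝ F]
    [FiniteDimensional ℝ F] (hμ : Continuous μ)
    (hsupp : ∀ t, (μ t : Measure (E d)) (Metric.closedBall 0 R)ᶜ = 0) {f : E d → F}
    (hf : Continuous f) : Continuous fun t => ∫ x, f x ∂(μ t : Measure (E d)) :=
  continuous_iff_continuousAt.2 fun t =>
    tendsto_integral_of_continuous (hμ.tendsto t) hsupp (hsupp t) hf

/-- The continuity equation tested with functions of the space variable only. -/
theorem integral_sub_eq_of_continuityEquation (hμ : Continuous μ)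
    (hsupp : ∀ t, (μ t : Measure (E d)) (Metric.closedBall 0 R)ᶜ = 0)
    (hv : Measurable (Function.uncurry v)) (hVi : IntervalIntegrable V volume 0 1)
    (hvV : ∀ᵐ t ∂(volume.restrict (Icc (0 : ℝ) 1)), ∀ x, ‖v t x‖ ≤ V t)
    (hce : ContinuityEquation μ v) {f : E d → ℝ} (hf : ContDiff ℝ ∞ f) :
    IntervalIntegrable (fun r => ∫ x, inner ℝ (v r x) (gradient f x) ∂(μ r : Measure (E d)))
      volume 0 1 ∧
    ∀ s t, 0 ≤ s → s ≤ t → t ≤ 1 →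
    ∫ x, f x ∂(μ t : Measure (E d)) - ∫ x, f x ∂(μ s : Measure (E d))
      = ∫ r in s..t, ∫ x, inner ℝ (v r x) (gradient f x) ∂(μ r : Measure (E d)) := by
  have hgc := continuous_gradient hf
  set G : ℝ → ℝ := fun r => ∫ x, inner ℝ (v r x) (gradient f x) ∂(μ r : Measure (E d)) with hGdef
  obtain ⟨B, hB⟩ := (isCompact_closedBall (0 : E d) R).exists_bound_of_continuousOn
    hgc.continuousOn
  have hvm : ∀ r, Measurable (v r) := fun r => hv.comp measurable_prodMk_left
  have hbound : ∀ r, (∀ x, ‖v r x‖ ≤ V r) → ∀ᵐ x ∂(μ r : Measure (E d)),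
      ‖(inner ℝ (v r x) (gradient f x) : ℝ)‖ ≤ V r * B := fun r hr => by
    filter_upwards [ae_mem_closedBall hsupp r] with x hx
    exact (norm_inner_le_norm _ _).trans (mul_le_mul (hr x) (hB x hx) (norm_nonneg _)
      ((norm_nonneg _).trans (hr x)))
  have h_int : ∀ r, (∀ x, ‖v r x‖ ≤ V r) →
      Integrable (fun x => (inner ℝ (v r x) (gradient f x) : ℝ)) (μ r : Measure (E d)) :=
    fun r hr => Integrable.of_bound ((hvm r).inner hgc.measurable).aestronglyMeasurable (V r * B)
      (hbound r hr)
  have hGm : StronglyMeasurable G := stronglyMeasurable_integral_curve hμ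
    (f := fun p => inner ℝ (v p.1 p.2) (gradient f p.2))
    (hv.inner (hgc.measurable.comp measurable_snd)).stronglyMeasurable
  have hVi' : IntegrableOn V (Icc 0 1) :=
    (intervalIntegrable_iff_integrableOn_Icc_of_le zero_le_one).1 hVi
  have hGi : IntervalIntegrable G volume 0 1 := by
    rw [intervalIntegrable_iff_integrableOn_Icc_of_le zero_le_one]
    refine (hVi'.mul_const B).mono' hGm.aestronglyMeasurable ?_
    filter_upwards [hvV] with r hr
    exact (norm_integral_le_of_norm_le (integrable_const _) (hbound r hr)).trans (by simp)
  refine ⟨hGi, fun s t hs hst ht => sub_eq_integral_of_weak_deriv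
    (F := fun t => ∫ x, f x ∂(μ t : Measure (E d)))
    (continuous_integral_curve hμ hsupp hf.continuous).continuousOn
    hGi (fun χ hχ hχc hχs => ?_) hs hst ht⟩
  -- A cutoff equal to one near the ball makes `χ(t) f(x)` compactly supported without changing any
  -- integral.
  let η : ContDiffBump (0 : E d) := ⟨|R| + 1, |R| + 2, by positivity, by linarith⟩
  have hη : ∀ x ∈ Metric.closedBall (0 : E d) R, ∀ᶠ y in 𝓝 x, η y * f y = f y := by
    intro x hx
    have : Metric.ball (0 : E d) (|R| + 1) ∈ 𝓝 x := Metric.isOpen_ball.mem_nhds (by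
      rw [mem_ball_zero_iff]
      rw [mem_closedBall_zero_iff] at hx
      linarith [le_abs_self R])
    filter_upwards [this] with y hy
    rw [η.one_of_mem_closedBall (Metric.ball_subset_closedBall hy), one_mul]
  have hηf : ContDiff ℝ ∞ fun x => η x * f x := η.contDiff.mul hf
  have key := hce (fun p => χ p.1 * (η p.2 * f p.2))
    ((hχ.comp contDiff_fst).mul (hηf.comp contDiff_snd)) ?_ ?_
  · refine Eq.trans ?_ key
    refine intervalIntegral.integral_congr_ae ((ae_restrict_iff' measurableSet_uIoc).1 ?_)
    rw [uIoc_of_le zero_le_one]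
    filter_upwards [ae_restrict_of_ae_restrict_of_subset Ioc_subset_Icc_self hvV] with r hr
    have e : ∀ᵐ x ∂(μ r : Measure (E d)), deriv (fun s => χ s * (η x * f x)) r
        + inner ℝ (v r x) (gradient (fun y => χ r * (η y * f y)) x)
        = deriv χ r * f x + χ r * inner ℝ (v r x) (gradient f x) := by
      filter_upwards [ae_mem_closedBall hsupp r] with x hx
      rw [deriv_mul_const (hχ.differentiable (by simp) r), (hη x hx).self_of_nhds,
        gradient_const_mul hηf, gradient_congr (hη x hx), inner_smul_right]
    rw [integral_congr_ae e, integral_add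
      ((Continuous.integrable_of_compl_closedBall (hsupp r) hf.continuous).const_mul _)
      ((h_int r hr).const_mul _), integral_const_mul, integral_const_mul]
  · refine HasCompactSupport.intro' (hχc.isCompact.prod η.hasCompactSupport.isCompact)
      ((isClosed_tsupport _).prod (isClosed_tsupport _)) fun p hp => ?_
    by_cases h1 : p.1 ∈ tsupport χ
    · have h2 : p.2 ∉ tsupport η := fun h2 => hp ⟨h1, h2⟩
      rw [image_eq_zero_of_notMem_tsupport h2]
      simp
    · rw [image_eq_zero_of_notMem_tsupport h1, zero_mul]
  · refine (closure_minimal (t := tsupport χ ×ˢ (univ : Set (E d))) (fun p hp => ?_)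
      ((isClosed_tsupport _).prod isClosed_univ)).trans (prod_mono hχs subset_rfl)
    refine ⟨subset_tsupport _ fun h0 => hp ?_, mem_univ _⟩
    simp [h0]

/-- A solution of the continuity equation whose velocity is bounded by `V` has speed bound `V`. -/
theorem hasSpeedBound_of_continuityEquation (hμ : Continuous μ)
    (hsupp : ∀ t, (μ t : Measure (E d)) (Metric.closedBall 0 R)ᶜ = 0)
    (hv : Measurable (Function.uncurry v)) (hV : ∀ t, 0 ≤ V t)
    (hVi : IntervalIntegrable V volume 0 1)
    (hvV : ∀ᵐ t ∂(volume.restrict (Icc (0 : ℝ) 1)), ∀ x, ‖v t x‖ ≤ V t)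
    (hce : ContinuityEquation μ v) : HasSpeedBound R μ V where
  cont := hμ
  supp := hsupp
  nonneg := hV
  int := hVi
  bound f hf s t hs hst ht := by
    obtain ⟨hGi, hG⟩ := integral_sub_eq_of_continuityEquation hμ hsupp hv hVi hvV hce hf
    rw [hG s t hs hst ht, ← Real.norm_eq_abs]
    have hdc : Continuous fun x => ‖fderiv ℝ f x‖ := (hf.continuous_fderiv (by simp)).norm
    have hsub : uIcc s t ⊆ uIcc (0 : ℝ) 1 := by
      rw [uIcc_of_le hst, uIcc_of_le zero_le_one]; exact Icc_subset_Icc hs ht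
    refine intervalIntegral.norm_integral_le_of_norm_le hst ?_
      ((hVi.mono_set hsub).mul_continuousOn
        (continuous_integral_curve hμ hsupp hdc).continuousOn)
    have h1 : ∀ᵐ r, r ∈ Icc (0 : ℝ) 1 → ∀ x, ‖v r x‖ ≤ V r :=
      (ae_restrict_iff' measurableSet_Icc).1 hvV
    filter_upwards [h1] with r hr hrst
    have hr' := hr ⟨hs.trans hrst.1.le, hrst.2.trans ht⟩
    rw [← integral_const_mul]
    refine norm_integral_le_of_norm_le
      ((Continuous.integrable_of_compl_closedBall (hsupp r) hdc).const_mul _)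
      (ae_of_all _ fun x => (norm_inner_le_norm _ _).trans ?_)
    rw [norm_gradient]
    exact mul_le_mul_of_nonneg_right (hr' x) (norm_nonneg _)

end

/-! ### Regular pairs, Gronwall's inequality and the uniform radius. -/

section

variable {d : ℕ} {R : ℝ} {μ : ℝ → ProbabilityMeasure (E d)} {V : ℝ → ℝ} {v γ : ℝ → E d → E d}

theorem integral_mul_le_sqrt_mul_sqrt {X : Type*} [MeasurableSpace X] {τ : Measure X} {f g : X → ℝ}
    (hf0 : ∀ x, 0 ≤ f x) (hg0 : ∀ x, 0 ≤ g x) (hf : MemLp f 2 τ) (hg : MemLp g 2 τ) :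
    ∫ x, f x * g x ∂τ ≤ √(∫ x, f x ^ 2 ∂τ) * √(∫ x, g x ^ 2 ∂τ) := by
  have h2 : ENNReal.ofReal 2 = 2 := by simp
  have := integral_mul_le_Lp_mul_Lq_of_nonneg (p := 2) (q := 2) (μ := τ) Real.HolderConjugate.two_two
    (ae_of_all _ hf0) (ae_of_all _ hg0) (by rwa [h2]) (by rwa [h2])
  simpa [Real.sqrt_eq_rpow] using this

theorem lintegral_enorm_sq_lt_top_iff {X F : Type*} [MeasurableSpace X] {τ : Measure X}
    [NormedAddCommGroup F] {f : X → F} (hf : AEStronglyMeasurable f τ) :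
    ∫⁻ x, ‖f x‖ₑ ^ 2 ∂τ < ⊤ ↔ MemLp f 2 τ := by
  rw [MemLp, eLpNorm_lt_top_iff_lintegral_rpow_enorm_lt_top two_ne_zero ENNReal.ofNat_ne_top]
  simp [hf]

/-- A curve in a fixed ball together with a square-integrable momentum of zero mean solving the
continuity equation. -/
structure RegularPair (R : ℝ) (μ : ℝ → ProbabilityMeasure (E d)) (γ : ℝ → E d → E d) : Prop where
  cont : Continuous μ
  supp : ∀ t, (μ t : Measure (E d)) (Metric.closedBall 0 R)ᶜ = 0
  momentum : IsL2Momentum μ γ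
  zeroMean : ∀ᵐ t ∂(volume.restrict (Icc (0 : ℝ) 1)), ∫ x, γ t x ∂(μ t : Measure (E d)) = 0
  continuity : ContinuityEquation μ (fun t => edConv (μ t) (γ t))

/-- The norm of `γ_t` in `L²(μ_t)`. -/
noncomputable def momentumNorm (μ : ℝ → ProbabilityMeasure (E d)) (γ : ℝ → E d → E d) (t : ℝ) : ℝ :=
  √(∫ x, ‖γ t x‖ ^ 2 ∂(μ t : Measure (E d)))

theorem momentumNorm_nonneg (t : ℝ) : 0 ≤ momentumNorm μ γ t := Real.sqrt_nonneg _

theorem momentumNorm_sq (t : ℝ) :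
    momentumNorm μ γ t ^ 2 = ∫ x, ‖γ t x‖ ^ 2 ∂(μ t : Measure (E d)) :=
  Real.sq_sqrt (integral_nonneg fun _ => by positivity)

/-- Disintegration turns the family of spaces `L²(μ_t)` into one Hilbert space over space-time,
where duality is available. -/
theorem isL2Momentum_iff (hμ : Continuous μ) : IsL2Momentum μ γ ↔
    Measurable (Function.uncurry γ) ∧ MemLp (Function.uncurry γ) 2 (spaceTime μ hμ) := by
  refine and_congr_right fun hγ => ?_
  rw [← lintegral_enorm_sq_lt_top_iff hγ.aestronglyMeasurable, spaceTime,
    Measure.lintegral_compProd (by fun_prop)]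
  rfl

theorem IsL2Momentum.memLp (h : IsL2Momentum μ γ) (hμ : Continuous μ) :
    MemLp (Function.uncurry γ) 2 (spaceTime μ hμ) := ((isL2Momentum_iff hμ).1 h).2

theorem IsL2Momentum.measurable (h : IsL2Momentum μ γ) (t : ℝ) : Measurable (γ t) :=
  h.1.comp measurable_prodMk_left

theorem integral_spaceTime {F : Type*} [NormedAddCommGroup F] [NormedSpace ℝ F] (hμ : Continuous μ)
    {f : ℝ × E d → F} (hf : Integrable f (spaceTime μ hμ)) :
    ∫ p, f p ∂(spaceTime μ hμ)
      = ∫ t in (0 : ℝ)..1, ∫ x, f (t, x) ∂(μ t : Measure (E d)) := by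
  rw [spaceTime, Measure.integral_compProd hf, intervalIntegral.integral_of_le zero_le_one,
    ← integral_Icc_eq_integral_Ioc]
  rfl

theorem integrable_integral_curve {F : Type*} [NormedAddCommGroup F] [NormedSpace ℝ F]
    (hμ : Continuous μ) {f : ℝ × E d → F} (hf : Integrable f (spaceTime μ hμ)) :
    Integrable (fun t => ∫ x, f (t, x) ∂(μ t : Measure (E d))) (volume.restrict (Icc (0 : ℝ) 1)) :=
  hf.integral_compProd

theorem IsL2Momentum.ae_memLp (h : IsL2Momentum μ γ) (hμ : Continuous μ) :
    ∀ᵐ t ∂(volume.restrict (Icc (0 : ℝ) 1)), MemLp (γ t) 2 (μ t : Measure (E d)) := by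
  have hm : Measurable fun t => ∫⁻ x, ‖γ t x‖ₑ ^ 2 ∂(μ t : Measure (E d)) := by
    have h1 : Measurable fun p : ℝ × E d => ‖γ p.1 p.2‖ₑ ^ 2 := h.1.enorm.pow_const 2
    exact h1.lintegral_kernel_prod_right' (κ := curveKernel μ hμ)
  filter_upwards [ae_lt_top hm h.2.ne] with t ht
  exact (lintegral_enorm_sq_lt_top_iff (h.measurable t).aestronglyMeasurable).1 ht

theorem IsL2Momentum.integrable_norm_sq (h : IsL2Momentum μ γ) (hμ : Continuous μ) :
    Integrable (fun p => ‖Function.uncurry γ p‖ ^ 2) (spaceTime μ hμ) :=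
  (h.memLp hμ).integrable_norm_pow two_ne_zero

theorem measurable_momentumNorm (h : IsL2Momentum μ γ) (hμ : Continuous μ) :
    Measurable (momentumNorm μ γ) := by
  have h1 : Measurable fun p : ℝ × E d => ‖γ p.1 p.2‖ ^ 2 := h.1.norm.pow_const 2
  exact (stronglyMeasurable_integral_curve hμ h1.stronglyMeasurable).measurable.sqrt

theorem integrable_momentumNorm_sq (h : IsL2Momentum μ γ) (hμ : Continuous μ) :
    Integrable (fun t => momentumNorm μ γ t ^ 2) (volume.restrict (Icc (0 : ℝ) 1)) := by
  simp only [momentumNorm_sq]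
  exact integrable_integral_curve hμ (h.integrable_norm_sq hμ)

theorem memLp_momentumNorm (h : IsL2Momentum μ γ) (hμ : Continuous μ) :
    MemLp (momentumNorm μ γ) 2 (volume.restrict (Icc (0 : ℝ) 1)) :=
  (memLp_two_iff_integrable_sq (measurable_momentumNorm h hμ).aestronglyMeasurable).2
    (integrable_momentumNorm_sq h hμ)

theorem intervalIntegrable_of_restrict_Icc {f : ℝ → ℝ}
    (hf : Integrable f (volume.restrict (Icc (0 : ℝ) 1))) : IntervalIntegrable f volume 0 1 :=
  (intervalIntegrable_iff_integrableOn_Icc_of_le zero_le_one).2 hf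

/-- Cauchy–Schwarz isolates the root second moment. That factor is at most the support radius, so
the growth of the radius is governed by a linear inequality. -/
theorem norm_edConv_le_mul {α : ProbabilityMeasure (E d)} {g : E d → E d}
    (hα : (α : Measure (E d)) (Metric.closedBall 0 R)ᶜ = 0) (hg : MemLp g 2 (α : Measure (E d)))
    (hg0 : ∫ x, g x ∂(α : Measure (E d)) = 0) (x : E d) :
    ‖edConv α g x‖ ≤ √(∫ y, ‖y‖ ^ 2 ∂(α : Measure (E d)))
      * √(∫ y, ‖g y‖ ^ 2 ∂(α : Measure (E d))) := by
  refine (norm_edConv_le (hg.integrable one_le_two) hα hg0 x).trans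
    (integral_mul_le_sqrt_mul_sqrt (fun _ => norm_nonneg _) (fun _ => norm_nonneg _) ?_ hg.norm)
  refine MemLp.of_bound (by fun_prop) R ?_
  filter_upwards [ae_norm_le_of_compl_closedBall hα] with y hy
  simpa using hy

theorem sqrt_integral_norm_sq_le {α : ProbabilityMeasure (E d)} (hR : 0 ≤ R)
    (hα : (α : Measure (E d)) (Metric.closedBall 0 R)ᶜ = 0) :
    √(∫ y, ‖y‖ ^ 2 ∂(α : Measure (E d))) ≤ R := by
  rw [Real.sqrt_le_left hR]
  calc ∫ y, ‖y‖ ^ 2 ∂(α : Measure (E d)) ≤ ∫ y, R ^ 2 ∂(α : Measure (E d)) := by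
        refine integral_mono_ae (Continuous.integrable_of_compl_closedBall hα (by fun_prop))
          (integrable_const _) ?_
        filter_upwards [ae_norm_le_of_compl_closedBall hα] with y hy
        exact pow_le_pow_left₀ (norm_nonneg _) hy 2
    _ = R ^ 2 := by simp

theorem nonneg_of_compl_closedBall {α : ProbabilityMeasure (E d)}
    (hα : (α : Measure (E d)) (Metric.closedBall 0 R)ᶜ = 0) : 0 ≤ R := by
  by_contra! hneg
  rw [Metric.closedBall_eq_empty.2 hneg, compl_empty, measure_univ] at hα
  exact one_ne_zero hα

/-- The speed bound of a regular pair in terms of second moments. -/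
theorem RegularPair.hasSpeedBound (h : RegularPair R μ γ) : HasSpeedBound R μ
    (fun t => √(∫ y, ‖y‖ ^ 2 ∂(μ t : Measure (E d))) * momentumNorm μ γ t) := by
  have hc : Continuous fun t => √(∫ y, ‖y‖ ^ 2 ∂(μ t : Measure (E d))) :=
    Real.continuous_sqrt.comp (continuous_integral_curve h.cont h.supp (by fun_prop))
  refine hasSpeedBound_of_continuityEquation (v := fun t => edConv (μ t) (γ t)) h.cont h.supp
    (measurable_edConv_curve h.cont h.momentum.1)
    (fun t => mul_nonneg (Real.sqrt_nonneg _) (momentumNorm_nonneg _))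
    ((intervalIntegrable_of_restrict_Icc
      ((memLp_momentumNorm h.momentum h.cont).integrable one_le_two)).continuousOn_mul
      hc.continuousOn) ?_ h.continuity
  filter_upwards [h.momentum.ae_memLp h.cont, h.zeroMean] with t ht ht0 x
  exact norm_edConv_le_mul (h.supp t) ht ht0 x

theorem HasSpeedBound.mono {W : ℝ → ℝ} (h : HasSpeedBound R μ V) (hVW : ∀ t, V t ≤ W t)
    (hW : IntervalIntegrable W volume 0 1) : HasSpeedBound R μ W where
  cont := h.cont
  supp := h.supp
  nonneg t := (h.nonneg t).trans (hVW t)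
  int := hW
  bound f hf s t hs hst ht := by
    have hdc : Continuous fun x : E d => ‖fderiv ℝ f x‖ := (hf.continuous_fderiv (by simp)).norm
    refine (h.bound f hf s t hs hst ht).trans (intervalIntegral.integral_mono_on hst
      (h.intervalIntegrable_mul hdc hs hst ht) ?_ fun r _ =>
      mul_le_mul_of_nonneg_right (hVW r) (integral_nonneg fun _ => norm_nonneg _))
    refine (hW.mono_set ?_).mul_continuousOn (h.continuous_integral hdc).continuousOn
    rw [uIcc_of_le hst, uIcc_of_le zero_le_one]; exact Icc_subset_Icc hs ht

/-- The speed bound of a regular pair in terms of the radius of the ball. -/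
theorem RegularPair.hasSpeedBound_radius (h : RegularPair R μ γ) :
    HasSpeedBound R μ (fun t => R * momentumNorm μ γ t) :=
  h.hasSpeedBound.mono (fun t => mul_le_mul_of_nonneg_right
    (sqrt_integral_norm_sq_le (nonneg_of_compl_closedBall (h.supp t)) (h.supp t))
    (momentumNorm_nonneg _))
    ((intervalIntegrable_of_restrict_Icc
      ((memLp_momentumNorm h.momentum h.cont).integrable one_le_two)).const_mul R)

theorem HasSpeedBound.supp_closedBall (h : HasSpeedBound R μ V) {R₀ : ℝ}
    (h0 : (μ 0 : Measure (E d)) (Metric.closedBall 0 R₀)ᶜ = 0) {t : ℝ} (ht : 0 ≤ t) (ht1 : t ≤ 1) :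
    (μ t : Measure (E d)) (Metric.closedBall 0 (R₀ + ∫ r in (0 : ℝ)..t, V r))ᶜ = 0 := by
  obtain ⟨π, h1, h2, h3⟩ := h.exists_coupling le_rfl ht ht1
  rw [← h1, Measure.map_apply measurable_fst Metric.isClosed_closedBall.measurableSet.compl] at h0
  rw [← h2, Measure.map_apply measurable_snd Metric.isClosed_closedBall.measurableSet.compl]
  have h0' : ∀ᵐ z ∂π, z.1 ∈ Metric.closedBall (0 : E d) R₀ := h0
  have : ∀ᵐ z ∂π, z.2 ∈ Metric.closedBall (0 : E d) (R₀ + ∫ r in (0 : ℝ)..t, V r) := by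
    filter_upwards [h0', h3] with z hz hz'
    rw [Metric.mem_closedBall] at hz ⊢
    have := dist_triangle z.2 z.1 0
    rw [dist_comm] at hz'
    linarith
  exact this

theorem intervalIntegral_mul_sq_le {f g : ℝ → ℝ} {t : ℝ} (ht : 0 ≤ t) (hf0 : ∀ x, 0 ≤ f x)
    (hg0 : ∀ x, 0 ≤ g x) (hf : MemLp f 2 (volume.restrict (Ioc 0 t)))
    (hg : MemLp g 2 (volume.restrict (Ioc 0 t))) :
    (∫ r in (0 : ℝ)..t, f r * g r) ^ 2
      ≤ (∫ r in (0 : ℝ)..t, f r ^ 2) * ∫ r in (0 : ℝ)..t, g r ^ 2 := by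
  simp only [intervalIntegral.integral_of_le ht]
  have h := integral_mul_le_sqrt_mul_sqrt hf0 hg0 hf hg
  have h0 : 0 ≤ ∫ r in Ioc 0 t, f r * g r :=
    integral_nonneg fun r => mul_nonneg (hf0 r) (hg0 r)
  calc _ ≤ (√(∫ r in Ioc 0 t, f r ^ 2) * √(∫ r in Ioc 0 t, g r ^ 2)) ^ 2 :=
        pow_le_pow_left₀ h0 h 2
    _ = _ := by
        rw [mul_pow, Real.sq_sqrt (integral_nonneg fun _ => by positivity),
          Real.sq_sqrt (integral_nonneg fun _ => by positivity)]

/-- A Gronwall inequality with square-integrable coefficient. -/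
theorem exists_bound_of_le_add_integral_mul (R₀ B : ℝ) : ∃ K : ℝ, ∀ ρ g : ℝ → ℝ,
    Continuous ρ → (∀ t, 0 ≤ ρ t) → (∀ t, 0 ≤ g t) →
    MemLp g 2 (volume.restrict (Icc (0 : ℝ) 1)) → ∫ t in (0 : ℝ)..1, g t ^ 2 ≤ B →
    (∀ t ∈ Icc (0 : ℝ) 1, ρ t ≤ R₀ + ∫ r in (0 : ℝ)..t, ρ r * g r) → ∀ t ∈ Icc (0 : ℝ) 1, ρ t ≤ K := by
  -- Cauchy–Schwarz gives `ρ² ≤ 2 R₀² + 2 B y` with `y = ∫ ρ²`, a differential inequality to which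
  -- Gronwall applies. The final `1` turns a bound on `ρ²` into one on `ρ`.
  refine ⟨2 * R₀ ^ 2 + 2 * B * gronwallBound 0 (2 * B) (2 * R₀ ^ 2) 1 + 1,
    fun ρ g hρ hρ0 hg0 hg hgB h => ?_⟩
  set y : ℝ → ℝ := fun t => ∫ r in (0 : ℝ)..t, ρ r ^ 2 with hy
  have hy0 : ∀ t, 0 ≤ t → 0 ≤ y t := fun t ht =>
    intervalIntegral.integral_nonneg ht fun _ _ => by positivity
  have hB : 0 ≤ B := le_trans (intervalIntegral.integral_nonneg zero_le_one
    fun _ _ => by positivity) hgB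
  have hg2 : IntervalIntegrable (fun t => g t ^ 2) volume 0 1 :=
    intervalIntegrable_of_restrict_Icc ((memLp_two_iff_integrable_sq hg.1).1 hg)
  have hsq : ∀ t ∈ Icc (0 : ℝ) 1, ρ t ^ 2 ≤ 2 * R₀ ^ 2 + 2 * B * y t := by
    intro t ht
    have hsub : Ioc 0 t ⊆ Icc (0 : ℝ) 1 := fun r hr => ⟨hr.1.le, hr.2.trans ht.2⟩
    have h1 := intervalIntegral_mul_sq_le (f := ρ) (g := g) ht.1 hρ0 hg0
      ((memLp_two_iff_integrable_sq hρ.aestronglyMeasurable).2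
        ((hρ.pow 2).integrableOn_Icc.mono_set hsub))
      (hg.mono_measure (Measure.restrict_mono hsub le_rfl))
    have h2 : ∫ r in (0 : ℝ)..t, g r ^ 2 ≤ B := by
      refine le_trans ?_ hgB
      exact intervalIntegral.integral_mono_interval le_rfl ht.1 ht.2
        (ae_of_all _ fun _ => sq_nonneg _) hg2
    have h3 : (∫ r in (0 : ℝ)..t, ρ r * g r) ^ 2 ≤ y t * B :=
      h1.trans (mul_le_mul_of_nonneg_left h2 (hy0 t ht.1))
    have h4 := pow_le_pow_left₀ (hρ0 t) (h t ht) 2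
    nlinarith [sq_nonneg (R₀ - ∫ r in (0 : ℝ)..t, ρ r * g r)]
  have hder : ∀ t, HasDerivAt y (ρ t ^ 2) t := fun t =>
    intervalIntegral.integral_hasDerivAt_right ((hρ.pow 2).intervalIntegrable _ _)
      ((hρ.pow 2).stronglyMeasurableAtFilter _ _) (hρ.pow 2).continuousAt
  have hgr := norm_le_gronwallBound_of_norm_deriv_right_le (f := y) (f' := fun t => ρ t ^ 2)
    (δ := 0) (K := 2 * B) (ε := 2 * R₀ ^ 2) (a := 0) (b := 1)
    (fun t _ => (hder t).continuousAt.continuousWithinAt)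
    (fun t _ => (hder t).hasDerivWithinAt) (by simp [hy])
    (fun t ht => by
      rw [Real.norm_of_nonneg (by positivity), Real.norm_of_nonneg (hy0 t ht.1)]
      linarith [hsq t ⟨ht.1, ht.2.le⟩])
  intro t ht
  have hy1 : y t ≤ y 1 := intervalIntegral.integral_mono_interval le_rfl ht.1 ht.2
    (ae_of_all _ fun _ => sq_nonneg _) ((hρ.pow 2).intervalIntegrable _ _)
  have h5 := hgr 1 (by simp)
  rw [Real.norm_of_nonneg (hy0 1 zero_le_one), sub_zero] at h5
  have h6 := hsq t ht
  have h7 : 2 * B * y t ≤ 2 * B * gronwallBound 0 (2 * B) (2 * R₀ ^ 2) 1 := by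
    gcongr; exact hy1.trans h5
  nlinarith [sq_nonneg (ρ t - 1)]

/-- The support of a regular pair stays in a ball that depends only on the initial support and on
the momentum bound. -/
theorem exists_uniform_radius (d : ℕ) (R₀ B : ℝ) : ∃ K : ℝ, ∀ (R : ℝ)
    (μ : ℝ → ProbabilityMeasure (E d)) (γ : ℝ → E d → E d), RegularPair R μ γ →
    (μ 0 : Measure (E d)) (Metric.closedBall 0 R₀)ᶜ = 0 →
    ∫ t in (0 : ℝ)..1, momentumNorm μ γ t ^ 2 ≤ B →
    ∀ t ∈ Icc (0 : ℝ) 1, (μ t : Measure (E d)) (Metric.closedBall 0 K)ᶜ = 0 := by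
  obtain ⟨K, hK⟩ := exists_bound_of_le_add_integral_mul R₀ B
  -- The displacement is at most `∫ ρ ‖γ‖ ≤ K ∫ (1 + ‖γ‖²) ≤ K * (1 + B)`; the a priori radius `R`
  -- does not enter.
  refine ⟨R₀ + K * (1 + B), fun R μ γ h h0 hB t ht => ?_⟩
  set ρ : ℝ → ℝ := fun t => √(∫ y, ‖y‖ ^ 2 ∂(μ t : Measure (E d)))
  have hs := h.hasSpeedBound
  have hR₀ : 0 ≤ R₀ := nonneg_of_compl_closedBall h0
  have h_int : ∀ t ∈ Icc (0 : ℝ) 1, 0 ≤ ∫ r in (0 : ℝ)..t, ρ r * momentumNorm μ γ r := fun t ht =>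
    intervalIntegral.integral_nonneg ht.1 fun r _ => hs.nonneg r
  have hsupp : ∀ t ∈ Icc (0 : ℝ) 1, (μ t : Measure (E d))
      (Metric.closedBall 0 (R₀ + ∫ r in (0 : ℝ)..t, ρ r * momentumNorm μ γ r))ᶜ = 0 := fun t ht =>
    hs.supp_closedBall h0 ht.1 ht.2
  have hg := memLp_momentumNorm h.momentum h.cont
  -- The loop closes here: the root second moment is at most the support radius, which is itself
  -- bounded by `R₀ + ∫ ρ ‖γ‖`.
  have hρK := hK ρ (momentumNorm μ γ)
    (Real.continuous_sqrt.comp (continuous_integral_curve h.cont h.supp (by fun_prop)))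
    (fun _ => Real.sqrt_nonneg _) (fun _ => momentumNorm_nonneg _) hg hB
    (fun t ht => sqrt_integral_norm_sq_le (add_nonneg hR₀ (h_int t ht)) (hsupp t ht))
  have hK0 : 0 ≤ K := (Real.sqrt_nonneg _).trans (hρK t ht)
  have hgi : IntervalIntegrable (momentumNorm μ γ) volume 0 1 :=
    intervalIntegrable_of_restrict_Icc (hg.integrable one_le_two)
  have hgi2 : IntervalIntegrable (fun t => momentumNorm μ γ t ^ 2) volume 0 1 :=
    intervalIntegrable_of_restrict_Icc (integrable_momentumNorm_sq h.momentum h.cont)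
  have hsub : uIcc 0 t ⊆ uIcc (0 : ℝ) 1 := by
    rw [uIcc_of_le ht.1, uIcc_of_le zero_le_one]; exact Icc_subset_Icc le_rfl ht.2
  have h1 : ∫ r in (0 : ℝ)..t, ρ r * momentumNorm μ γ r ≤ K * (1 + B) := by
    calc ∫ r in (0 : ℝ)..t, ρ r * momentumNorm μ γ r
        ≤ ∫ r in (0 : ℝ)..1, ρ r * momentumNorm μ γ r :=
          intervalIntegral.integral_mono_interval le_rfl ht.1 ht.2
            (ae_of_all _ fun r => hs.nonneg r) hs.int
      _ ≤ ∫ r in (0 : ℝ)..1, K * (1 + momentumNorm μ γ r ^ 2) := by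
          refine intervalIntegral.integral_mono_on zero_le_one hs.int
            ((intervalIntegrable_const.add hgi2).const_mul K) fun r hr => ?_
          refine mul_le_mul (hρK r hr) ?_ (momentumNorm_nonneg _) hK0
          nlinarith [sq_nonneg (momentumNorm μ γ r - 1)]
      _ ≤ K * (1 + B) := by
          rw [intervalIntegral.integral_const_mul,
            intervalIntegral.integral_add intervalIntegrable_const hgi2]
          simp only [intervalIntegral.integral_const, sub_zero, smul_eq_mul, mul_one]
          gcongr
  exact measure_mono_null (compl_subset_compl.2 (Metric.closedBall_subset_closedBall
    (by linarith))) (hsupp t ht)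

end

/-! ### Passing between admissible and regular pairs. -/

section

variable {d : ℕ} {R : ℝ} {μ μ' : ℝ → ProbabilityMeasure (E d)} {γ : ℝ → E d → E d}

/-- Some coupling has root mean square displacement below `δ`, hence mean displacement at most `δ`,
and a Lipschitz function changes in proportion. -/
theorem abs_integral_sub_le_of_W2_lt {α β : ProbabilityMeasure (E d)} {f : E d → ℝ} {C : NNReal}
    (hf : LipschitzWith C f) (hfb : ∃ B, ∀ x y, dist (f x) (f y) ≤ B) {δ : ℝ} (hδ : 0 ≤ δ)
    (h : W2 α β < ENNReal.ofReal δ) :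
    |∫ x, f x ∂(α : Measure (E d)) - ∫ x, f x ∂(β : Measure (E d))| ≤ C * δ := by
  obtain ⟨⟨π, h1, h2⟩, hπ⟩ := iInf_lt_iff.1 h
  have hp : IsProbabilityMeasure π := ⟨by
    rw [← preimage_univ (f := Prod.fst), ← Measure.map_apply measurable_fst .univ, h1]
    exact measure_univ⟩
  obtain ⟨B, hB⟩ := hfb
  have hfb' : ∀ x, ‖f x‖ ≤ ‖f 0‖ + B := fun x => by
    have := hB x 0
    rw [dist_eq_norm] at this
    linarith [norm_sub_norm_le (f x) (f 0)]
  have hfc : Continuous f := hf.continuous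
  have i1 : Integrable (fun z : E d × E d => f z.1) π :=
    Integrable.of_bound (by fun_prop) _ (ae_of_all _ fun z => hfb' z.1)
  have i2 : Integrable (fun z : E d × E d => f z.2) π :=
    Integrable.of_bound (by fun_prop) _ (ae_of_all _ fun z => hfb' z.2)
  rw [← h1, ← h2, integral_map measurable_fst.aemeasurable hfc.aestronglyMeasurable,
    integral_map measurable_snd.aemeasurable hfc.aestronglyMeasurable, ← integral_sub i1 i2,
    ← Real.norm_eq_abs, ← ENNReal.ofReal_le_ofReal_iff (by positivity), ofReal_norm]
  have hdm : AEStronglyMeasurable (fun z : E d × E d => dist z.1 z.2) π := by fun_prop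
  have e1 := eLpNorm_le_eLpNorm_of_exponent_le (p := 1) (q := 2) one_le_two hdm
  rw [eLpNorm_one_eq_lintegral_enorm,
    eLpNorm_eq_lintegral_rpow_enorm_toReal two_ne_zero ENNReal.ofNat_ne_top] at e1
  have e2 : ∀ z : E d × E d, ‖dist z.1 z.2‖ₑ = edist z.1 z.2 := fun z => by
    rw [edist_dist, Real.enorm_eq_ofReal dist_nonneg]
  simp only [e2, ENNReal.toReal_ofNat, ENNReal.rpow_ofNat] at e1
  calc ‖∫ z, (f z.1 - f z.2) ∂π‖ₑ ≤ ∫⁻ z, ‖f z.1 - f z.2‖ₑ ∂π := enorm_integral_le_lintegral_enorm _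
    _ ≤ ∫⁻ z, C * edist z.1 z.2 ∂π := lintegral_mono fun z => by
        rw [← edist_eq_enorm_sub]; exact hf z.1 z.2
    _ = C * ∫⁻ z, edist z.1 z.2 ∂π := lintegral_const_mul _ (by fun_prop)
    _ ≤ C * ENNReal.ofReal δ := by gcongr; exact e1.trans hπ.le
    _ = ENNReal.ofReal (C * δ) := by
        rw [ENNReal.ofReal_mul (NNReal.coe_nonneg C), ENNReal.ofReal_coe_nnreal]

/-- The curve that is constant before time `0` and after time `1`. -/
noncomputable def clampCurve (μ : ℝ → ProbabilityMeasure (E d)) (t : ℝ) : ProbabilityMeasure (E d) :=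
  μ (projIcc (0 : ℝ) 1 zero_le_one t)

theorem clampCurve_of_mem {t : ℝ} (ht : t ∈ Icc (0 : ℝ) 1) : clampCurve μ t = μ t := by
  rw [clampCurve, projIcc_of_mem _ ht]

theorem clampCurve_projIcc (t : ℝ) :
    clampCurve μ t = clampCurve μ (projIcc (0 : ℝ) 1 zero_le_one t) := by
  rw [clampCurve, clampCurve, projIcc_val]

/-- Narrow convergence may be tested on bounded Lipschitz functions, whose integrals vary along the
curve no faster than a multiple of the primitive of `|m|`. -/
theorem IsAC2Curve.continuous_clampCurve {C : Set (E d)} (h : IsAC2Curve C μ) :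
    Continuous (clampCurve μ) := by
  obtain ⟨-, m, hm, hW⟩ := h
  have hmi : IntegrableOn m (Icc 0 1) := hm.integrable one_le_two
  set m' : ℝ → ℝ := (Icc (0 : ℝ) 1).indicator fun r => ‖m r‖
  have hm' : Integrable m' := (integrable_indicator_iff measurableSet_Icc).2 hmi.norm
  set F : ℝ → ℝ := fun t => ∫ r in (0 : ℝ)..t, m' r
  have hF : Continuous F :=
    intervalIntegral.continuous_primitive (fun a b => hm'.intervalIntegrable) 0
  have hm'0 : ∀ r, 0 ≤ m' r := fun r => indicator_nonneg (fun _ _ => norm_nonneg _) r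
  have hFd : ∀ s t : ℝ, 0 ≤ s → s ≤ t → t ≤ 1 →
      0 ≤ F t - F s ∧ ∫⁻ r in Icc s t, ‖m r‖ₑ = ENNReal.ofReal (F t - F s) := by
    intro s t hs hst ht
    have e : F t - F s = ∫ r in s..t, m' r := intervalIntegral.integral_interval_sub_left
      hm'.intervalIntegrable hm'.intervalIntegrable
    refine ⟨e ▸ intervalIntegral.integral_nonneg hst fun r _ => hm'0 r, ?_⟩
    rw [e, intervalIntegral.integral_of_le hst, ← integral_Icc_eq_integral_Ioc,
      setIntegral_congr_fun (g := fun r => ‖m r‖) measurableSet_Icc fun r hr =>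
        indicator_of_mem (s := Icc (0 : ℝ) 1) ⟨hs.trans hr.1, hr.2.trans ht⟩ _,
      ofReal_integral_norm_eq_lintegral_enorm
        (hmi.mono_set (Icc_subset_Icc hs ht))]
  have key : ∀ (f : E d → ℝ) (C : NNReal), LipschitzWith C f → (∃ B, ∀ x y, dist (f x) (f y) ≤ B) →
      ∀ s t : ℝ, 0 ≤ s → s ≤ t → t ≤ 1 →
      |∫ x, f x ∂(μ s : Measure (E d)) - ∫ x, f x ∂(μ t : Measure (E d))| ≤ C * |F t - F s| := by
    intro f C hf hfb s t hs hst ht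
    obtain ⟨h0, h1⟩ := hFd s t hs hst ht
    rw [abs_of_nonneg h0]
    -- Extracting a coupling from the infimum needs a strict inequality, so a slack `ε` is added and
    -- sent to zero.
    have hlim : Tendsto (fun ε : ℝ => (C : ℝ) * (F t - F s + ε)) (𝓝[>] 0)
        (𝓝 (C * (F t - F s + 0))) :=
      ((continuous_const.mul (continuous_const.add continuous_id)).tendsto 0).mono_left
        nhdsWithin_le_nhds
    rw [add_zero] at hlim
    refine ge_of_tendsto hlim ?_
    filter_upwards [self_mem_nhdsWithin] with ε hε
    rw [mem_Ioi] at hε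
    refine abs_integral_sub_le_of_W2_lt hf hfb (by linarith) ((hW s t hs hst ht).trans_lt ?_)
    rw [h1]
    exact (ENNReal.ofReal_lt_ofReal_iff (by linarith)).2 (by linarith)
  refine continuous_iff_continuousAt.2 fun t₀ => ?_
  rw [ContinuousAt, tendsto_iff_forall_lipschitz_integral_tendsto]
  rintro f hfb ⟨C, hf⟩
  have hG : Continuous fun t => F (projIcc (0 : ℝ) 1 zero_le_one t) :=
    hF.comp (continuous_subtype_val.comp continuous_projIcc)
  refine tendsto_iff_dist_tendsto_zero.2 (squeeze_zero (fun _ => dist_nonneg)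
    (g := fun t => C * |F (projIcc (0 : ℝ) 1 zero_le_one t)
      - F (projIcc (0 : ℝ) 1 zero_le_one t₀)|) (fun t => ?_) ?_)
  · rw [Real.dist_eq, clampCurve, clampCurve]
    set a := projIcc (0 : ℝ) 1 zero_le_one t
    set b := projIcc (0 : ℝ) 1 zero_le_one t₀
    rcases le_total (a : ℝ) b with hab | hab
    · rw [abs_sub_comm (F a)]
      exact key f C hf hfb a b a.2.1 hab b.2.2
    · rw [abs_sub_comm]
      exact key f C hf hfb b a b.2.1 hab a.2.2
  · have : Tendsto (fun t => (C : ℝ) * |F (projIcc (0 : ℝ) 1 zero_le_one t)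
      - F (projIcc (0 : ℝ) 1 zero_le_one t₀)|) (𝓝 t₀) (𝓝 (C * |F (projIcc (0 : ℝ) 1 zero_le_one t₀)
      - F (projIcc (0 : ℝ) 1 zero_le_one t₀)|)) :=
      (continuous_const.mul (hG.sub continuous_const).abs).tendsto t₀
    simpa using this

theorem IsL2Momentum.congr (h : IsL2Momentum μ γ) (hμ : ∀ t ∈ Icc (0 : ℝ) 1, μ' t = μ t) :
    IsL2Momentum μ' γ := by
  refine ⟨h.1, ?_⟩
  rw [setLIntegral_congr_fun (g := fun t => ∫⁻ x, ‖γ t x‖ₑ ^ 2 ∂(μ t : Measure (E d)))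
    measurableSet_Icc fun t ht => by simp only [hμ t ht]]
  exact h.2

theorem ContinuityEquation.congr (h : ContinuityEquation μ (fun t => edConv (μ t) (γ t)))
    (hμ : ∀ t ∈ Icc (0 : ℝ) 1, μ' t = μ t) :
    ContinuityEquation μ' (fun t => edConv (μ' t) (γ t)) := by
  intro φ h1 h2 h3
  refine Eq.trans ?_ (h φ h1 h2 h3)
  refine intervalIntegral.integral_congr fun t ht => ?_
  rw [uIcc_of_le zero_le_one] at ht
  simp only [hμ t ht]

theorem zeroMean_congr
    (h : ∀ᵐ t ∂(volume.restrict (Icc (0 : ℝ) 1)), ∫ x, γ t x ∂(μ t : Measure (E d)) = 0)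
    (hμ : ∀ t ∈ Icc (0 : ℝ) 1, μ' t = μ t) :
    ∀ᵐ t ∂(volume.restrict (Icc (0 : ℝ) 1)), ∫ x, γ t x ∂(μ' t : Measure (E d)) = 0 := by
  rw [ae_restrict_iff' measurableSet_Icc] at h ⊢
  filter_upwards [h] with t ht htm
  rw [hμ t htm]
  exact ht htm

theorem RegularPair.clampCurve (h : RegularPair R μ γ) : RegularPair R (clampCurve μ) γ where
  cont := h.cont.comp (continuous_subtype_val.comp continuous_projIcc)
  supp _ := h.supp _
  momentum := h.momentum.congr fun _ ht => clampCurve_of_mem ht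
  zeroMean := zeroMean_congr h.zeroMean fun _ ht => clampCurve_of_mem ht
  continuity := h.continuity.congr fun _ ht => clampCurve_of_mem ht

theorem RegularPair.clampCurve_of_supp {K : ℝ} (h : RegularPair R μ γ)
    (hK : ∀ t ∈ Icc (0 : ℝ) 1, (μ t : Measure (E d)) (Metric.closedBall 0 K)ᶜ = 0) :
    RegularPair K (MomentumMatching.clampCurve μ) γ :=
  { h.clampCurve with supp := fun t => hK _ (projIcc (0 : ℝ) 1 zero_le_one t).2 }

theorem energy_congr {L : ProbabilityMeasure (E d) → ProbabilityMeasure (E d) → ℝ≥0∞}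
    {ν : ProbabilityMeasure (E d)} (hμ : ∀ t ∈ Icc (0 : ℝ) 1, μ' t = μ t) :
    energy L ν μ' γ = energy L ν μ γ := by
  rw [energy, energy, hμ 1 (by simp)]
  have e1 : ∫ t in (0 : ℝ)..1, edEnergy (μ' t) (γ t) = ∫ t in (0 : ℝ)..1, edEnergy (μ t) (γ t) :=
    intervalIntegral.integral_congr fun t ht => by
      rw [uIcc_of_le zero_le_one] at ht
      simp only [hμ t ht]
  have e2 : ∫ t in (0 : ℝ)..1, ∫ x, ‖γ t x‖ ^ 2 ∂(μ' t : Measure (E d))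
      = ∫ t in (0 : ℝ)..1, ∫ x, ‖γ t x‖ ^ 2 ∂(μ t : Measure (E d)) :=
    intervalIntegral.integral_congr fun t ht => by
      rw [uIcc_of_le zero_le_one] at ht
      simp only [hμ t ht]
  rw [e1, e2]

/-- `RegularPair` asks for continuity and support at all real times, while admissibility says
nothing outside `[0, 1]`; clamping bridges the gap without affecting the energy. -/
theorem Admissible.exists_regularPair {Ω : Set (E d)} {μ₀ : ProbabilityMeasure (E d)}
    (h : Admissible Ω μ₀ μ γ) : ∃ R, RegularPair R (clampCurve μ) γ := by
  obtain ⟨C, hCΩ, hC, hcurve⟩ := h.curve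
  obtain ⟨R, hR⟩ := hC.isBounded.subset_closedBall (0 : E d)
  exact ⟨R, hcurve.continuous_clampCurve,
    fun t => measure_mono_null (compl_subset_compl.2 hR)
      (hcurve.1 _ (projIcc (0 : ℝ) 1 zero_le_one t).2),
    h.momentum.congr fun _ ht => clampCurve_of_mem ht,
    zeroMean_congr h.zeroMean fun _ ht => clampCurve_of_mem ht,
    h.continuity.congr fun _ ht => clampCurve_of_mem ht⟩

theorem Admissible.mem_probOn {Ω : Set (E d)} {μ₀ : ProbabilityMeasure (E d)}
    (h : Admissible Ω μ₀ μ γ) {t : ℝ} (ht : t ∈ Icc (0 : ℝ) 1) : μ t ∈ probOn Ω := by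
  obtain ⟨C, hCΩ, -, hcurve⟩ := h.curve
  exact measure_mono_null (compl_subset_compl.2 hCΩ) (hcurve.1 t ht)

/-- A regular pair on a closed set is admissible. -/
theorem RegularPair.admissible {Ω : Set (E d)} (hΩ : IsClosed Ω) {μ₀ : ProbabilityMeasure (E d)}
    (h : RegularPair R μ γ) (h0 : μ 0 = μ₀) (hμΩ : ∀ t ∈ Icc (0 : ℝ) 1, μ t ∈ probOn Ω) :
    Admissible Ω μ₀ μ γ where
  initial := h0
  curve := by
    -- The metric derivative is dominated by `R * ‖γ_t‖`: under the coupling almost no point moves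
    -- farther than its integral, which therefore bounds the quadratic cost.
    refine ⟨Metric.closedBall 0 R ∩ Ω, inter_subset_right, (isCompact_closedBall 0 R).inter_right hΩ,
      fun t ht => ?_, fun t => R * momentumNorm μ γ t,
      (memLp_momentumNorm h.momentum h.cont).const_mul R, fun s t hs hst ht => ?_⟩
    · change (μ t : Measure (E d)) _ = 0
      rw [compl_inter, measure_union_null_iff]
      exact ⟨h.supp t, hμΩ t ht⟩
    · obtain ⟨π, h1, h2, h3⟩ := h.hasSpeedBound_radius.exists_coupling hs hst ht
      have hp : IsProbabilityMeasure π := ⟨by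
        rw [← preimage_univ (f := Prod.fst), ← Measure.map_apply measurable_fst .univ, h1]
        exact measure_univ⟩
      set δ := ∫ r in s..t, R * momentumNorm μ γ r
      have hδ : ENNReal.ofReal δ = ∫⁻ r in Icc s t, ‖R * momentumNorm μ γ r‖ₑ := by
        have hi : IntegrableOn (fun r => R * momentumNorm μ γ r) (Icc s t) :=
          IntegrableOn.mono_set (((memLp_momentumNorm h.momentum h.cont).const_mul R).integrable
            one_le_two) (Icc_subset_Icc hs ht)
        rw [← ofReal_integral_norm_eq_lintegral_enorm hi]
        simp only [δ, intervalIntegral.integral_of_le hst, ← integral_Icc_eq_integral_Ioc]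
        congr 2
        refine funext fun r => (Real.norm_of_nonneg (h.hasSpeedBound_radius.nonneg r)).symm
      rw [← hδ]
      refine (iInf_le _ ⟨π, h1, h2⟩).trans ?_
      calc (∫⁻ z, edist z.1 z.2 ^ 2 ∂π) ^ (1 / 2 : ℝ)
          ≤ (∫⁻ z, ENNReal.ofReal δ ^ 2 ∂π) ^ (1 / 2 : ℝ) := by
            refine ENNReal.rpow_le_rpow (lintegral_mono_ae ?_) (by norm_num)
            filter_upwards [h3] with z hz
            rw [edist_dist]
            gcongr
        _ = ENNReal.ofReal δ := by
            rw [lintegral_const, measure_univ, mul_one, ← ENNReal.rpow_natCast,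
              ← ENNReal.rpow_mul]
            norm_num
  momentum := h.momentum
  zeroMean := h.zeroMean
  continuity := h.continuity

end

/-! ### Compactness of curves and uniform convergence of integrals. -/

section

variable {d : ℕ} {R : ℝ} {μ : ℝ → ProbabilityMeasure (E d)} {γ : ℝ → E d → E d} {ι : Type*}
  {l : Filter ι} {M : ι → ℝ → ProbabilityMeasure (E d)}

/-- Cauchy–Schwarz in time gives a `1/2`-Hölder modulus depending only on `R` and `B`, the source of
equicontinuity. -/
theorem RegularPair.integral_speed_le (h : RegularPair R μ γ) {B : ℝ}
    (hB : ∫ t in (0 : ℝ)..1, momentumNorm μ γ t ^ 2 ≤ B) {s t : ℝ} (hs : 0 ≤ s) (hst : s ≤ t)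
    (ht : t ≤ 1) : ∫ r in s..t, R * momentumNorm μ γ r ≤ R * (√(t - s) * √B) := by
  have hR := nonneg_of_compl_closedBall (h.supp 0)
  rw [intervalIntegral.integral_const_mul]
  refine mul_le_mul_of_nonneg_left ?_ hR
  have hsub : Ioc s t ⊆ Icc (0 : ℝ) 1 := fun r hr => ⟨hs.trans hr.1.le, hr.2.trans ht⟩
  have h1 := integral_mul_le_sqrt_mul_sqrt (τ := volume.restrict (Ioc s t)) (f := fun _ => 1)
    (fun _ => zero_le_one) momentumNorm_nonneg (memLp_const 1)
    ((memLp_momentumNorm h.momentum h.cont).mono_measure (Measure.restrict_mono hsub le_rfl))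
  simp only [one_mul, one_pow, integral_const, smul_eq_mul, mul_one] at h1
  rw [intervalIntegral.integral_of_le hst]
  refine h1.trans (mul_le_mul (Real.sqrt_le_sqrt ?_) (Real.sqrt_le_sqrt ?_) (Real.sqrt_nonneg _)
    (Real.sqrt_nonneg _))
  · simp [measureReal_def, hst]
  · refine le_trans ?_ hB
    rw [← intervalIntegral.integral_of_le hst]
    exact intervalIntegral.integral_mono_interval hs hst ht
      (ae_of_all _ fun _ => sq_nonneg _)
      (intervalIntegrable_of_restrict_Icc (integrable_momentumNorm_sq h.momentum h.cont))

theorem RegularPair.abs_integral_sub_le (h : RegularPair R μ γ) {B : ℝ}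
    (hB : ∫ t in (0 : ℝ)..1, momentumNorm μ γ t ^ 2 ≤ B) {f : E d → ℝ} (hf : Continuous f)
    {ε δ : ℝ} (hfδ : ∀ x ∈ Metric.closedBall (0 : E d) R, ∀ y ∈ Metric.closedBall (0 : E d) R,
      dist x y ≤ δ → dist (f x) (f y) ≤ ε)
    {s t : ℝ} (hs : 0 ≤ s) (hst : s ≤ t) (ht : t ≤ 1) (hδ : R * (√(t - s) * √B) ≤ δ) :
    |∫ x, f x ∂(μ s : Measure (E d)) - ∫ x, f x ∂(μ t : Measure (E d))| ≤ ε := by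
  obtain ⟨π, h1, h2, h3⟩ := h.hasSpeedBound_radius.exists_coupling hs hst ht
  have hp : IsProbabilityMeasure π := ⟨by
    rw [← preimage_univ (f := Prod.fst), ← Measure.map_apply measurable_fst .univ, h1]
    exact measure_univ⟩
  have i1 := Continuous.integrable_of_compl_closedBall (h.supp s) hf
  have i2 := Continuous.integrable_of_compl_closedBall (h.supp t) hf
  have hs1 := h.supp s
  have hs2 := h.supp t
  rw [← h1] at i1 hs1 ⊢
  rw [← h2] at i2 hs2 ⊢
  rw [Measure.map_apply measurable_fst Metric.isClosed_closedBall.measurableSet.compl] at hs1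
  rw [Measure.map_apply measurable_snd Metric.isClosed_closedBall.measurableSet.compl] at hs2
  have hs1' : ∀ᵐ z ∂π, z.1 ∈ Metric.closedBall (0 : E d) R := hs1
  have hs2' : ∀ᵐ z ∂π, z.2 ∈ Metric.closedBall (0 : E d) R := hs2
  rw [integral_map measurable_fst.aemeasurable hf.aestronglyMeasurable,
    integral_map measurable_snd.aemeasurable hf.aestronglyMeasurable,
    ← integral_sub (μ := π) (f := fun z : E d × E d => f z.1) (g := fun z => f z.2) (i1.comp_measurable measurable_fst)
      (i2.comp_measurable measurable_snd),
    ← Real.norm_eq_abs]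
  refine (norm_integral_le_of_norm_le (integrable_const ε) ?_).trans (by simp)
  filter_upwards [hs1', hs2', h3] with z hz1 hz2 hz3
  rw [← dist_eq_norm]
  exact hfδ _ hz1 _ hz2 (hz3.trans ((h.integral_speed_le hB hs hst ht).trans hδ))

/-- Locally uniform convergence of curves of measures in a fixed ball. -/
structure CurveLimit (R : ℝ) (l : Filter ι) (M : ι → ℝ → ProbabilityMeasure (E d))
    (μ : ℝ → ProbabilityMeasure (E d)) : Prop where
  tendsto : ∀ t, Tendsto (fun p : ι × ℝ => M p.1 p.2) (l ×ˢ 𝓝 t) (𝓝 (μ t))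
  cont' : ∀ i, Continuous (M i)
  supp' : ∀ i t, (M i t : Measure (E d)) (Metric.closedBall 0 R)ᶜ = 0
  cont : Continuous μ
  supp : ∀ t, (μ t : Measure (E d)) (Metric.closedBall 0 R)ᶜ = 0

/-- Prokhorov's theorem in the case where one ball serves every tightness level. -/
theorem isCompact_setOf_compl_closedBall (R : ℝ) :
    IsCompact {α : ProbabilityMeasure (E d) | (α : Measure (E d)) (Metric.closedBall 0 R)ᶜ = 0} := by
  have h := isCompact_setOfPred_probabilityMeasure_mass_eq_compl_isCompact_le (E := E d)
    (u := fun _ => 0) (K := fun _ => Metric.closedBall 0 R) tendsto_const_nhds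
    (fun _ => isCompact_closedBall 0 R) (Or.inr monotone_const)
  convert h using 1
  ext α
  simp [← ProbabilityMeasure.null_iff_toMeasure_null]

/-- Compactness of curves with square-integrable momentum. -/
theorem exists_curveLimit (𝒰 : Ultrafilter ι) {Γ : ι → ℝ → E d → E d} {B : ℝ}
    (h : ∀ i, RegularPair R (M i) (Γ i))
    (hB : ∀ i, ∫ t in (0 : ℝ)..1, momentumNorm (M i) (Γ i) t ^ 2 ≤ B)
    (hM : ∀ i t, M i t = M i (projIcc (0 : ℝ) 1 zero_le_one t)) :
    ∃ μ : ℝ → ProbabilityMeasure (E d), CurveLimit R (𝒰 : Filter ι) M μ := by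
  -- The ultrafilter yields limits at all times at once, with no diagonal extraction; the
  -- equicontinuity in `key` then makes the convergence locally uniform in time.
  have hlim : ∀ t, ∃ α : ProbabilityMeasure (E d), (α : Measure (E d)) (Metric.closedBall 0 R)ᶜ = 0 ∧
      Tendsto (fun i => M i t) 𝒰 (𝓝 α) := fun t =>
    (isCompact_setOf_compl_closedBall R).ultrafilter_le_nhds (𝒰.map fun i => M i t)
      (by
        rw [le_principal_iff, Ultrafilter.coe_map]
        exact mem_map.2 (univ_mem' fun i => (h i).supp t))
  choose μ hμ hμt using hlim
  have key : ∀ (f : E d → ℝ), Continuous f → ∀ ε > 0, ∃ η > 0, ∀ i s t, dist s t < η →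
      |∫ x, f x ∂(M i s : Measure (E d)) - ∫ x, f x ∂(M i t : Measure (E d))| ≤ ε := by
    intro f hf ε hε
    obtain ⟨δ, hδ, hfδ⟩ := Metric.uniformContinuousOn_iff_le.1
      ((isCompact_closedBall (0 : E d) R).uniformContinuousOn_of_continuous hf.continuousOn) ε hε
    have hlim : Tendsto (fun r : ℝ => R * (√r * √B)) (𝓝 0) (𝓝 (R * (√0 * √B))) := by
      refine Continuous.tendsto ?_ 0
      fun_prop
    rw [Real.sqrt_zero, zero_mul, mul_zero] at hlim
    obtain ⟨η, hη, hηδ⟩ := Metric.eventually_nhds_iff.1 (hlim.eventually (Iio_mem_nhds hδ))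
    have main : ∀ i (s t : ℝ), 0 ≤ s → s ≤ t → t ≤ 1 → dist s t < η →
        |∫ x, f x ∂(M i s : Measure (E d)) - ∫ x, f x ∂(M i t : Measure (E d))| ≤ ε := by
      intro i s t hs hst ht hd
      refine (h i).abs_integral_sub_le (hB i) hf hfδ hs hst ht (hηδ ?_).le
      rwa [dist_zero_right, ← dist_eq_norm, dist_comm]
    refine ⟨η, hη, fun i s t hd => ?_⟩
    rw [hM i s, hM i t]
    set a := projIcc (0 : ℝ) 1 zero_le_one s
    set b := projIcc (0 : ℝ) 1 zero_le_one t
    have hab : dist (a : ℝ) b < η := by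
      refine lt_of_le_of_lt ?_ hd
      exact abs_projIcc_sub_projIcc zero_le_one
    rcases le_total (a : ℝ) b with h1 | h1
    · exact main i a b a.2.1 h1 b.2.2 hab
    · rw [abs_sub_comm]
      exact main i b a b.2.1 h1 a.2.2 (by rwa [dist_comm])
  have hμi : ∀ (f : E d → ℝ), Continuous f → ∀ t,
      Tendsto (fun i => ∫ x, f x ∂(M i t : Measure (E d))) 𝒰 (𝓝 (∫ x, f x ∂(μ t : Measure (E d)))) :=
    fun f hf t => tendsto_integral_of_continuous (hμt t) (fun i => (h i).supp t) (hμ t) hf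
  refine ⟨μ, fun t => ?_, fun i => (h i).cont, fun i => (h i).supp, ?_, hμ⟩
  · refine ProbabilityMeasure.tendsto_iff_forall_integral_tendsto.2 fun f => ?_
    rw [Metric.tendsto_nhds]
    intro ε hε
    obtain ⟨η, hη, hk⟩ := key f f.continuous (ε / 2) (by positivity)
    have h1 := (Metric.tendsto_nhds.1 (hμi f f.continuous t)) (ε / 2) (by positivity)
    filter_upwards [h1.prod_mk (Metric.ball_mem_nhds t hη)] with p hp
    have h2 := hk p.1 p.2 t hp.2
    rw [← Real.dist_eq] at h2
    calc _ ≤ _ + _ := dist_triangle _ (∫ x, f x ∂(M p.1 t : Measure (E d))) _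
      _ < ε := by linarith [hp.1]
  · refine continuous_iff_continuousAt.2 fun t =>
      ProbabilityMeasure.tendsto_iff_forall_integral_tendsto.2 fun f => ?_
    rw [Metric.tendsto_nhds]
    intro ε hε
    obtain ⟨η, hη, hk⟩ := key f f.continuous (ε / 2) (by positivity)
    filter_upwards [Metric.ball_mem_nhds t hη] with s hs
    refine lt_of_le_of_lt (b := ε / 2) ?_ (by linarith)
    rw [Real.dist_eq]
    exact le_of_tendsto ((hμi f f.continuous s).sub (hμi f f.continuous t)).abs
      (Eventually.of_forall fun i => hk i s t hs)

theorem tendstoUniformlyOn_of_continuous {X Y F : Type*} [TopologicalSpace X] [TopologicalSpace Y]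
    [UniformSpace F] {f : X → Y → F} (hf : Continuous (Function.uncurry f)) {k : Set Y}
    (hk : IsCompact k) (x : X) : TendstoUniformlyOn f (f x) (𝓝 x) k := by
  intro u hu
  obtain ⟨v, hv, h⟩ := hk.mem_uniformity_of_prod (s := univ) hf.continuousOn (mem_univ x)
    (symm_le_uniformity hu)
  rw [nhdsWithin_univ] at hv
  filter_upwards [hv] with p hp y hy using h p hp y hy

/-- For a continuous limit, convergence along `l ×ˢ 𝓝 x` at every point of a compact set forces
uniform convergence on it. -/
theorem tendstoUniformlyOn_of_forall_tendsto {X F : Type*} [TopologicalSpace X] [UniformSpace F]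
    {f : ι → X → F} {g : X → F} (hg : Continuous g) {k : Set X} (hk : IsCompact k)
    (h : ∀ x ∈ k, Tendsto (fun p : ι × X => f p.1 p.2) (l ×ˢ 𝓝 x) (𝓝 (g x))) :
    TendstoUniformlyOn f g l k := by
  rw [← tendstoLocallyUniformlyOn_iff_tendstoUniformlyOn_of_compact hk,
    tendstoLocallyUniformlyOn_iff_forall_tendsto]
  intro x hx
  have h1 : Tendsto (fun p : ι × X => (g p.2, f p.1 p.2)) (l ×ˢ 𝓝 x) (𝓝 (g x, g x)) :=
    ((hg.tendsto x).comp tendsto_snd).prodMk_nhds (h x hx)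
  exact (h1.mono_right (nhds_le_uniformity _)).mono_left
    (Filter.prod_mono le_rfl nhdsWithin_le_nhds)

section Kernel

variable {F Y : Type*} [NormedAddCommGroup F] [InnerProductSpace ℝ F] [FiniteDimensional ℝ F]
  [TopologicalSpace Y] {κ : ℝ × Y → E d → F}

theorem continuous_integral_curve_kernel (hμ : Continuous μ)
    (hsupp : ∀ t, (μ t : Measure (E d)) (Metric.closedBall 0 R)ᶜ = 0)
    (hκ : Continuous (Function.uncurry κ)) :
    Continuous fun p : ℝ × Y => ∫ x, κ p x ∂(μ p.1 : Measure (E d)) :=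
  continuous_iff_continuousAt.2 fun p => tendsto_integral_of_tendstoUniformlyOn
    (α := fun p : ℝ × Y => μ p.1) ((hμ.comp continuous_fst).tendsto p) (fun p => hsupp p.1)
    (hsupp p.1) (fun q => hκ.comp (by fun_prop : Continuous fun x => (q, x)))
    (hκ.comp (by fun_prop : Continuous fun x => (p, x)))
    (tendstoUniformlyOn_of_continuous hκ (isCompact_closedBall 0 R) p)

/-- The parameter space `Y` is the position variable for interaction fields and a single point for
functions of time alone. -/
theorem CurveLimit.tendstoUniformlyOn (h : CurveLimit R l M μ) (hκ : Continuous (Function.uncurry κ))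
    {k : Set (ℝ × Y)} (hk : IsCompact k) :
    TendstoUniformlyOn (fun i p => ∫ x, κ p x ∂(M i p.1 : Measure (E d)))
      (fun p => ∫ x, κ p x ∂(μ p.1 : Measure (E d))) l k := by
  refine tendstoUniformlyOn_of_forall_tendsto (continuous_integral_curve_kernel h.cont h.supp hκ) hk
    fun p _ => ?_
  refine tendsto_integral_of_tendstoUniformlyOn (α := fun q : ι × (ℝ × Y) => M q.1 q.2.1)
    ?_ (fun q => h.supp' q.1 q.2.1) (h.supp p.1)
    (fun q => hκ.comp (by fun_prop : Continuous fun x => (q.2, x)))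
    (hκ.comp (by fun_prop : Continuous fun x => (p, x))) ?_
  · exact (h.tendsto p.1).comp (tendsto_id.prodMap (continuous_fst.tendsto p))
  · intro u hu
    exact tendsto_snd.eventually
      (tendstoUniformlyOn_of_continuous hκ (isCompact_closedBall 0 R) p u hu)

end Kernel

end

/-! ### Weak limits of momenta on varying space-time measures. -/

section

variable {d : ℕ} {R : ℝ} {μ : ℝ → ProbabilityMeasure (E d)} {γ : ℝ → E d → E d} {ι : Type*}
  {l : Filter ι} {M : ι → ℝ → ProbabilityMeasure (E d)}

theorem ae_mem_spaceTime (hμ : Continuous μ)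
    (hsupp : ∀ t, (μ t : Measure (E d)) (Metric.closedBall 0 R)ᶜ = 0) :
    ∀ᵐ p ∂(spaceTime μ hμ), p ∈ Icc (0 : ℝ) 1 ×ˢ Metric.closedBall (0 : E d) R := by
  rw [spaceTime, Measure.ae_compProd_iff (p := fun p => p ∈ Icc (0 : ℝ) 1 ×ˢ _)
    (measurableSet_Icc.prod Metric.isClosed_closedBall.measurableSet)]
  filter_upwards [ae_restrict_mem measurableSet_Icc] with t ht
  filter_upwards [(hsupp t : ∀ᵐ x ∂(μ t : Measure (E d)), x ∈ Metric.closedBall (0 : E d) R)]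
    with x hx using ⟨ht, hx⟩

theorem isCompact_Icc_prod_closedBall (R : ℝ) :
    IsCompact (Icc (0 : ℝ) 1 ×ˢ Metric.closedBall (0 : E d) R) :=
  isCompact_Icc.prod (isCompact_closedBall 0 R)

theorem Continuous.memLp_spaceTime {F : Type*} [NormedAddCommGroup F] (hμ : Continuous μ)
    (hsupp : ∀ t, (μ t : Measure (E d)) (Metric.closedBall 0 R)ᶜ = 0) {f : ℝ × E d → F}
    (hf : Continuous f) : MemLp f 2 (spaceTime μ hμ) := by
  obtain ⟨C, hC⟩ := (isCompact_Icc_prod_closedBall R).exists_bound_of_continuousOn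
    (f := f) hf.continuousOn
  refine MemLp.of_bound hf.aestronglyMeasurable C ?_
  filter_upwards [ae_mem_spaceTime hμ hsupp] with p hp using hC p hp

theorem Continuous.integrable_spaceTime {F : Type*} [NormedAddCommGroup F] (hμ : Continuous μ)
    (hsupp : ∀ t, (μ t : Measure (E d)) (Metric.closedBall 0 R)ᶜ = 0) {f : ℝ × E d → F}
    (hf : Continuous f) : Integrable f (spaceTime μ hμ) :=
  (Continuous.memLp_spaceTime hμ hsupp hf).integrable one_le_two

theorem CurveLimit.tendsto_integral (h : CurveLimit R l M μ) {f : ℝ × E d → ℝ} (hf : Continuous f) :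
    Tendsto (fun i => ∫ p, f p ∂(spaceTime (M i) (h.cont' i))) l
      (𝓝 (∫ p, f p ∂(spaceTime μ h.cont))) := by
  have hu := h.tendstoUniformlyOn (Y := Unit) (κ := fun p x => f (p.1, x)) (by fun_prop)
    (isCompact_Icc.prod isCompact_univ : IsCompact (Icc (0 : ℝ) 1 ×ˢ (univ : Set Unit)))
  rw [Metric.tendsto_nhds]
  intro ε hε
  filter_upwards [Metric.tendstoUniformlyOn_iff.1 hu (ε / 2) (by positivity)] with i hi
  have i1 := Continuous.integrable_spaceTime (h.cont' i) (h.supp' i) hf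
  have i2 := Continuous.integrable_spaceTime h.cont h.supp hf
  rw [integral_spaceTime _ i1, integral_spaceTime _ i2, dist_eq_norm,
    ← intervalIntegral.integral_sub
      (intervalIntegrable_of_restrict_Icc (integrable_integral_curve _ i1))
      (intervalIntegrable_of_restrict_Icc (integrable_integral_curve _ i2))]
  refine (intervalIntegral.norm_integral_le_of_norm_le_const (C := ε / 2) fun t ht => ?_).trans_lt
    (by rw [sub_zero, abs_one]; linarith)
  rw [uIoc_of_le zero_le_one] at ht
  rw [← dist_eq_norm, dist_comm]
  exact (hi (t, ()) ⟨Ioc_subset_Icc_self ht, mem_univ _⟩).le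

/-- The pairing of the momentum with a vector field on space-time. -/
noncomputable def pairing (μ : ℝ → ProbabilityMeasure (E d)) (hμ : Continuous μ)
    (γ : ℝ → E d → E d) (ξ : ℝ × E d → E d) : ℝ :=
  ∫ p, inner ℝ (γ p.1 p.2) (ξ p) ∂(spaceTime μ hμ)

theorem integral_momentumNorm_sq (h : IsL2Momentum μ γ) (hμ : Continuous μ) :
    ∫ t in (0 : ℝ)..1, momentumNorm μ γ t ^ 2 = ∫ p, ‖γ p.1 p.2‖ ^ 2 ∂(spaceTime μ hμ) := by
  have := integral_spaceTime hμ (f := fun p => ‖γ p.1 p.2‖ ^ 2) (h.integrable_norm_sq hμ)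
  rw [this]
  simp only [momentumNorm_sq]

theorem integrable_pairing (h : IsL2Momentum μ γ) (hμ : Continuous μ) {ξ : ℝ × E d → E d}
    (hξ : MemLp ξ 2 (spaceTime μ hμ)) :
    Integrable (fun p => (inner ℝ (γ p.1 p.2) (ξ p) : ℝ)) (spaceTime μ hμ) :=
  ((h.memLp hμ).norm.integrable_mul hξ.norm).mono'
    ((h.memLp hμ).1.inner hξ.1) (ae_of_all _ fun _ => norm_inner_le_norm _ _)

theorem abs_pairing_le (h : IsL2Momentum μ γ) (hμ : Continuous μ) {ξ : ℝ × E d → E d}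
    (hξ : MemLp ξ 2 (spaceTime μ hμ)) :
    |pairing μ hμ γ ξ| ≤ √(∫ t in (0 : ℝ)..1, momentumNorm μ γ t ^ 2)
      * √(∫ p, ‖ξ p‖ ^ 2 ∂(spaceTime μ hμ)) := by
  rw [integral_momentumNorm_sq h hμ, ← Real.norm_eq_abs]
  refine (norm_integral_le_integral_norm _).trans (le_trans (integral_mono
    (integrable_pairing h hμ hξ).norm ((h.memLp hμ).norm.integrable_mul hξ.norm)
    fun p => norm_inner_le_norm _ _) ?_)
  exact integral_mul_le_sqrt_mul_sqrt (fun _ => norm_nonneg _) (fun _ => norm_nonneg _)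
    (h.memLp hμ).norm hξ.norm

theorem abs_pairing_le_of_forall (h : IsL2Momentum μ γ) (hμ : Continuous μ)
    (hsupp : ∀ t, (μ t : Measure (E d)) (Metric.closedBall 0 R)ᶜ = 0) {ξ : ℝ × E d → E d}
    (hξ : Continuous ξ) {ε : ℝ} (hε : 0 ≤ ε)
    (hξε : ∀ p ∈ Icc (0 : ℝ) 1 ×ˢ Metric.closedBall (0 : E d) R, ‖ξ p‖ ≤ ε) :
    |pairing μ hμ γ ξ| ≤ √(∫ t in (0 : ℝ)..1, momentumNorm μ γ t ^ 2) * ε := by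
  have hm := Continuous.memLp_spaceTime hμ hsupp hξ
  refine (abs_pairing_le h hμ hm).trans (mul_le_mul_of_nonneg_left ?_ (Real.sqrt_nonneg _))
  rw [Real.sqrt_le_left hε]
  calc ∫ p, ‖ξ p‖ ^ 2 ∂(spaceTime μ hμ) ≤ ∫ p, ε ^ 2 ∂(spaceTime μ hμ) := by
        refine integral_mono_ae (hm.integrable_norm_pow two_ne_zero) (integrable_const _) ?_
        filter_upwards [ae_mem_spaceTime hμ hsupp] with p hp
        exact pow_le_pow_left₀ (norm_nonneg _) (hξε p hp) 2
    _ = ε ^ 2 := by simp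

theorem pairing_sub (h : IsL2Momentum μ γ) (hμ : Continuous μ) {ξ η : ℝ × E d → E d}
    (hξ : MemLp ξ 2 (spaceTime μ hμ)) (hη : MemLp η 2 (spaceTime μ hμ)) :
    pairing μ hμ γ (fun p => ξ p - η p) = pairing μ hμ γ ξ - pairing μ hμ γ η := by
  simp only [pairing, inner_sub_right]
  exact integral_sub (integrable_pairing h hμ hξ) (integrable_pairing h hμ hη)

/-- The pairings with continuous fields converge to those with a limit momentum. -/
theorem exists_tendsto_pairing (𝒰 : Ultrafilter ι) (h : CurveLimit R (𝒰 : Filter ι) M μ)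
    {Γ : ι → ℝ → E d → E d} (hΓ : ∀ i, IsL2Momentum (M i) (Γ i)) {a : ℝ}
    (ha : Tendsto (fun i => ∫ t in (0 : ℝ)..1, momentumNorm (M i) (Γ i) t ^ 2) 𝒰 (𝓝 a)) :
    ∃ γ : ℝ → E d → E d, IsL2Momentum μ γ ∧ ∫ t in (0 : ℝ)..1, momentumNorm μ γ t ^ 2 ≤ a ∧
      ∀ ξ : ℝ × E d → E d, Continuous ξ →
        Tendsto (fun i => pairing (M i) (h.cont' i) (Γ i) ξ) 𝒰 (𝓝 (pairing μ h.cont γ ξ)) := by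
  set N : ι → ℝ := fun i => ∫ t in (0 : ℝ)..1, momentumNorm (M i) (Γ i) t ^ 2
  have hN0 : ∀ i, 0 ≤ N i := fun i =>
    intervalIntegral.integral_nonneg zero_le_one fun t _ => sq_nonneg _
  have ha0 : 0 ≤ a := ge_of_tendsto ha (Eventually.of_forall hN0)
  have hmi : ∀ i (ξ : C(ℝ × E d, E d)), MemLp ξ 2 (spaceTime (M i) (h.cont' i)) := fun i ξ =>
    Continuous.memLp_spaceTime _ (h.supp' i) ξ.continuous
  have hm : ∀ ξ : C(ℝ × E d, E d), MemLp ξ 2 (spaceTime μ h.cont) := fun ξ =>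
    Continuous.memLp_spaceTime _ h.supp ξ.continuous
  -- The `L²` spaces vary with `i`, so the momenta are compared through continuous fields, which
  -- belong to all of them.
  set P : ι → C(ℝ × E d, E d) → ℝ := fun i ξ => pairing (M i) (h.cont' i) (Γ i) ξ
  have hbound : ∀ ξ : C(ℝ × E d, E d), Tendsto (fun i => √(N i) * √(∫ p, ‖ξ p‖ ^ 2 ∂(spaceTime (M i) (h.cont' i))))
      𝒰 (𝓝 (√a * √(∫ p, ‖ξ p‖ ^ 2 ∂(spaceTime μ h.cont)))) := fun ξ =>
    ha.sqrt.mul (h.tendsto_integral (f := fun p => ‖ξ p‖ ^ 2) (by fun_prop)).sqrt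
  have hP : ∀ i ξ, |P i ξ| ≤ √(N i) * √(∫ p, ‖ξ p‖ ^ 2 ∂(spaceTime (M i) (h.cont' i))) :=
    fun i ξ => abs_pairing_le (hΓ i) _ (hmi i ξ)
  have hex : ∀ ξ, ∃ c, Tendsto (fun i => P i ξ) 𝒰 (𝓝 c) := by
    intro ξ
    set b := √a * √(∫ p, ‖ξ p‖ ^ 2 ∂(spaceTime μ h.cont))
    have hev : ∀ᶠ i in (𝒰 : Filter ι), P i ξ ∈ Icc (-(b + 1)) (b + 1) := by
      filter_upwards [(hbound ξ).eventually (Iio_mem_nhds (lt_add_one b))] with i hi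
      exact abs_le.1 ((hP i ξ).trans (le_of_lt hi))
    obtain ⟨c, -, hc⟩ := isCompact_Icc.ultrafilter_le_nhds (𝒰.map fun i => P i ξ)
      (s := Icc (-(b + 1)) (b + 1)) (by rw [le_principal_iff, Ultrafilter.coe_map]; exact hev)
    exact ⟨c, hc⟩
  choose ℓ hℓ using hex
  let lin : C(ℝ × E d, E d) →ₗ[ℝ] ℝ :=
    { toFun := ℓ
      map_add' := fun ξ η => by
        refine tendsto_nhds_unique (hℓ _) (((hℓ ξ).add (hℓ η)).congr fun i => ?_)
        simp only [P, pairing, ContinuousMap.add_apply, inner_add_right]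
        exact (integral_add (integrable_pairing (hΓ i) _ (hmi i ξ))
          (integrable_pairing (hΓ i) _ (hmi i η))).symm
      map_smul' := fun c ξ => by
        refine tendsto_nhds_unique (hℓ _) (((hℓ ξ).const_mul c).congr fun i => ?_)
        simp only [P, pairing, ContinuousMap.smul_apply, inner_smul_right]
        exact (integral_const_mul _ _).symm }
  let T : C(ℝ × E d, E d) →ₗ[ℝ] Lp (E d) 2 (spaceTime μ h.cont) :=
    { toFun := fun ξ => (hm ξ).toLp ξ
      map_add' := fun ξ η => (hm ξ).toLp_add (hm η)
      map_smul' := fun c ξ => (hm ξ).toLp_const_smul c }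
  have hT : ∀ ξ, ‖T ξ‖ = √(∫ p, ‖ξ p‖ ^ 2 ∂(spaceTime μ h.cont)) := by
    intro ξ
    rw [← Real.sqrt_sq (norm_nonneg (T ξ)), ← real_inner_self_eq_norm_sq, L2.inner_def]
    congr 1
    refine integral_congr_ae ?_
    filter_upwards [(hm ξ).coeFn_toLp] with p hp
    change inner ℝ ((hm ξ).toLp ξ p) ((hm ξ).toLp ξ p) = _
    rw [hp, real_inner_self_eq_norm_sq]
  -- The Cauchy–Schwarz bounds pass to the limit with constant `√a`. Riesz then gives the momentum
  -- together with lower semicontinuity of its norm.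
  obtain ⟨w, hw, hw'⟩ := exists_inner_eq_of_abs_le T lin (Real.sqrt_nonneg a) fun ξ => by
    rw [hT]
    exact le_of_tendsto_of_tendsto (hℓ ξ).abs (hbound ξ) (Eventually.of_forall fun i => hP i ξ)
  have hγ : IsL2Momentum μ (fun t x => w (t, x)) :=
    (isL2Momentum_iff h.cont).2 ⟨(Lp.stronglyMeasurable w).measurable, Lp.memLp w⟩
  refine ⟨fun t x => w (t, x), hγ, ?_, fun ξ hξ => ?_⟩
  · rw [integral_momentumNorm_sq hγ h.cont]
    have : ∫ p, ‖w (p.1, p.2)‖ ^ 2 ∂(spaceTime μ h.cont) = ‖w‖ ^ 2 := by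
      rw [← real_inner_self_eq_norm_sq, L2.inner_def]
      simp only [Prod.mk.eta, real_inner_self_eq_norm_sq]
    rw [this, ← Real.sq_sqrt ha0]
    exact pow_le_pow_left₀ (norm_nonneg _) hw 2
  · have e : pairing μ h.cont (fun t x => w (t, x)) ξ = ℓ ⟨ξ, hξ⟩ := by
      refine Eq.trans ?_ (hw' ⟨ξ, hξ⟩).symm
      rw [L2.inner_def]
      refine integral_congr_ae ?_
      filter_upwards [(hm ⟨ξ, hξ⟩).coeFn_toLp] with p hp
      change _ = inner ℝ (w p) ((hm ⟨ξ, hξ⟩).toLp _ p)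
      rw [hp]
      rfl
    rw [e]
    exact hℓ ⟨ξ, hξ⟩

/-- Convergence of pairings with uniformly convergent fields. -/
theorem CurveLimit.tendsto_pairing (h : CurveLimit R l M μ) {Γ : ι → ℝ → E d → E d}
    (hΓ : ∀ i, IsL2Momentum (M i) (Γ i)) {B : ℝ}
    (hB : ∀ i, ∫ t in (0 : ℝ)..1, momentumNorm (M i) (Γ i) t ^ 2 ≤ B)
    (hγ : ∀ ξ : ℝ × E d → E d, Continuous ξ →
        Tendsto (fun i => pairing (M i) (h.cont' i) (Γ i) ξ) l (𝓝 (pairing μ h.cont γ ξ)))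
    {Ξ : ι → ℝ × E d → E d} {ξ : ℝ × E d → E d} (hΞ : ∀ i, Continuous (Ξ i)) (hξ : Continuous ξ)
    (hΞξ : TendstoUniformlyOn Ξ ξ l (Icc (0 : ℝ) 1 ×ˢ Metric.closedBall (0 : E d) R)) :
    Tendsto (fun i => pairing (M i) (h.cont' i) (Γ i) (Ξ i)) l (𝓝 (pairing μ h.cont γ ξ)) := by
  have h1 : Tendsto (fun i => pairing (M i) (h.cont' i) (Γ i) (Ξ i)
      - pairing (M i) (h.cont' i) (Γ i) ξ) l (𝓝 0) := by
    rw [Metric.tendsto_nhds]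
    intro ε hε
    have hε' : 0 < ε / (2 * (√B + 1)) := by positivity
    filter_upwards [Metric.tendstoUniformlyOn_iff.1 hΞξ _ hε'] with i hi
    rw [dist_zero_right, ← pairing_sub (hΓ i) _
      (Continuous.memLp_spaceTime _ (h.supp' i) (hΞ i))
      (Continuous.memLp_spaceTime _ (h.supp' i) hξ)]
    refine (abs_pairing_le_of_forall (hΓ i) _ (h.supp' i)
      (ξ := fun p => Ξ i p - ξ p) ((hΞ i).sub hξ) hε'.le
      fun p hp => ?_).trans_lt ?_
    · rw [← dist_eq_norm, dist_comm]
      exact (hi p hp).le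
    · calc _ ≤ (√B + 1) * (ε / (2 * (√B + 1))) := by
            gcongr
            linarith [Real.sqrt_le_sqrt (hB i)]
        _ = ε / 2 := by field_simp
        _ < ε := by linarith
  simpa using h1.add (hγ ξ hξ)

end

/-! ### Stability of zero mass and of the continuity equation. -/

section

variable {d : ℕ} {R : ℝ} {μ : ℝ → ProbabilityMeasure (E d)} {γ : ℝ → E d → E d} {ι : Type*}
  {l : Filter ι} {M : ι → ℝ → ProbabilityMeasure (E d)}

theorem pairing_eq_intervalIntegral (h : IsL2Momentum μ γ) (hμ : Continuous μ) {ξ : ℝ × E d → E d}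
    (hξ : MemLp ξ 2 (spaceTime μ hμ)) :
    pairing μ hμ γ ξ = ∫ t in (0 : ℝ)..1, ∫ x, inner ℝ (γ t x) (ξ (t, x)) ∂(μ t : Measure (E d)) :=
  integral_spaceTime hμ (integrable_pairing h hμ hξ)

theorem IsL2Momentum.ae_integrable (h : IsL2Momentum μ γ) (hμ : Continuous μ) :
    ∀ᵐ t ∂(volume.restrict (Icc (0 : ℝ) 1)), Integrable (γ t) (μ t : Measure (E d)) := by
  filter_upwards [h.ae_memLp hμ] with t ht using ht.integrable one_le_two

/-- Fields depending on time alone see only the total mass of the momentum, so zero mass is a family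
of linear conditions on the pairings. -/
theorem pairing_smul_const (h : IsL2Momentum μ γ) (hμ : Continuous μ) {χ : ℝ → ℝ}
    (hχ : Continuous χ) (hc : HasCompactSupport χ) (e : E d) :
    pairing μ hμ γ (fun p => χ p.1 • e) = inner ℝ e
      (∫ t in Icc (0 : ℝ) 1, χ t • ∫ x, γ t x ∂(μ t : Measure (E d))) := by
  obtain ⟨C, hC⟩ := hχ.bounded_above_of_compact_support hc
  have hi : Integrable (fun p : ℝ × E d => χ p.1 • γ p.1 p.2) (spaceTime μ hμ) :=
    ((h.memLp hμ).integrable one_le_two).bdd_smul C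
      (hχ.comp continuous_fst).aestronglyMeasurable (ae_of_all _ fun p => hC p.1)
  have e1 : ∫ p, χ p.1 • γ p.1 p.2 ∂(spaceTime μ hμ)
      = ∫ t in Icc (0 : ℝ) 1, χ t • ∫ x, γ t x ∂(μ t : Measure (E d)) := by
    rw [integral_spaceTime hμ hi, intervalIntegral.integral_of_le zero_le_one,
      ← integral_Icc_eq_integral_Ioc]
    simp only [integral_smul]
  rw [← e1, ← integral_inner hi]
  refine integral_congr_ae (ae_of_all _ fun p => ?_)
  simp only [inner_smul_right, real_inner_comm]

/-- The zero mean property is stable under convergence of pairings. -/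
theorem CurveLimit.zeroMean [l.NeBot] (h : CurveLimit R l M μ) {Γ : ι → ℝ → E d → E d}
    (hΓ : ∀ i, IsL2Momentum (M i) (Γ i))
    (hΓ0 : ∀ i, ∀ᵐ t ∂(volume.restrict (Icc (0 : ℝ) 1)),
      ∫ x, Γ i t x ∂(M i t : Measure (E d)) = 0)
    (hγm : IsL2Momentum μ γ)
    (hγ : ∀ ξ : ℝ × E d → E d, Continuous ξ →
        Tendsto (fun i => pairing (M i) (h.cont' i) (Γ i) ξ) l (𝓝 (pairing μ h.cont γ ξ))) :
    ∀ᵐ t ∂(volume.restrict (Icc (0 : ℝ) 1)), ∫ x, γ t x ∂(μ t : Measure (E d)) = 0 := by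
  refine ae_eq_zero_of_integral_contDiff_smul_eq_zero
    (integrable_integral_curve h.cont ((hγm.memLp h.cont).integrable one_le_two)).locallyIntegrable
    fun χ hχ hc => ext_inner_left ℝ fun e => ?_
  rw [inner_zero_right]
  refine Eq.trans (pairing_smul_const hγm h.cont hχ.continuous hc e).symm ?_
  refine tendsto_nhds_unique (hγ _ ((hχ.continuous.comp continuous_fst).smul continuous_const)) ?_
  refine tendsto_const_nhds.congr fun i => ?_
  refine Eq.trans ?_ (pairing_smul_const (hΓ i) (h.cont' i) hχ.continuous hc e).symm
  have : ∫ t in Icc (0 : ℝ) 1, χ t • ∫ x, Γ i t x ∂(M i t : Measure (E d)) = 0 := by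
    refine integral_eq_zero_of_ae ?_
    filter_upwards [hΓ0 i] with t ht
    rw [ht, smul_zero, Pi.zero_apply]
  rw [this, inner_zero_right]

section EnergyDistance

variable {α : ProbabilityMeasure (E d)} {f g : E d → E d}

theorem continuous_edKernel : Continuous fun p : E d × E d => edKernel p.1 p.2 := by
  unfold edKernel; fun_prop

theorem integrable_edKernel_smul (hα : (α : Measure (E d)) (Metric.closedBall 0 R)ᶜ = 0)
    (hf : Integrable f (α : Measure (E d))) (x : E d) :
    Integrable (fun y => edKernel x y • f y) (α : Measure (E d)) := by
  refine hf.bdd_smul (‖x‖ + R) (continuous_edKernel.comp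
    (by fun_prop : Continuous fun y : E d => (x, y))).aestronglyMeasurable ?_
  filter_upwards [ae_norm_le_of_compl_closedBall hα] with y hy
  change ‖-‖x - y‖‖ ≤ _
  rw [norm_neg, norm_norm]
  exact (norm_sub_le x y).trans (by gcongr)

theorem integrable_prod_edKernel (hα : (α : Measure (E d)) (Metric.closedBall 0 R)ᶜ = 0)
    (hf : Integrable f (α : Measure (E d))) (hg : Integrable g (α : Measure (E d))) :
    Integrable (fun p : E d × E d => edKernel p.1 p.2 * inner ℝ (f p.1) (g p.2))
      ((α : Measure (E d)).prod (α : Measure (E d))) := by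
  have h1 : Integrable (fun p : E d × E d => (inner ℝ (f p.1) (g p.2) : ℝ))
      ((α : Measure (E d)).prod (α : Measure (E d))) :=
    (hf.norm.mul_prod hg.norm).mono' (hf.1.comp_fst.inner hg.1.comp_snd)
      (ae_of_all _ fun p => norm_inner_le_norm _ _)
  refine h1.bdd_mul (c := R + R) continuous_edKernel.aestronglyMeasurable ?_
  have hae := ae_norm_le_of_compl_closedBall hα
  filter_upwards [Measure.quasiMeasurePreserving_fst.ae hae,
    Measure.quasiMeasurePreserving_snd.ae hae] with p h1 h2
  rw [edKernel, norm_neg, norm_norm]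
  exact (norm_sub_le _ _).trans (add_le_add h1 h2)

theorem inner_edConv_left (hα : (α : Measure (E d)) (Metric.closedBall 0 R)ᶜ = 0)
    (hf : Integrable f (α : Measure (E d))) (x z : E d) :
    inner ℝ z (edConv α f x) = ∫ y, edKernel x y * inner ℝ z (f y) ∂(α : Measure (E d)) := by
  rw [edConv, ← integral_inner (integrable_edKernel_smul hα hf x)]
  simp only [inner_smul_right]

theorem integrable_inner_edConv (hα : (α : Measure (E d)) (Metric.closedBall 0 R)ᶜ = 0)
    (hf : Integrable f (α : Measure (E d))) (hg : Integrable g (α : Measure (E d))) :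
    Integrable (fun x => (inner ℝ (f x) (edConv α g x) : ℝ)) (α : Measure (E d)) := by
  simp only [inner_edConv_left hα hg]
  exact (integrable_prod_edKernel hα hf hg).integral_prod_left

/-- Symmetry of the interaction. -/
theorem integral_inner_edConv_comm (hα : (α : Measure (E d)) (Metric.closedBall 0 R)ᶜ = 0)
    (hf : Integrable f (α : Measure (E d))) (hg : Integrable g (α : Measure (E d))) :
    ∫ x, inner ℝ (f x) (edConv α g x) ∂(α : Measure (E d))
      = ∫ x, inner ℝ (g x) (edConv α f x) ∂(α : Measure (E d)) := by
  simp only [inner_edConv_left hα hg, inner_edConv_left hα hf]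
  rw [integral_integral_swap (f := fun x y => edKernel x y * inner ℝ (f x) (g y))
    (integrable_prod_edKernel hα hf hg)]
  refine integral_congr_ae (ae_of_all _ fun x => integral_congr_ae (ae_of_all _ fun y => ?_))
  simp only [edKernel, norm_sub_rev, real_inner_comm]

end EnergyDistance

section ContinuityEquation

variable {φ : ℝ × E d → ℝ}

theorem deriv_time_eq (hφ : ContDiff ℝ ∞ φ) (t : ℝ) (x : E d) :
    deriv (fun s => φ (s, x)) t = fderiv ℝ φ (t, x) (1, 0) := by
  have h1 : HasDerivAt (fun s : ℝ => (s, x)) (1, 0) t :=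
    (hasDerivAt_id t).prodMk (hasDerivAt_const t x)
  exact ((hφ.differentiable (by simp) (t, x)).hasFDerivAt.comp_hasDerivAt t h1).deriv

theorem continuous_deriv_time (hφ : ContDiff ℝ ∞ φ) :
    Continuous fun p : ℝ × E d => deriv (fun s => φ (s, p.2)) p.1 := by
  simp only [deriv_time_eq hφ]
  exact (hφ.continuous_fderiv (by simp)).clm_apply continuous_const

theorem continuous_gradient_space (hφ : ContDiff ℝ ∞ φ) :
    Continuous fun p : ℝ × E d => gradient (fun y => φ (p.1, y)) p.2 := by
  have h : ∀ p : ℝ × E d, fderiv ℝ (fun y => φ (p.1, y)) p.2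
      = (fderiv ℝ φ p).comp (ContinuousLinearMap.inr ℝ ℝ (E d)) := fun p =>
    ((hφ.differentiable (by simp) p).hasFDerivAt.comp p.2
      (hasFDerivAt_prodMk_right p.1 p.2)).fderiv
  simp only [gradient, h]
  exact (InnerProductSpace.toDual ℝ (E d)).symm.continuous.comp
    ((hφ.continuous_fderiv (by simp)).clm_comp continuous_const)

/-- The interaction field of a continuous momentum field. -/
noncomputable def edField (μ : ℝ → ProbabilityMeasure (E d)) (g : ℝ × E d → E d) (p : ℝ × E d) :
    E d := edConv (μ p.1) (fun x => g (p.1, x)) p.2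

theorem continuous_edField (hμ : Continuous μ)
    (hsupp : ∀ t, (μ t : Measure (E d)) (Metric.closedBall 0 R)ᶜ = 0) {g : ℝ × E d → E d}
    (hg : Continuous g) : Continuous (edField μ g) :=
  continuous_integral_curve_kernel (Y := E d) (κ := fun p x => edKernel p.2 x • g (p.1, x)) hμ hsupp
    (by unfold edKernel; fun_prop)

theorem CurveLimit.tendstoUniformlyOn_edField (h : CurveLimit R l M μ) {g : ℝ × E d → E d}
    (hg : Continuous g) : TendstoUniformlyOn (fun i => edField (M i) g) (edField μ g) l
      (Icc (0 : ℝ) 1 ×ˢ Metric.closedBall (0 : E d) R) :=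
  h.tendstoUniformlyOn (Y := E d) (κ := fun p x => edKernel p.2 x • g (p.1, x))
    (by unfold edKernel; fun_prop) (isCompact_Icc_prod_closedBall R)

/-- The weak form of the continuity equation as a pairing with the momentum. -/
theorem integral_continuityEquation (hμ : Continuous μ)
    (hsupp : ∀ t, (μ t : Measure (E d)) (Metric.closedBall 0 R)ᶜ = 0) (hγ : IsL2Momentum μ γ)
    (hφ : ContDiff ℝ ∞ φ) :
    ∫ t in (0 : ℝ)..1, ∫ x, (deriv (fun s => φ (s, x)) t
      + inner ℝ (edConv (μ t) (γ t) x) (gradient (fun y => φ (t, y)) x)) ∂(μ t : Measure (E d))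
    = ∫ p, deriv (fun s => φ (s, p.2)) p.1 ∂(spaceTime μ hμ)
      + pairing μ hμ γ (edField μ fun p => gradient (fun y => φ (p.1, y)) p.2) := by
  have hD := continuous_deriv_time hφ
  have hG := continuous_gradient_space hφ
  have hD' := Continuous.integrable_spaceTime hμ hsupp hD
  have hG' := Continuous.memLp_spaceTime hμ hsupp (continuous_edField hμ hsupp hG)
  rw [integral_spaceTime hμ hD', pairing_eq_intervalIntegral hγ hμ hG',
    ← intervalIntegral.integral_add
      (intervalIntegrable_of_restrict_Icc (integrable_integral_curve hμ hD'))
      (intervalIntegrable_of_restrict_Icc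
        (integrable_integral_curve hμ (integrable_pairing hγ hμ hG')))]
  refine intervalIntegral.integral_congr_ae ((ae_restrict_iff' measurableSet_uIoc).1 ?_)
  rw [uIoc_of_le zero_le_one]
  filter_upwards [ae_restrict_of_ae_restrict_of_subset Ioc_subset_Icc_self (hγ.ae_integrable hμ)]
    with t ht
  have hg : Continuous fun x : E d => gradient (fun y => φ (t, y)) x :=
    hG.comp (by fun_prop : Continuous fun x : E d => (t, x))
  have hgi := Continuous.integrable_of_compl_closedBall (hsupp t) hg
  have hDi : Integrable (fun x => deriv (fun s => φ (s, x)) t) (μ t : Measure (E d)) :=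
    Continuous.integrable_of_compl_closedBall (hsupp t)
      (hD.comp (by fun_prop : Continuous fun x : E d => (t, x)))
  simp only [real_inner_comm (gradient (fun y => φ (t, y)) _)]
  -- Symmetry of the kernel moves the convolution from `γ` onto `∇φ`: the merely square-integrable
  -- factor is now paired with a continuous field.
  rw [integral_add hDi (integrable_inner_edConv (hsupp t) hgi ht), integral_inner_edConv_comm (hsupp t) hgi ht]
  rfl

/-- The continuity equation is stable under convergence of pairings. -/
theorem CurveLimit.continuityEquation [l.NeBot] (h : CurveLimit R l M μ) {Γ : ι → ℝ → E d → E d}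
    (hΓ : ∀ i, IsL2Momentum (M i) (Γ i)) {B : ℝ}
    (hB : ∀ i, ∫ t in (0 : ℝ)..1, momentumNorm (M i) (Γ i) t ^ 2 ≤ B)
    (hce : ∀ i, ContinuityEquation (M i) fun t => edConv (M i t) (Γ i t))
    (hγm : IsL2Momentum μ γ)
    (hγ : ∀ ξ : ℝ × E d → E d, Continuous ξ →
        Tendsto (fun i => pairing (M i) (h.cont' i) (Γ i) ξ) l (𝓝 (pairing μ h.cont γ ξ))) :
    ContinuityEquation μ fun t => edConv (μ t) (γ t) := by
  intro φ hφ hφc hφs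
  have hG := continuous_gradient_space hφ
  rw [integral_continuityEquation h.cont h.supp hγm hφ]
  refine tendsto_nhds_unique ((h.tendsto_integral (continuous_deriv_time hφ)).add
    (h.tendsto_pairing hΓ hB hγ (fun i => continuous_edField (h.cont' i) (h.supp' i) hG)
      (continuous_edField h.cont h.supp hG) (h.tendstoUniformlyOn_edField hG))) ?_
  refine tendsto_const_nhds.congr fun i => ?_
  rw [← integral_continuityEquation (h.cont' i) (h.supp' i) (hΓ i) hφ]
  exact (hce i φ hφ hφc hφs).symm

end ContinuityEquation

end

/-! ### Lower semicontinuity of the interaction energy. -/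

section

variable {d : ℕ} {R : ℝ} {μ : ℝ → ProbabilityMeasure (E d)} {γ : ℝ → E d → E d} {ι : Type*}
  {l : Filter ι} {M : ι → ℝ → ProbabilityMeasure (E d)}

section EnergyDistance

variable {α : ProbabilityMeasure (E d)} {f g : E d → E d}

theorem integral_norm_le_sqrt {X F : Type*} [MeasurableSpace X] {τ : Measure X}
    [IsProbabilityMeasure τ] [NormedAddCommGroup F] [NormedSpace ℝ F] {f : X → F}
    (hf : MemLp f 2 τ) : ∫ x, ‖f x‖ ∂τ ≤ √(∫ x, ‖f x‖ ^ 2 ∂τ) := by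
  simpa using integral_mul_le_sqrt_mul_sqrt (fun x => norm_nonneg (f x)) (fun _ => zero_le_one)
    hf.norm (memLp_const (1 : ℝ))

/-- The velocity is uniformly bounded by `R` times the `L²` norm of `g`, and the `L¹` norm is at
most the `L²` norm. This controls the error of replacing a momentum by a continuous one. -/
theorem abs_edEnergy_le (hα : (α : Measure (E d)) (Metric.closedBall 0 R)ᶜ = 0)
    (hg : MemLp g 2 (α : Measure (E d))) (hg0 : ∫ x, g x ∂(α : Measure (E d)) = 0) :
    |edEnergy α g| ≤ R * ∫ x, ‖g x‖ ^ 2 ∂(α : Measure (E d)) := by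
  set N := ∫ x, ‖g x‖ ^ 2 ∂(α : Measure (E d))
  have hN : 0 ≤ N := integral_nonneg fun _ => by positivity
  have hR := nonneg_of_compl_closedBall hα
  have hb : ∀ x, ‖edConv α g x‖ ≤ R * √N := fun x =>
    (norm_edConv_le_mul hα hg hg0 x).trans
      (mul_le_mul_of_nonneg_right (sqrt_integral_norm_sq_le hR hα) (Real.sqrt_nonneg _))
  rw [← Real.norm_eq_abs]
  calc ‖edEnergy α g‖ ≤ ∫ x, ‖g x‖ * (R * √N) ∂(α : Measure (E d)) :=
        norm_integral_le_of_norm_le ((hg.integrable one_le_two).norm.mul_const _)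
          (ae_of_all _ fun x => (norm_inner_le_norm _ _).trans
            (mul_le_mul_of_nonneg_left (hb x) (norm_nonneg _)))
    _ = (∫ x, ‖g x‖ ∂(α : Measure (E d))) * (R * √N) := integral_mul_const _ _
    _ ≤ √N * (R * √N) := mul_le_mul_of_nonneg_right (integral_norm_le_sqrt hg) (by positivity)
    _ = R * N := by
        rw [mul_left_comm, Real.mul_self_sqrt hN]

theorem edEnergy_sub (hα : (α : Measure (E d)) (Metric.closedBall 0 R)ᶜ = 0)
    (hf : Integrable f (α : Measure (E d))) (hg : Integrable g (α : Measure (E d))) :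
    edEnergy α (fun x => f x - g x) = edEnergy α f
      - 2 * ∫ x, inner ℝ (f x) (edConv α g x) ∂(α : Measure (E d)) + edEnergy α g := by
  have e : ∀ x, edConv α (fun x => f x - g x) x = edConv α f x - edConv α g x := fun x => by
    simp only [edConv, smul_sub]
    exact integral_sub (integrable_edKernel_smul hα hf x) (integrable_edKernel_smul hα hg x)
  have iff := integrable_inner_edConv hα hf hf
  have ifg := integrable_inner_edConv hα hf hg
  have igf := integrable_inner_edConv hα hg hf
  have igg := integrable_inner_edConv hα hg hg
  have e2 : ∀ x, (inner ℝ (f x - g x) (edConv α (fun x => f x - g x) x) : ℝ)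
      = (inner ℝ (f x) (edConv α f x) - inner ℝ (f x) (edConv α g x))
        - (inner ℝ (g x) (edConv α f x) - inner ℝ (g x) (edConv α g x)) := fun x => by
    rw [e, inner_sub_left, inner_sub_right, inner_sub_right]
  have h1 : edEnergy α (fun x => f x - g x)
      = (edEnergy α f - ∫ x, inner ℝ (f x) (edConv α g x) ∂(α : Measure (E d)))
        - ((∫ x, inner ℝ (g x) (edConv α f x) ∂(α : Measure (E d))) - edEnergy α g) := by
    have i1 : Integrable (fun x => (inner ℝ (f x) (edConv α f x) : ℝ) - inner ℝ (f x) (edConv α g x))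
      (α : Measure (E d)) := iff.sub ifg
    have i2 : Integrable (fun x => (inner ℝ (g x) (edConv α f x) : ℝ) - inner ℝ (g x) (edConv α g x))
      (α : Measure (E d)) := igf.sub igg
    unfold edEnergy
    simp only [e2]
    rw [integral_sub i1 i2, integral_sub iff ifg, integral_sub igf igg]
  rw [h1, integral_inner_edConv_comm hα hg hf]
  ring

end EnergyDistance

theorem measurable_edEnergy (h : IsL2Momentum μ γ) (hμ : Continuous μ) :
    Measurable fun t => edEnergy (μ t) (γ t) := by
  have h1 : Measurable fun p : ℝ × E d => (inner ℝ (γ p.1 p.2) (edConv (μ p.1) (γ p.1) p.2) : ℝ) :=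
    h.1.inner (measurable_edConv_curve hμ h.1)
  exact (stronglyMeasurable_integral_curve hμ h1.stronglyMeasurable).measurable

theorem integrable_edEnergy (h : IsL2Momentum μ γ) (hμ : Continuous μ)
    (hsupp : ∀ t, (μ t : Measure (E d)) (Metric.closedBall 0 R)ᶜ = 0)
    (h0 : ∀ᵐ t ∂(volume.restrict (Icc (0 : ℝ) 1)), ∫ x, γ t x ∂(μ t : Measure (E d)) = 0) :
    Integrable (fun t => edEnergy (μ t) (γ t)) (volume.restrict (Icc (0 : ℝ) 1)) := by
  refine ((integrable_momentumNorm_sq h hμ).const_mul R).mono'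
    (measurable_edEnergy h hμ).aestronglyMeasurable ?_
  filter_upwards [h.ae_memLp hμ, h0] with t ht ht0
  rw [momentumNorm_sq]
  exact abs_edEnergy_le (hsupp t) ht ht0

theorem isL2Momentum_of_continuous (hμ : Continuous μ)
    (hsupp : ∀ t, (μ t : Measure (E d)) (Metric.closedBall 0 R)ᶜ = 0) {g : ℝ × E d → E d}
    (hg : Continuous g) : IsL2Momentum μ fun t x => g (t, x) :=
  (isL2Momentum_iff hμ).2 ⟨hg.measurable, Continuous.memLp_spaceTime hμ hsupp hg⟩

theorem integrable_slice
    (hsupp : ∀ t, (μ t : Measure (E d)) (Metric.closedBall 0 R)ᶜ = 0) {g : ℝ × E d → E d}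
    (hg : Continuous g) (t : ℝ) : Integrable (fun x => g (t, x)) (μ t : Measure (E d)) :=
  Continuous.integrable_of_compl_closedBall (hsupp t)
    (hg.comp (by fun_prop : Continuous fun x : E d => (t, x)))

/-- Positive definiteness is applied across two different curves. The zero mass of `g` refers to
`ρ`, so one `g` centred for the limit curve serves along the whole sequence. -/
theorem two_mul_pairing_edField_le (hμ : Continuous μ)
    (hsupp : ∀ t, (μ t : Measure (E d)) (Metric.closedBall 0 R)ᶜ = 0) (hγ : IsL2Momentum μ γ)
    (h0 : ∀ᵐ t ∂(volume.restrict (Icc (0 : ℝ) 1)), ∫ x, γ t x ∂(μ t : Measure (E d)) = 0)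
    {ρ : ℝ → ProbabilityMeasure (E d)} (hρ : Continuous ρ)
    (hρsupp : ∀ t, (ρ t : Measure (E d)) (Metric.closedBall 0 R)ᶜ = 0) {g : ℝ × E d → E d}
    (hg : Continuous g) (hg0 : ∀ t, ∫ x, g (t, x) ∂(ρ t : Measure (E d)) = 0) :
    2 * pairing μ hμ γ (edField ρ g) ≤ (∫ t in (0 : ℝ)..1, edEnergy (μ t) (γ t))
      + ∫ t in (0 : ℝ)..1, edEnergy (ρ t) (fun x => g (t, x)) := by
  have hξ := Continuous.memLp_spaceTime hμ hsupp (continuous_edField hρ hρsupp hg)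
  have i1 := integrable_integral_curve hμ (integrable_pairing hγ hμ hξ)
  have i2 := integrable_edEnergy hγ hμ hsupp h0
  have hg2 := isL2Momentum_of_continuous hρ hρsupp hg
  have i3 := integrable_edEnergy hg2 hρ hρsupp (ae_of_all _ hg0)
  rw [pairing_eq_intervalIntegral hγ hμ hξ, ← intervalIntegral.integral_const_mul,
    ← intervalIntegral.integral_add (intervalIntegrable_of_restrict_Icc i2)
      (intervalIntegrable_of_restrict_Icc i3)]
  refine intervalIntegral.integral_mono_ae_restrict zero_le_one
    ((intervalIntegrable_of_restrict_Icc i1).const_mul 2)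
    ((intervalIntegrable_of_restrict_Icc i2).add (intervalIntegrable_of_restrict_Icc i3)) ?_
  filter_upwards [hγ.ae_integrable hμ, h0] with t ht ht0
  have := two_mul_integral_inner_edConv_le (g := fun x => g (t, x)) (hsupp t) (hρsupp t) ht
    (integrable_slice hρsupp hg t) ht0 (hg0 t)
  exact this

/-- Expanding the interaction of `γ - g` shows that the previous inequality, with both momenta on
the same curve, is an equality up to an error controlled in `L²`. -/
theorem integral_edEnergy_le (hμ : Continuous μ)
    (hsupp : ∀ t, (μ t : Measure (E d)) (Metric.closedBall 0 R)ᶜ = 0) (hγ : IsL2Momentum μ γ)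
    (h0 : ∀ᵐ t ∂(volume.restrict (Icc (0 : ℝ) 1)), ∫ x, γ t x ∂(μ t : Measure (E d)) = 0)
    {g : ℝ × E d → E d} (hg : Continuous g)
    (hg0 : ∀ t, ∫ x, g (t, x) ∂(μ t : Measure (E d)) = 0) :
    ∫ t in (0 : ℝ)..1, edEnergy (μ t) (γ t) ≤ 2 * pairing μ hμ γ (edField μ g)
      - (∫ t in (0 : ℝ)..1, edEnergy (μ t) (fun x => g (t, x)))
      + R * ∫ p, ‖γ p.1 p.2 - g p‖ ^ 2 ∂(spaceTime μ hμ) := by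
  have hξ := Continuous.memLp_spaceTime hμ hsupp (continuous_edField hμ hsupp hg)
  have i1 := intervalIntegrable_of_restrict_Icc
    (integrable_integral_curve hμ (integrable_pairing hγ hμ hξ))
  have i2 := intervalIntegrable_of_restrict_Icc (integrable_edEnergy hγ hμ hsupp h0)
  have hg2 := isL2Momentum_of_continuous hμ hsupp hg
  have i3 := intervalIntegrable_of_restrict_Icc (integrable_edEnergy hg2 hμ hsupp
    (ae_of_all _ hg0))
  have hd : MemLp (fun p : ℝ × E d => γ p.1 p.2 - g p) 2 (spaceTime μ hμ) :=
    (hγ.memLp hμ).sub (hg2.memLp hμ)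
  have hd2 := hd.integrable_norm_pow two_ne_zero
  have i4 := intervalIntegrable_of_restrict_Icc (integrable_integral_curve hμ hd2)
  rw [pairing_eq_intervalIntegral hγ hμ hξ, integral_spaceTime hμ hd2,
    ← intervalIntegral.integral_const_mul, ← intervalIntegral.integral_const_mul,
    ← intervalIntegral.integral_sub (i1.const_mul 2) i3,
    ← intervalIntegral.integral_add ((i1.const_mul 2).sub i3) (i4.const_mul R)]
  refine intervalIntegral.integral_mono_ae_restrict zero_le_one i2
    (((i1.const_mul 2).sub i3).add (i4.const_mul R)) ?_
  filter_upwards [hγ.ae_memLp hμ, hg2.ae_memLp hμ, h0] with t ht hgt ht0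
  have hi := ht.integrable one_le_two
  have hgi := hgt.integrable one_le_two
  have e1 := edEnergy_sub (hsupp t) hi hgi
  have e2 := abs_edEnergy_le (g := fun x => γ t x - g (t, x)) (hsupp t) (ht.sub hgt)
    (by rw [integral_sub hi hgi, ht0, hg0, sub_zero])
  have e3 := (abs_le.1 e2).2
  rw [e1] at e3
  change edEnergy (μ t) (γ t) ≤ 2 * (∫ x, inner ℝ (γ t x) (edConv (μ t) (fun x => g (t, x)) x)
    ∂(μ t : Measure (E d))) - edEnergy (μ t) (fun x => g (t, x))
    + R * ∫ x, ‖γ t x - g (t, x)‖ ^ 2 ∂(μ t : Measure (E d))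
  linarith

/-- Momenta of zero mean are approximated by continuous momenta of zero mean. -/
theorem exists_continuous_zeroMean (hμ : Continuous μ)
    (hsupp : ∀ t, (μ t : Measure (E d)) (Metric.closedBall 0 R)ᶜ = 0) (hγ : IsL2Momentum μ γ)
    (h0 : ∀ᵐ t ∂(volume.restrict (Icc (0 : ℝ) 1)), ∫ x, γ t x ∂(μ t : Measure (E d)) = 0)
    {ε : ℝ} (hε : 0 < ε) : ∃ g : ℝ × E d → E d, Continuous g ∧
      (∀ t, ∫ x, g (t, x) ∂(μ t : Measure (E d)) = 0) ∧
      ∫ p, ‖γ p.1 p.2 - g p‖ ^ 2 ∂(spaceTime μ hμ) ≤ ε := by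
  -- Subtracting the mean `c t` restores zero mass. As `γ_t` has mean zero, `‖c t‖²` is at most the
  -- squared error at time `t`, so recentring costs a factor `4`; hence the tolerance `ε / 4`.
  obtain ⟨g, hgε, hgm⟩ := (hγ.memLp hμ).exists_boundedContinuous_eLpNorm_sub_le
    ENNReal.ofNat_ne_top (ε := ENNReal.ofReal (√(ε / 4))) (by simpa using hε)
  have hgc : Continuous g := g.continuous
  have hgi := integrable_slice hsupp hgc
  set c : ℝ → E d := fun t => ∫ x, g (t, x) ∂(μ t : Measure (E d))
  have hc : Continuous c := (continuous_integral_curve_kernel (Y := Unit)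
    (κ := fun p x => g (p.1, x)) hμ hsupp (by fun_prop)).comp
      (by fun_prop : Continuous fun t : ℝ => (t, ()))
  refine ⟨fun p => g p - c p.1, by fun_prop, fun t => ?_, ?_⟩
  · change ∫ x, (g (t, x) - c t) ∂(μ t : Measure (E d)) = 0
    rw [integral_sub (hgi t) (integrable_const _)]
    simp [c]
  have hd : MemLp (fun p : ℝ × E d => γ p.1 p.2 - g p) 2 (spaceTime μ hμ) :=
    (hγ.memLp hμ).sub hgm
  have hd2 := hd.integrable_norm_pow two_ne_zero
  have hgcL := (isL2Momentum_of_continuous hμ hsupp (g := fun p => g p - c p.1) (by fun_prop))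
  have hdc : MemLp (fun p : ℝ × E d => γ p.1 p.2 - (g p - c p.1)) 2 (spaceTime μ hμ) :=
    (hγ.memLp hμ).sub (hgcL.memLp hμ)
  have hdc2 := hdc.integrable_norm_pow two_ne_zero
  have h1 : ∫ p, ‖γ p.1 p.2 - g p‖ ^ 2 ∂(spaceTime μ hμ) ≤ ε / 4 := by
    have e := hd.eLpNorm_eq_integral_rpow_norm two_ne_zero ENNReal.ofNat_ne_top
    change eLpNorm (fun p : ℝ × E d => γ p.1 p.2 - g p) 2 _ ≤ _ at hgε
    rw [e, ENNReal.ofReal_le_ofReal_iff (Real.sqrt_nonneg _)] at hgε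
    simp only [ENNReal.toReal_ofNat, Real.rpow_ofNat] at hgε
    rw [← one_div, ← Real.sqrt_eq_rpow] at hgε
    exact (Real.sqrt_le_sqrt_iff (by positivity)).1 hgε
  have h2 : ∫ p, ‖γ p.1 p.2 - (g p - c p.1)‖ ^ 2 ∂(spaceTime μ hμ)
      ≤ 4 * ∫ p, ‖γ p.1 p.2 - g p‖ ^ 2 ∂(spaceTime μ hμ) := by
    have i1 := intervalIntegrable_of_restrict_Icc (integrable_integral_curve hμ hdc2)
    have i2 := intervalIntegrable_of_restrict_Icc (integrable_integral_curve hμ hd2)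
    rw [integral_spaceTime hμ hdc2, integral_spaceTime hμ hd2, ← intervalIntegral.integral_const_mul]
    refine intervalIntegral.integral_mono_ae_restrict zero_le_one i1 (i2.const_mul 4) ?_
    filter_upwards [hγ.ae_memLp hμ, h0] with t ht ht0
    have hgt : MemLp (fun x => g (t, x)) 2 (μ t : Measure (E d)) :=
      MemLp.of_bound (hgi t).1 ‖g‖ (ae_of_all _ fun x => g.norm_coe_le_norm _)
    have hs : MemLp (fun x => γ t x - g (t, x)) 2 (μ t : Measure (E d)) := ht.sub hgt
    have hs2 := hs.integrable_norm_pow two_ne_zero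
    have hcn : ‖c t‖ ^ 2 ≤ ∫ x, ‖γ t x - g (t, x)‖ ^ 2 ∂(μ t : Measure (E d)) := by
      have e : c t = -∫ x, (γ t x - g (t, x)) ∂(μ t : Measure (E d)) := by
        rw [integral_sub (ht.integrable one_le_two) (hgi t), ht0, zero_sub, neg_neg]
      rw [e, norm_neg]
      have := (norm_integral_le_integral_norm _).trans (integral_norm_le_sqrt hs)
      rw [← Real.sq_sqrt (integral_nonneg fun x => by positivity :
        0 ≤ ∫ x, ‖γ t x - g (t, x)‖ ^ 2 ∂(μ t : Measure (E d)))]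
      exact pow_le_pow_left₀ (norm_nonneg _) this 2
    calc ∫ x, ‖γ t x - (g (t, x) - c t)‖ ^ 2 ∂(μ t : Measure (E d))
        ≤ ∫ x, (2 * ‖γ t x - g (t, x)‖ ^ 2 + 2 * ‖c t‖ ^ 2) ∂(μ t : Measure (E d)) := by
          refine integral_mono_of_nonneg (ae_of_all _ fun _ => by positivity)
            ((hs2.const_mul 2).add (integrable_const _)) (ae_of_all _ fun x => ?_)
          have h3 : ‖γ t x - (g (t, x) - c t)‖ ≤ ‖γ t x - g (t, x)‖ + ‖c t‖ := by
            rw [← sub_add]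
            exact norm_add_le _ _
          have := pow_le_pow_left₀ (norm_nonneg _) h3 2
          change ‖γ t x - (g (t, x) - c t)‖ ^ 2 ≤ _
          nlinarith [sq_nonneg (‖γ t x - g (t, x)‖ - ‖c t‖)]
      _ = 2 * (∫ x, ‖γ t x - g (t, x)‖ ^ 2 ∂(μ t : Measure (E d))) + 2 * ‖c t‖ ^ 2 := by
          rw [integral_add (hs2.const_mul 2) (integrable_const _), integral_const_mul]
          simp
      _ ≤ 4 * ∫ x, ‖γ t x - g (t, x)‖ ^ 2 ∂(μ t : Measure (E d)) := by linarith
  linarith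

/-- Lower semicontinuity of the interaction energy. -/
theorem CurveLimit.integral_edEnergy_le [l.NeBot] (h : CurveLimit R l M μ)
    {Γ : ι → ℝ → E d → E d} (hΓ : ∀ i, IsL2Momentum (M i) (Γ i))
    (hΓ0 : ∀ i, ∀ᵐ t ∂(volume.restrict (Icc (0 : ℝ) 1)),
      ∫ x, Γ i t x ∂(M i t : Measure (E d)) = 0)
    (hγm : IsL2Momentum μ γ)
    (hγ : ∀ ξ : ℝ × E d → E d, Continuous ξ →
        Tendsto (fun i => pairing (M i) (h.cont' i) (Γ i) ξ) l (𝓝 (pairing μ h.cont γ ξ)))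
    {q : ℝ} (hq : Tendsto (fun i => ∫ t in (0 : ℝ)..1, edEnergy (M i t) (Γ i t)) l (𝓝 q)) :
    ∫ t in (0 : ℝ)..1, edEnergy (μ t) (γ t) ≤ q := by
  have h0 := h.zeroMean hΓ hΓ0 hγm hγ
  have hR := nonneg_of_compl_closedBall (h.supp 0)
  refine le_of_forall_pos_le_add fun ε hε => ?_
  obtain ⟨g, hg, hg0, hgε⟩ := exists_continuous_zeroMean h.cont h.supp hγm h0
    (ε := ε / (R + 1)) (by positivity)
  have h1 := MomentumMatching.integral_edEnergy_le h.cont h.supp hγm h0 hg hg0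
  -- The left side is linear in the momentum, so it converges. Combined with `h1`, the energy of `g`
  -- cancels.
  have h2 := le_of_tendsto_of_tendsto ((hγ _ (continuous_edField h.cont h.supp hg)).const_mul 2)
    (hq.add_const (∫ t in (0 : ℝ)..1, edEnergy (μ t) (fun x => g (t, x))))
    (Eventually.of_forall fun i => two_mul_pairing_edField_le (h.cont' i) (h.supp' i) (hΓ i) (hΓ0 i)
      h.cont h.supp hg hg0)
  have h3 : R * ∫ p, ‖γ p.1 p.2 - g p‖ ^ 2 ∂(spaceTime μ h.cont) ≤ ε := by
    calc _ ≤ (R + 1) * (ε / (R + 1)) := by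
          refine mul_le_mul (by linarith) hgε (integral_nonneg fun _ => by positivity)
            (by positivity)
      _ = ε := by field_simp
  linarith

end

/-! ### The direct method. -/

section

variable {d : ℕ} {R : ℝ} {μ : ℝ → ProbabilityMeasure (E d)} {γ : ℝ → E d → E d} {ι : Type*}
  {l : Filter ι} {M : ι → ℝ → ProbabilityMeasure (E d)}

/-- The part of the energy that does not depend on the loss. -/
noncomputable def actionEnergy (μ : ℝ → ProbabilityMeasure (E d)) (γ : ℝ → E d → E d) : ℝ :=
  (∫ t in (0 : ℝ)..1, edEnergy (μ t) (γ t)) + ∫ t in (0 : ℝ)..1, momentumNorm μ γ t ^ 2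

theorem integral_momentumNorm_sq_nonneg (μ : ℝ → ProbabilityMeasure (E d)) (γ : ℝ → E d → E d) :
    0 ≤ ∫ t in (0 : ℝ)..1, momentumNorm μ γ t ^ 2 :=
  intervalIntegral.integral_nonneg zero_le_one fun _ _ => sq_nonneg _

theorem RegularPair.integral_edEnergy_nonneg (h : RegularPair R μ γ) :
    0 ≤ ∫ t in (0 : ℝ)..1, edEnergy (μ t) (γ t) := by
  refine intervalIntegral.integral_nonneg_of_ae_restrict zero_le_one ?_
  filter_upwards [h.momentum.ae_integrable h.cont, h.zeroMean] with t ht ht0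
  exact edEnergy_nonneg (h.supp t) ht ht0

theorem RegularPair.actionEnergy_nonneg (h : RegularPair R μ γ) : 0 ≤ actionEnergy μ γ :=
  add_nonneg h.integral_edEnergy_nonneg (integral_momentumNorm_sq_nonneg μ γ)

/-- Nonnegativity of the action moves the problem to `ℝ≥0∞`, where infima exist and ultrafilter
limits are automatic. -/
theorem RegularPair.energy_eq (h : RegularPair R μ γ)
    (L : ProbabilityMeasure (E d) → ProbabilityMeasure (E d) → ℝ≥0∞) (ν : ProbabilityMeasure (E d)) :
    energy L ν μ γ = ((L (μ 1) ν + ENNReal.ofReal (actionEnergy μ γ) : ℝ≥0∞) : EReal) := by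
  rw [EReal.coe_ennreal_add, EReal.coe_ennreal_ofReal, max_eq_left h.actionEnergy_nonneg,
    energy, actionEnergy]
  simp only [momentumNorm_sq]

theorem CurveLimit.tendsto_apply (h : CurveLimit R l M μ) (t : ℝ) :
    Tendsto (fun i => M i t) l (𝓝 (μ t)) :=
  (h.tendsto t).comp (tendsto_id.prodMk tendsto_const_nhds)

/-- Compactness of regular pairs with bounded energy. -/
theorem exists_regularPair_limit (𝒰 : Ultrafilter ι) {Γ : ι → ℝ → E d → E d} {B : ℝ}
    (h : ∀ i, RegularPair R (M i) (Γ i))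
    (hB : ∀ i, actionEnergy (M i) (Γ i) ≤ B)
    (hM : ∀ i t, M i t = M i (projIcc (0 : ℝ) 1 zero_le_one t)) :
    ∃ (μ : ℝ → ProbabilityMeasure (E d)) (γ : ℝ → E d → E d) (b : ℝ), RegularPair R μ γ ∧
      (∀ t, Tendsto (fun i => M i t) 𝒰 (𝓝 (μ t))) ∧
      Tendsto (fun i => actionEnergy (M i) (Γ i)) 𝒰 (𝓝 b) ∧ actionEnergy μ γ ≤ b := by
  have hBN : ∀ i, ∫ t in (0 : ℝ)..1, momentumNorm (M i) (Γ i) t ^ 2 ≤ B := fun i =>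
    (le_add_of_nonneg_left (h i).integral_edEnergy_nonneg).trans (hB i)
  have hBI : ∀ i, ∫ t in (0 : ℝ)..1, edEnergy (M i t) (Γ i t) ≤ B := fun i =>
    (le_add_of_nonneg_right (integral_momentumNorm_sq_nonneg _ _)).trans (hB i)
  obtain ⟨μ, hμ⟩ := exists_curveLimit 𝒰 h hBN hM
  have hlim : ∀ f : ι → ℝ, (∀ i, f i ∈ Icc 0 B) → ∃ c, Tendsto f 𝒰 (𝓝 c) := fun f hf => by
    obtain ⟨c, -, hc⟩ := isCompact_Icc.ultrafilter_le_nhds (𝒰.map f) (s := Icc 0 B)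
      (by rw [le_principal_iff, Ultrafilter.coe_map]; exact mem_map.2 (univ_mem' hf))
    exact ⟨c, hc⟩
  obtain ⟨a, ha⟩ := hlim _ fun i => ⟨integral_momentumNorm_sq_nonneg _ _, hBN i⟩
  obtain ⟨q, hq⟩ := hlim _ fun i => ⟨(h i).integral_edEnergy_nonneg, hBI i⟩
  have hΓ := fun i => (h i).momentum
  obtain ⟨γ, hγ, hγa, hγP⟩ := exists_tendsto_pairing 𝒰 hμ hΓ ha
  refine ⟨μ, γ, q + a, ⟨hμ.cont, hμ.supp, hγ, ?_, ?_⟩, hμ.tendsto_apply, hq.add ha,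
    add_le_add ?_ hγa⟩
  · exact hμ.zeroMean hΓ (fun i => (h i).zeroMean) hγ hγP
  · exact hμ.continuityEquation hΓ hBN (fun i => (h i).continuity) hγ hγP
  · exact hμ.integral_edEnergy_le hΓ (fun i => (h i).zeroMean) hγ hγP hq

theorem isClosed_probOn {Ω : Set (E d)} (hΩ : IsClosed Ω) : IsClosed (probOn Ω) := by
  refine isClosed_iff_forall_filter.2 fun α F hF hFs hFα => ?_
  have h1 := ProbabilityMeasure.le_liminf_measure_open_of_tendsto (μs := id) (L := F) hFα hΩ.isOpen_compl
  have h2 : liminf (fun β : ProbabilityMeasure (E d) => (β : Measure (E d)) Ωᶜ) F = 0 := by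
    refine (liminf_congr (v := fun _ => 0) ?_).trans (liminf_const 0)
    exact le_principal_iff.1 hFs
  exact le_antisymm (h1.trans h2.le) zero_le

/-- The resting curve provides a competitor, and a minimizer when every competitor has infinite
energy. -/
theorem regularPair_const {μ₀ : ProbabilityMeasure (E d)}
    (h : (μ₀ : Measure (E d)) (Metric.closedBall 0 R)ᶜ = 0) :
    RegularPair R (fun _ => μ₀) (fun _ _ => 0) where
  cont := continuous_const
  supp _ := h
  momentum := ⟨measurable_const, by simp⟩
  zeroMean := by simp
  continuity := by
    intro φ hφ hφc hφs
    have hz : ∀ x : E d, edConv μ₀ (fun _ => 0) x = 0 := fun x => by simp [edConv]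
    simp only [hz, inner_zero_left, add_zero]
    have hD := continuous_deriv_time hφ
    have hi : Integrable (Function.uncurry fun (t : ℝ) (x : E d) => deriv (fun s => φ (s, x)) t)
        ((volume.restrict (Ioc (0 : ℝ) 1)).prod (μ₀ : Measure (E d))) := by
      have hc : HasCompactSupport fun p : ℝ × E d => deriv (fun s => φ (s, p.2)) p.1 := by
        simp only [deriv_time_eq hφ]
        exact (hφc.fderiv (𝕜 := ℝ)).comp_left (g := fun T : ℝ × E d →L[ℝ] ℝ => T (1, 0)) rfl
      obtain ⟨C, hC⟩ := hD.bounded_above_of_compact_support hc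
      exact Integrable.of_bound hD.aestronglyMeasurable C (ae_of_all _ hC)
    rw [intervalIntegral.integral_of_le zero_le_one, integral_integral_swap hi]
    refine integral_eq_zero_of_ae (ae_of_all _ fun x => ?_)
    have hx : ContDiff ℝ ∞ fun s : ℝ => φ (s, x) := hφ.comp (contDiff_id.prodMk contDiff_const)
    have h0 : ∀ s : ℝ, s ∉ Ioo (0 : ℝ) 1 → φ (s, x) = 0 := fun s hs =>
      image_eq_zero_of_notMem_tsupport fun hm => hs (hφs hm).1
    change ∫ t in Ioc (0 : ℝ) 1, deriv (fun s => φ (s, x)) t = 0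
    rw [← intervalIntegral.integral_of_le zero_le_one, intervalIntegral.integral_deriv_eq_sub
      (fun s _ => hx.differentiable (by simp) s)
      ((hx.continuous_deriv (by simp)).intervalIntegrable _ _), h0 1 (by simp), h0 0 (by simp),
      sub_zero]

theorem exists_minimizer {Ω : Set (E d)} (hΩ : IsClosed Ω) {μ₀ : ProbabilityMeasure (E d)}
    (hμ₀ : ∃ C ⊆ Ω, IsCompact C ∧ μ₀ ∈ probOn C) (ν : ProbabilityMeasure (E d))
    (L : ProbabilityMeasure (E d) → ProbabilityMeasure (E d) → ℝ≥0∞)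
    (hL : LowerSemicontinuousOn (fun α => L α ν) (probOn Ω)) :
    ∃ (μ : ℝ → ProbabilityMeasure (E d)) (γ : ℝ → E d → E d), Admissible Ω μ₀ μ γ ∧
      ∀ μ' γ', Admissible Ω μ₀ μ' γ' → energy L ν μ γ ≤ energy L ν μ' γ' := by
  obtain ⟨C, hCΩ, hC, hμC⟩ := hμ₀
  obtain ⟨R₀, hR₀⟩ := hC.isBounded.subset_closedBall (0 : E d)
  have h0 : (μ₀ : Measure (E d)) (Metric.closedBall 0 R₀)ᶜ = 0 :=
    measure_mono_null (compl_subset_compl.2 hR₀) hμC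
  have hμΩ : μ₀ ∈ probOn Ω := measure_mono_null (compl_subset_compl.2 hCΩ) hμC
  have hconst := regularPair_const h0
  have hconst' : Admissible Ω μ₀ (fun _ => μ₀) (fun _ _ => 0) :=
    hconst.admissible hΩ rfl fun _ _ => hμΩ
  let J : (ℝ → ProbabilityMeasure (E d)) → (ℝ → E d → E d) → ℝ≥0∞ := fun μ γ =>
    L (μ 1) ν + ENNReal.ofReal (actionEnergy μ γ)
  -- Regular pairs of arbitrary radius replace admissible ones: clamping leads one way and
  -- `RegularPair.admissible` the other.
  let S : Set ℝ≥0∞ := {e | ∃ μ γ R, RegularPair R μ γ ∧ μ 0 = μ₀ ∧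
    (∀ t ∈ Icc (0 : ℝ) 1, μ t ∈ probOn Ω) ∧ J μ γ = e}
  have hS : S.Nonempty := ⟨_, _, _, _, hconst, rfl, fun _ _ => hμΩ, rfl⟩
  have hle : ∀ μ' γ', Admissible Ω μ₀ μ' γ' → ((sInf S : ℝ≥0∞) : EReal) ≤ energy L ν μ' γ' := by
    intro μ' γ' h
    obtain ⟨R, hR⟩ := h.exists_regularPair
    have hcl : ∀ t ∈ Icc (0 : ℝ) 1, clampCurve μ' t = μ' t := fun t ht => clampCurve_of_mem ht
    rw [← energy_congr hcl, hR.energy_eq, EReal.coe_ennreal_le_coe_ennreal_iff]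
    refine sInf_le ⟨_, _, R, hR, ?_, fun t ht => ?_, rfl⟩
    · rw [hcl 0 (by simp), h.initial]
    · rw [hcl t ht]; exact h.mem_probOn ht
  suffices hsuff : ∃ μ γ, Admissible Ω μ₀ μ γ ∧ energy L ν μ γ ≤ ((sInf S : ℝ≥0∞) : EReal) by
    obtain ⟨μ, γ, h1, h2⟩ := hsuff
    exact ⟨μ, γ, h1, fun μ' γ' h' => h2.trans (hle μ' γ' h')⟩
  rcases eq_or_ne (sInf S) ⊤ with htop | htop
  · refine ⟨_, _, hconst', ?_⟩
    rw [htop, EReal.coe_ennreal_top]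
    exact le_top
  obtain ⟨u, hu, hut, huS⟩ := exists_seq_tendsto_sInf hS (OrderBot.bddBelow S)
  -- Dropping the first `n₀` terms keeps all energies below the infimum plus one, as `u` is
  -- antitone; this is the bound that fixes the common radius `K`.
  obtain ⟨n₀, hn₀⟩ := (hut.eventually (Iio_mem_nhds (ENNReal.lt_add_right htop one_ne_zero))).exists
  choose M Γ R hreg hM0 hMΩ hJ using fun n => huS (n + n₀)
  set b : ℝ≥0∞ := sInf S + 1
  have hb : b ≠ ⊤ := ENNReal.add_ne_top.2 ⟨htop, ENNReal.one_ne_top⟩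
  have hE : ∀ n, actionEnergy (M n) (Γ n) ≤ b.toReal := fun n => by
    refine (ENNReal.ofReal_le_iff_le_toReal hb).1 ?_
    calc _ ≤ J (M n) (Γ n) := le_add_self
      _ = u (n + n₀) := hJ n
      _ ≤ u n₀ := hu (Nat.le_add_left _ _)
      _ ≤ b := le_of_lt hn₀
  obtain ⟨K, hK⟩ := exists_uniform_radius d R₀ b.toReal
  have hcl : ∀ n, ∀ t ∈ Icc (0 : ℝ) 1, clampCurve (M n) t = M n t := fun n t ht =>
    clampCurve_of_mem ht
  have hregK : ∀ n, RegularPair K (clampCurve (M n)) (Γ n) := fun n =>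
    (hreg n).clampCurve_of_supp (hK (R n) _ _ (hreg n) (by rw [hM0]; exact h0)
      ((le_add_of_nonneg_left (hreg n).integral_edEnergy_nonneg).trans (hE n)))
  have hJcl : ∀ n, J (clampCurve (M n)) (Γ n) = J (M n) (Γ n) := fun n => by
    have := energy_congr (L := L) (ν := ν) (γ := Γ n) (hcl n)
    rwa [(hregK n).energy_eq, (hreg n).energy_eq, EReal.coe_ennreal_eq_coe_ennreal_iff] at this
  have hE' : ∀ n, actionEnergy (clampCurve (M n)) (Γ n) ≤ b.toReal := fun n => by
    refine (ENNReal.ofReal_le_iff_le_toReal hb).1 ?_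
    calc _ ≤ J (clampCurve (M n)) (Γ n) := le_add_self
      _ = u (n + n₀) := (hJcl n).trans (hJ n)
      _ ≤ u n₀ := hu (Nat.le_add_left _ _)
      _ ≤ b := le_of_lt hn₀
  let 𝒰 : Ultrafilter ℕ := hyperfilter ℕ
  obtain ⟨μ, γ, c, hμγ, hμ, hc, hcle⟩ := exists_regularPair_limit 𝒰 hregK hE'
    fun n t => clampCurve_projIcc t
  obtain ⟨a, -, ha⟩ := isCompact_univ.ultrafilter_le_nhds
    (𝒰.map fun n => L (clampCurve (M n) 1) ν) (by simp)
  have ha' : Tendsto (fun n => L (clampCurve (M n) 1) ν) 𝒰 (𝓝 a) := ha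
  have hJlim : a + ENNReal.ofReal c = sInf S := by
    refine tendsto_nhds_unique (ha'.add (ENNReal.tendsto_ofReal hc)) ?_
    have h1 : Tendsto (fun n => u (n + n₀)) 𝒰 (𝓝 (sInf S)) :=
      ((tendsto_add_atTop_iff_nat n₀).2 hut).mono_left Nat.hyperfilter_le_atTop
    exact h1.congr fun n => ((hJcl n).trans (hJ n)).symm
  have hmem : ∀ n, ∀ t ∈ Icc (0 : ℝ) 1, clampCurve (M n) t ∈ probOn Ω := fun n t ht => by
    rw [hcl n t ht]; exact hMΩ n t ht
  have hμΩ' : ∀ t ∈ Icc (0 : ℝ) 1, μ t ∈ probOn Ω := fun t ht =>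
    (isClosed_probOn hΩ).mem_of_tendsto (hμ t) (Eventually.of_forall fun n => hmem n t ht)
  have hμ0 : μ 0 = μ₀ := tendsto_nhds_unique (hμ 0)
    (tendsto_const_nhds.congr fun n => by rw [hcl n 0 (by simp), hM0])
  have h1 : (1 : ℝ) ∈ Icc (0 : ℝ) 1 := by simp
  -- The loss is semicontinuous only within measures on `Ω`, so the convergence at time one is taken
  -- inside `probOn Ω`.
  have hLa : L (μ 1) ν ≤ a := le_of_forall_lt_imp_le_of_dense fun r hr => by
    have hw : Tendsto (fun n => clampCurve (M n) 1) 𝒰 (𝓝[probOn Ω] (μ 1)) :=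
      tendsto_nhdsWithin_iff.2 ⟨hμ 1, Eventually.of_forall fun n => hmem n 1 h1⟩
    exact ge_of_tendsto ha' ((hw.eventually (hL _ (hμΩ' 1 h1) r hr)).mono fun n hn => hn.le)
  refine ⟨μ, γ, hμγ.admissible hΩ hμ0 hμΩ', ?_⟩
  rw [hμγ.energy_eq, EReal.coe_ennreal_le_coe_ennreal_iff, ← hJlim]
  exact add_le_add hLa (ENNReal.ofReal_le_ofReal hcle)

end

end MomentumMatching

theorem mainTheorem3 (d : ℕ) (Ω : Set (EuclideanSpace ℝ (Fin d))) (hΩ : IsClosed Ω)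
    (μ₀ : ProbabilityMeasure (EuclideanSpace ℝ (Fin d)))
    (hμ₀ : ∃ C ⊆ Ω, IsCompact C ∧ μ₀ ∈ probOn C)
    (ν : ProbabilityMeasure (EuclideanSpace ℝ (Fin d))) (hν : ν ∈ probOn Ω)
    (L : ProbabilityMeasure (EuclideanSpace ℝ (Fin d)) →
      ProbabilityMeasure (EuclideanSpace ℝ (Fin d)) → ℝ≥0∞)
    (hL : LowerSemicontinuousOn (fun α => L α ν) (probOn Ω)) :
    ∃ (μ : ℝ → ProbabilityMeasure (EuclideanSpace ℝ (Fin d)))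
      (γ : ℝ → EuclideanSpace ℝ (Fin d) → EuclideanSpace ℝ (Fin d)),
      Admissible Ω μ₀ μ γ ∧
      ∀ μ' γ', Admissible Ω μ₀ μ' γ' → energy L ν μ γ ≤ energy L ν μ' γ' := by
  exact exists_minimizer hΩ hμ₀ ν L hL
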